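/- **Setting.** Let $N\ge 1$, let $q=e^{\eta}\in\mathbb C^*$ with $q\neq q^{-1}$, put $q^x=e^{\eta x}$ and $[x]=\frac{q^x-q^{-x}}{q-q^{-1}}$, and let $\omega,\delta,\lambda\in\mathbb C$. Assume $[k]\ne0$ for $2\le k\le N$ and $[\omega+1]\neq 0$. Put $k(u,\delta)=[\tfrac{\omega+\delta}2+u][\tfrac{\omega-\delta}2+u]$ and $n=\lfloor\frac{N+1}2\rfloor$. *Paths.* $\mathcal B_N$ is the set of Ballot paths, i.e. integer vectors $\alpha=(\alpha_0,\dots,\alpha_N)$ with $\alpha_i\ge 0$, $\alpha_{i+1}-\alpha_i=\pm1$, $\alpha_N=0$; $\Omega=(N,N-1,\dots,1,0)$ is the maximal one. The generators $e_0,\dots,e_{N-1}$ of the type B (one-boundary) Temperley–Lieb algebra act on the span of the states $|\alpha\rangle$, $\alpha\in\mathcal B_N$, as follows. For $1\le i\le N-1$: - if $\alpha$ has a local minimum at $i$, $e_i$ raises $\alpha_i$ by $2$; - if $\alpha$ has a local maximum at $i$, $e_i|\alpha\rangle=-[2]|\alpha\rangle$; - if $\alpha_{i-1}<\alpha_i<\alpha_{i+1}$,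 $e_i$ lowers by $2$ all heights strictly between $i$ and the first $j>i$ with $\alpha_j=\alpha_i$; - if $\alpha_{i-1}>\alpha_i>\alpha_{i+1}$ and some $k<i$ has $\alpha_k=\alpha_i$, $e_i$ lowers by $2$ all heights strictly between the last such $k$ and $i$; if there is no such $k$, $e_i$ lowers by $2$ all $\alpha_l$ with $l<i$, and multiplies by $-\frac{[\omega]}{[\omega+1]}$ when $i$ is even. Further, $e_0$ raises $\alpha_0$ by $2$ if $\alpha_0<\alpha_1$, and $e_0|\alpha\rangle=-\frac{[\omega]}{[\omega+1]}|\alpha\rangle$ if $\alpha_0>\alpha_1$. Put $$R_i(u)=\frac{[1-u]-[u]e_i}{[1+u]},\qquad K_0(u)=\frac{k(u,\delta)+[2u][\omega+1]e_0}{k(-u,\delta)} .$$ *Functions.* Let $\pi_i$ ($1\le i\le N-1$), $\pi_0$, $\pi_N$ act on functions of $(x_1,\dots,x_N)$ by exchanging the arguments $x_i,x_{i+1}$, by $x_1\mapsto -x_1$ and by $x_N\mapsto-\lambda-x_N$, respectively. Functions are complex valued functions on a set $D\subset\mathbb C^N$ that is stable under these permutations and reflections and on which $[x_i-x_{i+1}]$,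 $[1+x_i-x_{i+1}]$ ($1\le i\le N-1$), $[2x_1]$ and $k(x_1,\delta)$ vanish nowhere. The type B qKZ equations for $|\Psi\rangle=\sum_{\alpha\in\mathcal B_N}\psi_\alpha|\alpha\rangle$ are $$R_i(x_i-x_{i+1})|\Psi\rangle=\pi_i|\Psi\rangle\ (1\le i\le N-1),\qquad K_0(-x_1)|\Psi\rangle=\pi_0|\Psi\rangle,\qquad |\Psi\rangle=\pi_N|\Psi\rangle .$$ *Factorised operators.* Let $s_i=\frac{[x_i-x_{i+1}+1]}{[x_i-x_{i+1}]}(1-\pi_i)$ for $1\le i\le N-1$, $s_0=\frac{k(x_1,\delta)}{[2x_1][\omega+1]}(1-\pi_0)$, and for positive integers $u$ $$h_i(u)=s_i-\frac{[u-1]}{[u]}\ (i\geq1),\qquad h_0(u)=s_0-\frac{[\lfloor u/2\rfloor]\,[\omega+\lfloor (u+1)/2\rfloor]}{[u][\omega+1]} .$$ For a path $\alpha$ with steps $\pm1$, $\alpha_N=0$ and heights $\ge-1$, fill the region between $\alpha$ and $\Omega$ with tiles (half-tiles in column $0$): column $i$, $0\le i\le N-1$, contains the tiles $(i,j)$ with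 $\alpha_i<j<N-i$ and $j-\alpha_i$ odd. Give the tile $(i,j)$ the integer $u_{i,j}=1$ if there are no tiles at $(i\pm1,j-1)$, and otherwise $u_{i,j}=1+{}$the maximum of the integers of the tiles at $(i\pm1,j-1)$. Let $H_\alpha$ be the product of the $h_i(u_{i,j})$ over all these tiles, ordered so that the integers $u_{i,j}$ do not decrease from left to right. For $1\le k\le n$ let $\gamma(k)$ be the (non-Ballot) path with steps $\pm1$ and $\gamma(k)_N=0$ having only one minimum, at the point $m=2k-1-(N\bmod 2)$, with $\gamma(k)_m=-1$; explicitly $\gamma(k)_j=\min(|j-m|-1,\,N-j)$. Put $H^{\rm B}_k=H_{\gamma(k)}$. **Proposition.** If $(\psi_\alpha)_{\alpha\in\mathcal B_N}$ satisfies the type B qKZ equations, then the base function $\psi_\Omega$ satisfies the truncation conditions $$H^{\rm B}_k\,\psi_\Omega=0\qquad\text{for all } k=1,\dots,n. \tag{3}$$ Moreover, a family of functions $(\psi_\alpha)_{\alpha\in\mathcal B_N}$ satisfies the type B qKZ equations if and only if the following three conditions hold together: 1. $\displaystyle \psi_\Omega(x_1,\dots,x_N)=\prod_{1\le i<j\le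 N}[1+x_i-x_j]\,[\lambda+1+x_i+x_j]\;\;\xi\bigl(x_1+\tfrac\lambda2,\dots,x_N+\tfrac\lambda2\bigr)$ for some function $\xi$ that is symmetric and even in all of its variables; 2. $\psi_\alpha=H_\alpha\psi_\Omega$ for all $\alpha\in\mathcal B_N$; 3. the truncation conditions (3). -/

import Mathlib

namespace TypeBqKZ

/-- The parameters: `η` is a logarithm of `q` (so that `q ^ x := exp (η x)`), `ω` is the parameter of
the algebra, `δ` the parameter of the reflection matrix and `lam` the level parameter `λ`. -/
structure Params where
  η : ℂ
  ω : ℂ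
  δ : ℂ
  lam : ℂ

/-- The `q`-number `[x] = (q^x - q^{-x}) / (q - q^{-1})`, where `q^x = exp (η x)`. -/
noncomputable def qn (P : Params) (x : ℂ) : ℂ :=
  (Complex.exp (P.η * x) - Complex.exp (-(P.η * x))) / (Complex.exp P.η - Complex.exp (-P.η))

/-- `k(u, δ) = [(ω + δ)/2 + u] [(ω - δ)/2 + u]`. -/
noncomputable def kfun (P : Params) (u : ℂ) : ℂ :=
  qn P ((P.ω + P.δ) / 2 + u) * qn P ((P.ω - P.δ) / 2 + u)

/-! ### Paths and the Ballot path representation -/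

/-- A vector of local integer heights `(α_0, …, α_N)`. -/
abbrev Heights (N : ℕ) : Type := Fin (N + 1) → ℤ

/-- Ballot paths: `α_{i+1} - α_i = ±1`, `α_i ≥ 0`, `α_N = 0`. -/
def IsBallot {N : ℕ} (α : Heights N) : Prop :=
  (∀ i : Fin N, α i.succ - α i.castSucc = 1 ∨ α i.succ - α i.castSucc = -1) ∧
    (∀ i, 0 ≤ α i) ∧ α (Fin.last N) = 0

/-- The set `𝓑_N` of Ballot paths of length `N`. -/
abbrev BallotPath (N : ℕ) : Type := {α : Heights N // IsBallot α}

theorem IsBallot.le {N : ℕ} {α : Heights N} (h : IsBallot α) (i : Fin (N + 1)) :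
    α i ≤ (N : ℤ) - (i : ℕ) := by
  induction i using Fin.reverseInduction with
  | last => simp [h.2.2]
  | cast i ih =>
    have h1 := h.1 i
    simp only [Fin.val_succ, Fin.val_castSucc] at *
    push_cast at ih
    omega

instance (N : ℕ) : Finite (BallotPath N) := by
  refine Set.Finite.to_subtype
    ((Set.finite_Icc (0 : Heights N) (fun _ => (N : ℤ))).subset ?_)
  intro α hα
  refine ⟨fun i => hα.2.1 i, fun i => (IsBallot.le hα i).trans ?_⟩
  simp

noncomputable instance (N : ℕ) : Fintype (BallotPath N) := Fintype.ofFinite _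

/-- The maximal Ballot path `Ω = (N, N - 1, …, 1, 0)`. -/
def omega (N : ℕ) : BallotPath N :=
  ⟨fun i => (N : ℤ) - (i : ℕ), by
    refine ⟨fun i => Or.inr ?_, fun i => ?_, ?_⟩
    · simp only [Fin.val_succ, Fin.val_castSucc]
      push_cast
      ring
    · have := i.is_le
      simp only [sub_nonneg]
      exact_mod_cast this
    · simp⟩

/-- The non-Ballot path `γ(k)`, `1 ≤ k ≤ ⌊(N+1)/2⌋`: with `m = 2k - (N mod 2) - 1` it takes the value
`-1` at `m`, which is its only minimum; it comes down to `m` from the left boundary, goes up to the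
right of `m` until it meets the maximal path `Ω`, and then follows `Ω` down to the height `0`
at `N`. -/
def gamma (N k : ℕ) : Heights N := fun j =>
  min (|((j : ℕ) : ℤ) - (2 * (k : ℤ) - ((N % 2 : ℕ) : ℤ) - 1)| - 1) ((N : ℤ) - (j : ℕ))

/-- The index `i - 1` (it is only used for `i ≥ 1`). -/
def prev {N : ℕ} (i : Fin N) : Fin N := ⟨(i : ℕ) - 1, by omega⟩

/-- The heights `α_{i-1}`, `α_i`, `α_{i+1}` around the point `i`, `1 ≤ i ≤ N - 1`. -/
def htL {N : ℕ} (α : Heights N) (i : Fin N) : ℤ := α (prev i).castSucc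
/-- See `htL`. -/
def htM {N : ℕ} (α : Heights N) (i : Fin N) : ℤ := α i.castSucc
/-- See `htL`. -/
def htR {N : ℕ} (α : Heights N) (i : Fin N) : ℤ := α i.succ

open Classical in
/-- The heights of the path which is proportional to `e_i |α⟩`, for `i = 0, …, N - 1`. -/
noncomputable def imagePath {N : ℕ} (i : Fin N) (α : Heights N) : Heights N := fun j =>
  if (i : ℕ) = 0 then
    -- boundary generator: an uphill slope at `0` is turned into a downhill slope
    if htM α i < htR α i ∧ j = i.castSucc then α j + 2 else α j
  else if htM α i < htL α i ∧ htM α i < htR α i then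
    -- local minimum
    if j = i.castSucc then α j + 2 else α j
  else if htL α i < htM α i ∧ htR α i < htM α i then
    -- local maximum
    α j
  else if htL α i < htM α i then
    -- uphill slope: lower by two the points between `i` and the first return to the height `α_i`
    if i.castSucc < j ∧ ∀ l, i.castSucc < l → l ≤ j → htM α i < α l then α j - 2 else α j
  else
    -- downhill slope: lower by two the points between `i` and the last previous visit to the height
    -- `α_i`, or the left boundary if there is no such visit
    if j < i.castSucc ∧ ∀ l, j ≤ l → l < i.castSucc → htM α i < α l then α j - 2 else α j

open Classical in
/-- The coefficient with which `e_i |α⟩` is proportional to the path `imagePath i α`. -/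
noncomputable def imageCoeff (P : Params) {N : ℕ} (i : Fin N) (α : Heights N) : ℂ :=
  if (i : ℕ) = 0 then
    if htM α i < htR α i then 1 else -(qn P P.ω / qn P (P.ω + 1))
  else if htL α i < htM α i ∧ htR α i < htM α i then
    -- local maximum
    -qn P 2
  else if htM α i < htL α i ∧ htR α i < htM α i ∧ Even (i : ℕ) ∧
      ∀ l, l < i.castSucc → htM α i < α l then
    -- downhill slope at an even point, all the heights to the left of `i` being greater than `α_i`
    -(qn P P.ω / qn P (P.ω + 1))
  else 1

open Classical in
/-- The matrix of the generator `e_i` (`i = 0, …, N - 1`) in the Ballot path representation of the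
Temperley-Lieb algebra of type `B_N`: the column `α` lists the coefficients of `e_i |α⟩`. -/
noncomputable def eMat (P : Params) {N : ℕ} (i : Fin N) :
    Matrix (BallotPath N) (BallotPath N) ℂ :=
  Matrix.of fun β α => if β.1 = imagePath i α.1 then imageCoeff P i α.1 else 0

open Classical in
/-- The R-matrix `R_i(u) = ([1 - u] - [u] e_i) / [1 + u]`, `1 ≤ i ≤ N - 1`. -/
noncomputable def RMat (P : Params) {N : ℕ} (i : Fin N) (u : ℂ) :
    Matrix (BallotPath N) (BallotPath N) ℂ :=
  (qn P (1 + u))⁻¹ • (qn P (1 - u) • (1 : Matrix (BallotPath N) (BallotPath N) ℂ) -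
    qn P u • eMat P i)

open Classical in
/-- The reflection matrix `K_0(u) = (k(u, δ) + [2u] [ω + 1] e_0) / k(-u, δ)`. -/
noncomputable def KMat (P : Params) {N : ℕ} [NeZero N] (u : ℂ) :
    Matrix (BallotPath N) (BallotPath N) ℂ :=
  (kfun P (-u))⁻¹ • (kfun P u • (1 : Matrix (BallotPath N) (BallotPath N) ℂ) +
    (qn P (2 * u) * qn P (P.ω + 1)) • eMat P (0 : Fin N))

/-! ### Functions of `x_1, …, x_N`

The variable `x_i` of the text is the coordinate with index `i - 1`; hence for `1 ≤ i ≤ N - 1` the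
variables `x_i` and `x_{i+1}` are `x (prev i)` and `x i`. -/

/-- `(…, x_i, x_{i+1}, …) ↦ (…, x_{i+1}, x_i, …)`. -/
def swapVars {N : ℕ} (i : Fin N) (x : Fin N → ℂ) : Fin N → ℂ :=
  fun j => x (Equiv.swap (prev i) i j)

/-- `(x_1, …) ↦ (-x_1, …)`. -/
def reflFirst {N : ℕ} [NeZero N] (x : Fin N → ℂ) : Fin N → ℂ :=
  Function.update x 0 (-x 0)

/-- The last index. -/
def lastVar (N : ℕ) [NeZero N] : Fin N := ⟨N - 1, Nat.sub_lt (NeZero.pos N) Nat.one_pos⟩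

/-- `(…, x_N) ↦ (…, -λ - x_N)`. -/
def reflLast (P : Params) {N : ℕ} [NeZero N] (x : Fin N → ℂ) : Fin N → ℂ :=
  Function.update x (lastVar N) (-P.lam - x (lastVar N))

/-- A set of points of `ℂ^N` on which the operators of the qKZ equation act on functions: it is
stable under the permutations and the two boundary reflections of the arguments, and the
denominators of these operators do not vanish on it. (For instance, one may take all the points of
`ℂ^N` outside of the hypersurfaces on which one of the denominators, or of their images under
permutations and reflections, vanishes, or the complement in that set of the poles of a meromorphic
solution.) -/
structure Domain (P : Params) (N : ℕ) [NeZero N] where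
  carrier : Set (Fin N → ℂ)
  swap_mem : ∀ i : Fin N, 1 ≤ (i : ℕ) → ∀ x ∈ carrier, swapVars i x ∈ carrier
  reflFirst_mem : ∀ x ∈ carrier, reflFirst x ∈ carrier
  reflLast_mem : ∀ x ∈ carrier, reflLast P x ∈ carrier
  diff_ne : ∀ i : Fin N, 1 ≤ (i : ℕ) → ∀ x ∈ carrier, qn P (x (prev i) - x i) ≠ 0
  one_add_diff_ne : ∀ i : Fin N, 1 ≤ (i : ℕ) → ∀ x ∈ carrier, qn P (1 + (x (prev i) - x i)) ≠ 0
  two_mul_ne : ∀ x ∈ carrier, qn P (2 * x 0) ≠ 0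
  kfun_ne : ∀ x ∈ carrier, kfun P (x 0) ≠ 0

section Operators

variable {P : Params} {N : ℕ} [NeZero N] (D : Domain P N)

/-- Functions of `(x_1, …, x_N) ∈ D`. -/
abbrev Fn : Type := D.carrier → ℂ

/-- The permutation of the arguments `x_i, x_{i+1}`, for `1 ≤ i ≤ N - 1`, and the reflection of the
argument `x_1`, for `i = 0`, as a map of `D` to itself. -/
def move (i : Fin N) (x : D.carrier) : D.carrier :=
  if h : 1 ≤ (i : ℕ) then ⟨swapVars i x.1, D.swap_mem i h x.1 x.2⟩
  else ⟨reflFirst x.1, D.reflFirst_mem x.1 x.2⟩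

/-- The reflection of the argument `x_N` as a map of `D` to itself. -/
def moveLast (x : D.carrier) : D.carrier := ⟨reflLast P x.1, D.reflLast_mem x.1 x.2⟩

/-- The operators `π_0, …, π_{N-1}` on functions. -/
noncomputable def piOp (i : Fin N) : Module.End ℂ (Fn D) := LinearMap.funLeft ℂ ℂ (move D i)

/-- The symmetrizers in the functional representation:
`s_i = [x_i - x_{i+1} + 1] / [x_i - x_{i+1}] (1 - π_i)` for `1 ≤ i ≤ N - 1` and
`s_0 = k(x_1, δ) / ([2 x_1] [ω + 1]) (1 - π_0)`. -/
noncomputable def sOp (i : Fin N) : Module.End ℂ (Fn D) :=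
  LinearMap.mulLeft ℂ (fun x : D.carrier =>
    if 1 ≤ (i : ℕ) then
      qn P (x.1 (prev i) - x.1 i + 1) / qn P (x.1 (prev i) - x.1 i)
    else kfun P (x.1 0) / (qn P (2 * x.1 0) * qn P (P.ω + 1))) * (1 - piOp D i)

/-- The Baxterised element of the (half-)tile in the column `i` with the integer `u`:
`h_i(u) = s_i - [u - 1] / [u]` for `1 ≤ i ≤ N - 1` and
`h̄_0(u) = s_0 - [⌊u/2⌋] [ω + ⌊(u+1)/2⌋] / ([u] [ω + 1])`. -/
noncomputable def hOp (i : Fin N) (u : ℕ) : Module.End ℂ (Fn D) :=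
  if 1 ≤ (i : ℕ) then sOp D i - (qn P ((u : ℂ) - 1) / qn P u) • 1
  else sOp D i -
    (qn P ((u / 2 : ℕ) : ℂ) * qn P (P.ω + (((u + 1) / 2 : ℕ) : ℂ)) /
      (qn P u * qn P (P.ω + 1))) • 1

end Operators

/-! ### The (half-)tiles between a path and the maximal path -/

/-- `IsTile α i j`: a (half-)tile centred in the column `i` at the height `j` belongs to the
complement of the path `α` to the maximal path `Ω`. (The paths considered here have heights `≥ -1`,
so that the tiles have heights `≥ 0`.) -/
def IsTile {N : ℕ} (α : Heights N) (i : Fin N) (j : ℕ) : Prop :=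
  α i.castSucc < (j : ℤ) ∧ (j : ℤ) < (omega N).1 i.castSucc ∧ Odd ((j : ℤ) - α i.castSucc)

open Classical in
/-- The integer `u_{i,j}` of the (half-)tile in the column `i` at the height `j`: it is `1` if there
are no tiles in the columns `i ± 1` at the height `j - 1`, and is otherwise equal to the maximum of
their integers plus `1`. -/
noncomputable def content {N : ℕ} (α : Heights N) : ℕ → Fin N → ℕ
  | 0, _ => 1
  | j + 1, i => (Finset.univ.filter fun i' : Fin N =>
      ((i' : ℕ) + 1 = i ∨ (i : ℕ) + 1 = i') ∧ IsTile α i' j).sup (content α j) + 1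

open Classical in
/-- The list of the columns `i` of all the (half-)tiles whose integer is `u`. -/
noncomputable def layer {N : ℕ} (α : Heights N) (u : ℕ) : List (Fin N) :=
  (((List.finRange N).product (List.range N)).filter fun t =>
    decide (IsTile α t.1 t.2 ∧ content α t.2 t.1 = u)).map Prod.fst

/-- The factorised operator `H_α`: the product of the Baxterised elements of all the added
(half-)tiles, their integers increasing weakly from left to right. (All the integers lie between
`1` and `N`; factors with the same integer commute.) -/
noncomputable def HOp {P : Params} {N : ℕ} [NeZero N] (D : Domain P N) (α : Heights N) :
    Module.End ℂ (Fn D) :=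
  ((List.range' 1 N).map fun u => ((layer α u).map fun i => hOp D i u).prod).prod

/-! ### The qKZ equation of type B and the ansatz for the base function -/

/-- The vector `|Ψ(x)⟩` of the values of the coefficient functions at a point. -/
def ket {P : Params} {N : ℕ} [NeZero N] {D : Domain P N} (Ψ : BallotPath N → Fn D)
    (x : D.carrier) : BallotPath N → ℂ := fun α => Ψ α x

/-- The qKZ equation of type B: `R_i(x_i - x_{i+1}) |Ψ⟩ = π_i |Ψ⟩` for `1 ≤ i ≤ N - 1`,
`K_0(-x_1) |Ψ⟩ = π_0 |Ψ⟩` and `|Ψ⟩ = π_N |Ψ⟩`. -/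
def QKZ {P : Params} {N : ℕ} [NeZero N] {D : Domain P N} (Ψ : BallotPath N → Fn D) : Prop :=
  (∀ i : Fin N, 1 ≤ (i : ℕ) → ∀ x : D.carrier,
    (RMat P i (x.1 (prev i) - x.1 i)).mulVec (ket Ψ x) = ket Ψ (move D i x)) ∧
  (∀ x : D.carrier, (KMat P (-(x.1 0))).mulVec (ket Ψ x) = ket Ψ (move D 0 x)) ∧
  (∀ x : D.carrier, ket Ψ x = ket Ψ (moveLast D x))

/-- `Δ^-_μ(x_1, …, x_N) = ∏_{i < j} [μ + x_i - x_j]`. -/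
noncomputable def deltaMinus (P : Params) {N : ℕ} (μ : ℂ) (x : Fin N → ℂ) : ℂ :=
  ∏ i, ∏ j ∈ Finset.Ioi i, qn P (μ + x i - x j)

/-- `Δ^+_μ(x_1, …, x_N) = ∏_{i < j} [μ + x_i + x_j]`. -/
noncomputable def deltaPlus (P : Params) {N : ℕ} (μ : ℂ) (x : Fin N → ℂ) : ℂ :=
  ∏ i, ∏ j ∈ Finset.Ioi i, qn P (μ + x i + x j)

/-- Functions which are symmetric and even in all of their variables. -/
def IsEvenSymmetric {N : ℕ} (ξ : (Fin N → ℂ) → ℂ) : Prop :=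
  (∀ (σ : Equiv.Perm (Fin N)) y, ξ (fun i => y (σ i)) = ξ y) ∧
    ∀ (i : Fin N) y, ξ (Function.update y i (-y i)) = ξ y

/-- The ansatz for the base function:
`ψ_Ω = Δ^-_1(x_1, …, x_N) Δ^+_{λ+1}(x_1, …, x_N) ξ(x_1 + λ/2, …, x_N + λ/2)`
with an even symmetric function `ξ`. -/
def BaseAnsatz {P : Params} {N : ℕ} [NeZero N] (D : Domain P N) (ψ : Fn D) : Prop :=
  ∃ ξ : (Fin N → ℂ) → ℂ, IsEvenSymmetric ξ ∧
    ∀ x : D.carrier, ψ x =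
      deltaMinus P 1 x.1 * deltaPlus P (P.lam + 1) x.1 * ξ (fun i => x.1 i + P.lam / 2)

/-- The truncation conditions `H^B_k ψ_Ω = 0`, `H^B_k = H_{γ(k)}`, for `k = 1, …, ⌊(N+1)/2⌋`. -/
def Truncation {P : Params} {N : ℕ} [NeZero N] (D : Domain P N) (ψ : Fn D) : Prop :=
  ∀ k : ℕ, 1 ≤ k → k ≤ (N + 1) / 2 → HOp D (gamma N k) ψ = 0

end TypeBqKZ

/-!
The qKZ equations relate two representations of the Hecke algebra of type `B_N`. On functions it
acts by the divided differences `s_i` (`sFun_heckeRep`). On `ℂ^{𝓑_N}` it acts by the transposes of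
`e_i + [2]` and `e_0 + [ω]/[ω+1]` (`sDual_heckeRep`, which contains the proof that the action of the
`e_i` on Ballot paths satisfies the Temperley-Lieb relations). Written out in components, the
equations for `R_i` and `K_0` say that the linear map `f ↦ ∑_α f(α) ψ_α` intertwines the two
(`qkz_iff_intertwining`).

Let `v` be a vector in any representation with `s_i v = [2] v` for `i ≥ 1`, and consider the vectors
`H_a v`, for all paths `a` with heights at least `-1`. The Yang-Baxter and reflection equations
transport the symmetry of `v` through the tiles, so that `s_j H_a v` is a multiple of `H_a v` unless
`a` has a peak at `j` (`isSym_hVec`). At a peak, `s_j H_a v` is the vector of the path with the peak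
removed, plus vectors of higher paths (`weak_triangularity`). The truncation conditions kill the
vectors of all the paths which are not Ballot paths, since the tiles above `γ(k)` carry the same
integers for every path through the minimum of `γ(k)` (`hVec_eq_zero_of_truncation`). Hence under
these conditions the span of the `H_a v`, `a ∈ 𝓑_N`, is stable (`apply_hVec_mem_span`).

For `v = δ_Ω`, the indicator function of the maximal path in the dual path representation, these
vectors are known exactly: `H_a δ_Ω = δ_a`, and `H_a δ_Ω = 0` if `a` is not a Ballot path
(`hVec_delta`). The proof fills a valley of `a` of maximal height. The tiles in this valley only
produce paths above `a` which agree with `a` outside of the valley (`HighValley.support`), and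
symmetry excludes those with a peak inside the valley (`apply_eq_zero_of_isSym`). This leaves `a`
itself and, if the valley reaches the left boundary, one more candidate: the path
which comes down from the left boundary beyond the valley. Its coefficient vanishes by the choice of
the constants in `h_0(u)` (`rowVec_eq_zero`).

If `ψ` solves the qKZ equations, the intertwiner maps `H_α δ_Ω = δ_α` to `H_α ψ_Ω = ψ_α`, and
`H_{γ(k)} δ_Ω = 0` to the truncation conditions (`QKZ.isSym_hVec_truncation`). Conversely, let
`ψ_α = H_α ψ_Ω` with a symmetric `ψ_Ω` which satisfies the truncation conditions. In the product of
the two representations the vectors of the Ballot paths for `v = (ψ_Ω, δ_Ω)` are `(ψ_α, δ_α)`. They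
span a stable subspace, which is the graph of `f ↦ ∑_α f(α) ψ_α`, so this map is an intertwiner
(`sOp_eq_eFam`).

Finally, the ansatz for `ψ_Ω` says that `ψ_Ω` is symmetric and invariant under the reflection of the
last variable (`baseAnsatz_iff`): `Δ^-_1 Δ^+_{λ+1}` has these properties and does not vanish on the
domain. The invariance passes to all `ψ_α`, since the tiles above a Ballot path lie in the columns
`0, …, N - 2`, whose operators do not involve the last variable (`HOp_moveLast`).
-/

namespace TypeBqKZ

/-! ### Identities between `q`-numbers -/

/-- `q^x`. -/
noncomputable def qexp (P : Params) (x : ℂ) : ℂ := Complex.exp (P.η * x)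

theorem qexp_ne (P : Params) (x : ℂ) : qexp P x ≠ 0 := Complex.exp_ne_zero _

theorem qexp_add (P : Params) (x y : ℂ) : qexp P (x + y) = qexp P x * qexp P y := by
  simp [qexp, mul_add, Complex.exp_add]

theorem qexp_neg (P : Params) (x : ℂ) : qexp P (-x) = (qexp P x)⁻¹ := by
  simp [qexp, Complex.exp_neg]

theorem qexp_sub (P : Params) (x y : ℂ) : qexp P (x - y) = qexp P x * (qexp P y)⁻¹ := by
  rw [sub_eq_add_neg, qexp_add, qexp_neg]

theorem qexp_two_mul (P : Params) (x : ℂ) : qexp P (2 * x) = qexp P x ^ 2 := by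
  rw [two_mul, qexp_add, sq]

theorem qexp_two (P : Params) : qexp P 2 = qexp P 1 ^ 2 := by
  rw [← qexp_two_mul, mul_one]

theorem qn_eq (P : Params) (x : ℂ) :
    qn P x = (qexp P x - (qexp P x)⁻¹) / (qexp P 1 - (qexp P 1)⁻¹) := by
  simp [qn, qexp, Complex.exp_neg]

theorem qden_ne {P : Params} (hq : Complex.exp P.η ≠ Complex.exp (-P.η)) :
    qexp P 1 - (qexp P 1)⁻¹ ≠ 0 := by
  simpa [qexp, Complex.exp_neg, sub_eq_zero] using hq

theorem qden_ne' {P : Params} (hq : Complex.exp P.η ≠ Complex.exp (-P.η)) :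
    qexp P 1 ^ 2 - 1 ≠ 0 := by
  have h := qden_ne hq
  have h0 := qexp_ne P 1
  intro h1
  apply h
  field_simp
  simpa using h1

theorem qn_zero (P : Params) : qn P 0 = 0 := by simp [qn]

theorem qn_neg (P : Params) (x : ℂ) : qn P (-x) = -qn P x := by
  simp only [qn, mul_neg, neg_neg]
  ring

theorem qn_one {P : Params} (hq : Complex.exp P.η ≠ Complex.exp (-P.η)) : qn P 1 = 1 := by
  rw [qn_eq]; exact div_self (qden_ne hq)

theorem qn_two_mul {P : Params} (hq : Complex.exp P.η ≠ Complex.exp (-P.η)) (x : ℂ) :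
    qn P 2 * qn P x = qn P (x + 1) + qn P (x - 1) := by
  have h0 := qexp_ne P 1
  have h1 := qexp_ne P x
  have h2 := qden_ne' hq
  simp only [qn_eq, qexp_add, qexp_sub, qexp_two]
  field_simp
  ring

/-- The elementary addition rule `[x + z] [y] - [x] [y + z] = [z] [y - x]`. -/
theorem qn_mul_sub {P : Params} (hq : Complex.exp P.η ≠ Complex.exp (-P.η)) (x y z : ℂ) :
    qn P (x + z) * qn P y - qn P x * qn P (y + z) = qn P z * qn P (y - x) := by
  have h0 := qexp_ne P 1
  have h1 := qexp_ne P x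
  have h3 := qexp_ne P y
  have h4 := qexp_ne P z
  have h2 := qden_ne' hq
  simp only [qn_eq, qexp_add, qexp_sub]
  field_simp
  ring

theorem kfun_sub {P : Params} (hq : Complex.exp P.η ≠ Complex.exp (-P.η)) (x : ℂ) :
    kfun P x - kfun P (-x) = qn P P.ω * qn P (2 * x) := by
  have h6 := qn_mul_sub hq (-((P.ω - P.δ) / 2 + x)) ((P.ω + P.δ) / 2 + -x) (2 * x)
  rw [show -((P.ω - P.δ) / 2 + x) + 2 * x = -((P.ω - P.δ) / 2 + -x) by ring,
    show (P.ω + P.δ) / 2 + -x + 2 * x = (P.ω + P.δ) / 2 + x by ring,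
    show (P.ω + P.δ) / 2 + -x - -((P.ω - P.δ) / 2 + x) = P.ω by ring, qn_neg, qn_neg] at h6
  simp only [kfun]
  linear_combination h6

/-! ### The Baxterisation constants -/

/-- The loop weights: `s_i² = [2] s_i` for `i ≥ 1` and `s_0² = ([ω] / [ω + 1]) s_0`. -/
noncomputable def loopWt (P : Params) (i : ℕ) : ℂ :=
  if 1 ≤ i then qn P 2 else qn P P.ω / qn P (P.ω + 1)

/-- The constant subtracted from `s_i` in the Baxterised element `h_i(u)`. -/
noncomputable def baxt (P : Params) (i u : ℕ) : ℂ :=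
  if 1 ≤ i then qn P ((u : ℂ) - 1) / qn P u
  else qn P ((u / 2 : ℕ) : ℂ) * qn P (P.ω + (((u + 1) / 2 : ℕ) : ℂ)) /
      (qn P u * qn P (P.ω + 1))

theorem baxt_one (P : Params) (i : ℕ) : baxt P i 1 = 0 := by
  simp [baxt, qn_zero]

theorem baxt_pos {P : Params} {i : ℕ} (hi : 1 ≤ i) (u : ℕ) :
    baxt P i u = qn P ((u : ℂ) - 1) / qn P u := by simp [baxt, hi]

theorem baxt_zero (P : Params) (u : ℕ) :
    baxt P 0 u = qn P ((u / 2 : ℕ) : ℂ) * qn P (P.ω + (((u + 1) / 2 : ℕ) : ℂ)) /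
      (qn P u * qn P (P.ω + 1)) := by simp [baxt]

theorem loopWt_zero (P : Params) : loopWt P 0 = qn P P.ω / qn P (P.ω + 1) := by simp [loopWt]

theorem loopWt_pos {P : Params} {i : ℕ} (hi : 1 ≤ i) : loopWt P i = qn P 2 := by
  simp [loopWt, hi]

/-- `[2] - [a - 1] / [a] = [a + 1] / [a]`. -/
theorem loopWt_sub_baxt {P : Params} (hq : Complex.exp P.η ≠ Complex.exp (-P.η)) {i : ℕ}
    (hi : 1 ≤ i) (a : ℕ) (ha : qn P a ≠ 0) :
    loopWt P i - baxt P i a = qn P ((a + 1 : ℕ) : ℂ) / qn P a := by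
  rw [loopWt_pos hi, baxt_pos hi]
  have := qn_two_mul hq (a : ℂ)
  field_simp
  push_cast
  linear_combination this

/-- The scalar identity behind the Yang-Baxter equation. -/
theorem baxt_yangBaxter {P : Params} (hq : Complex.exp P.η ≠ Complex.exp (-P.η)) {i k : ℕ}
    (hi : 1 ≤ i) (hk : 1 ≤ k) (a : ℕ) (ha : qn P a ≠ 0) (ha' : qn P ((a + 1 : ℕ) : ℂ) ≠ 0) :
    baxt P i (a + 1) * (qn P 2 - baxt P k a) = 1 := by
  have := loopWt_sub_baxt hq hk a ha
  rw [loopWt_pos hk] at this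
  rw [this, baxt_pos hi]
  push_cast at *
  rw [add_sub_cancel_right]
  field_simp

/-- The scalar identity behind the reflection equation. The constants of `h_0(u)` depend on the
parity of `u`. -/
theorem baxt_reflection {P : Params} (hq : Complex.exp P.η ≠ Complex.exp (-P.η))
    (hω : qn P (P.ω + 1) ≠ 0) (a : ℕ) (ha : qn P a ≠ 0) (ha' : qn P ((a + 1 : ℕ) : ℂ) ≠ 0)
    (ha'' : qn P ((a + 2 : ℕ) : ℂ) ≠ 0) :
    qn P 2 * baxt P 0 (a + 2) -
      baxt P 1 (a + 1) * (baxt P 0 a + baxt P 0 (a + 2) - loopWt P 0) = 1 := by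
  have h0 := qexp_ne P 1
  have h2 := qden_ne' hq
  have h3 := qexp_ne P P.ω
  rcases Nat.even_or_odd' a with ⟨b, rfl | rfl⟩
  · have e1 : 2 * b / 2 = b := by omega
    have e2 : (2 * b + 1) / 2 = b := by omega
    have e3 : (2 * b + 2) / 2 = b + 1 := by omega
    have e4 : (2 * b + 2 + 1) / 2 = b + 1 := by omega
    have hb := qexp_ne P b
    simp only [baxt_zero, baxt_pos le_rfl, loopWt_zero, e1, e2, e3, e4]
    push_cast at ha ha' ha'' ⊢
    rw [add_sub_cancel_right]
    have key : qn P 2 * qn P (b + 1) * qn P (P.ω + (b + 1)) * qn P (2 * b + 1) -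
        (qn P b * qn P (P.ω + b) * qn P (2 * b + 2) +
          qn P (2 * b) * qn P (b + 1) * qn P (P.ω + (b + 1)) -
          qn P (2 * b) * qn P (2 * b + 2) * qn P P.ω) =
        qn P (P.ω + 1) * qn P (2 * b + 1) * qn P (2 * b + 2) := by
      simp only [qn_eq, qexp_add, qexp_two, qexp_two_mul]
      field_simp
      ring
    generalize qn P (2 * b + 1) = x1, qn P (2 * b + 2) = x2, qn P (2 * b) = x0 at *
    field_simp
    linear_combination key
  · have e1 : (2 * b + 1) / 2 = b := by omega
    have e2 : (2 * b + 1 + 1) / 2 = b + 1 := by omega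
    have e3 : (2 * b + 1 + 2) / 2 = b + 1 := by omega
    have e4 : (2 * b + 1 + 2 + 1) / 2 = b + 2 := by omega
    have hb := qexp_ne P b
    simp only [baxt_zero, baxt_pos le_rfl, loopWt_zero, e1, e2, e3, e4]
    push_cast at ha ha' ha'' ⊢
    rw [add_sub_cancel_right]
    have key : qn P 2 * qn P (b + 1) * qn P (P.ω + (b + 2)) * qn P (2 * b + 1 + 1) -
        (qn P b * qn P (P.ω + (b + 1)) * qn P (2 * b + 1 + 2) +
          qn P (2 * b + 1) * qn P (b + 1) * qn P (P.ω + (b + 2)) -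
          qn P (2 * b + 1) * qn P (2 * b + 1 + 2) * qn P P.ω) =
        qn P (P.ω + 1) * qn P (2 * b + 1 + 1) * qn P (2 * b + 1 + 2) := by
      simp only [qn_eq, qexp_add, qexp_two, qexp_two_mul]
      field_simp
      ring
    generalize qn P (2 * b + 1 + 1) = x1, qn P (2 * b + 1 + 2) = x2, qn P (2 * b + 1) = x0 at *
    field_simp
    linear_combination key


/-! ### Representations of the Hecke algebra of type `B` -/

/-- Operators `s_0, …, s_{N-1}` which satisfy the relations of the symmetrisers in the
(two-parameter) Hecke algebra of type `B_N`. -/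
structure HeckeRep (P : Params) (N : ℕ) {M : Type*} [AddCommGroup M] [Module ℂ M]
    (s : ℕ → Module.End ℂ M) : Prop where
  sq : ∀ i < N, s i * s i = loopWt P i • s i
  comm : ∀ i j, i + 2 ≤ j → j < N → s i * s j = s j * s i
  braid : ∀ i, 1 ≤ i → i + 1 < N →
    s i * s (i + 1) * s i - s i = s (i + 1) * s i * s (i + 1) - s (i + 1)
  braid₀ : 1 < N → s 1 * s 0 * s 1 * s 0 - s 0 * s 1 * s 0 * s 1 = s 1 * s 0 - s 0 * s 1

section Ring

variable {A : Type*} [Ring A] [Algebra ℂ A]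

/-- The Yang-Baxter equation with the first spectral parameter equal to `-1`. -/
theorem yangBaxter_of_braid {s t : A} {d p q : ℂ} (hs : s * s = d • s) (ht : t * t = d • t)
    (hb : s * t * s - s = t * s * t - t) (hpq : q * (d - p) = 1) :
    (s - d • 1) * (t - p • 1) * (s - q • 1) = (t - q • 1) * (s - p • 1) * (t - d • 1) := by
  have h1 : (s - d • 1) * (t - p • 1) * (s - q • 1)
      = s * t * s - q • (s * t) - p • (s * s) + (p * q) • s - d • (t * s) + (d * q) • t
        + (d * p) • s - (d * p * q) • 1 := by
    simp only [sub_mul, mul_sub, smul_mul_assoc, mul_smul_comm, mul_one, one_mul, smul_sub,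
      smul_smul]
    module
  have h2 : (t - q • 1) * (s - p • 1) * (t - d • 1)
      = t * s * t - d • (t * s) - p • (t * t) + (p * d) • t - q • (s * t) + (d * q) • s
        + (p * q) • t - (d * p * q) • 1 := by
    simp only [sub_mul, mul_sub, smul_mul_assoc, mul_smul_comm, mul_one, one_mul, smul_sub,
      smul_smul]
    module
  have hb' : s * t * s = t * s * t - t + s := by rw [← hb]; abel
  rw [h1, h2, hs, ht, hb']
  have e : d * q = 1 + p * q := by linear_combination hpq
  rw [e]
  module

/-- The reflection equation with the first spectral parameter equal to `-1`. -/
theorem reflection_of_braid {s r : A} {d τ x q y : ℂ} (hs : s * s = d • s) (hr : r * r = τ • r)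
    (hb : s * r * s * r - r * s * r * s = s * r - r * s)
    (hx : d * y - q * (x + y - τ) = 1) :
    (s - d • 1) * (r - x • 1) * (s - q • 1) * (r - y • 1)
      = (r - y • 1) * (s - q • 1) * (r - x • 1) * (s - d • 1) := by
  have hb' : s * (r * (s * r)) = r * (s * (r * s)) + s * r - r * s := by
    simp only [mul_assoc] at hb
    rw [add_sub_assoc, ← hb]; abel
  simp only [sub_mul, mul_sub, smul_mul_assoc, mul_smul_comm, mul_one, one_mul, smul_sub,
      smul_smul, mul_assoc, hs, hr, hb']
  match_scalars <;> first | ring1 | linear_combination hx | linear_combination -hx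

end Ring

section Baxterised

variable {P : Params} {N : ℕ} {M : Type*} [AddCommGroup M] [Module ℂ M]

/-- The Baxterised element `h_i(u)` of a representation. -/
noncomputable def baxtOp (P : Params) (s : ℕ → Module.End ℂ M) (i u : ℕ) : Module.End ℂ M :=
  s i - baxt P i u • 1

theorem baxtOp_apply (s : ℕ → Module.End ℂ M) (i u : ℕ) (w : M) :
    baxtOp P s i u w = s i w - baxt P i u • w := by simp [baxtOp]

theorem baxtOp_one (s : ℕ → Module.End ℂ M) (i : ℕ) : baxtOp P s i 1 = s i := by
  simp [baxtOp, baxt_one]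

/-- `w` is an eigenvector of `s_i` with the eigenvalue `[2]` (or `[ω]/[ω+1]` for `i = 0`). For
`i ≥ 1` this says that `h_i(-1) w = 0`. -/
def IsSym (P : Params) (s : ℕ → Module.End ℂ M) (i : ℕ) (w : M) : Prop :=
  s i w = loopWt P i • w

theorem isSym_iff (s : ℕ → Module.End ℂ M) (i : ℕ) (w : M) :
    IsSym P s i w ↔ (s i - loopWt P i • 1) w = 0 := by
  simp [IsSym, sub_eq_zero]

variable {s : ℕ → Module.End ℂ M} (H : HeckeRep P N s)

include H in
theorem HeckeRep.comm' {i k : ℕ} (hi : i < N) (hk : k < N) (hik : i + 2 ≤ k ∨ k + 2 ≤ i) :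
    Commute (s i) (s k) := by
  rcases hik with h | h
  · exact H.comm i k h hk
  · exact (H.comm k i h hi).symm

include H in
theorem HeckeRep.baxtOp_commute {i k : ℕ} (hi : i < N) (hk : k < N)
    (hik : i + 2 ≤ k ∨ k + 2 ≤ i) (u v : ℕ) : Commute (baxtOp P s i u) (baxtOp P s k v) :=
  Commute.sub_left (((H.comm' hi hk hik).sub_right
    ((Commute.one_right _).smul_right _))) (((Commute.one_left _).smul_left _))

include H in
theorem HeckeRep.isSym_self {i : ℕ} (hi : i < N) (w : M) : IsSym P s i (s i w) := by
  have := H.sq i hi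
  simpa [IsSym] using congrArg (fun f : Module.End ℂ M => f w) this

include H in
theorem HeckeRep.isSym_of_far {i k : ℕ} (hi : i < N) (hk : k < N)
    (hik : i + 2 ≤ k ∨ k + 2 ≤ i) (u : ℕ) {w : M} (hw : IsSym P s i w) :
    IsSym P s i (baxtOp P s k u w) := by
  have h := H.comm' hi hk hik
  have h1 : s i (s k w) = s k (s i w) := congrArg (fun f : Module.End ℂ M => f w) h.eq
  unfold IsSym at *
  rw [baxtOp_apply, map_sub, map_smul, h1, hw, map_smul, smul_sub, smul_comm (loopWt P i)]

include H in
/-- By the Yang-Baxter equation, the symmetry of a vector is passed on from the column `k` to the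
neighbouring column `i`. -/
theorem HeckeRep.isSym_of_adj (hq : Complex.exp P.η ≠ Complex.exp (-P.η)) {i k : ℕ}
    (hi : i < N) (hk : k < N) (hi1 : 1 ≤ i) (hk1 : 1 ≤ k) (hik : i + 1 = k ∨ k + 1 = i) {a : ℕ}
    (ha : qn P a ≠ 0) (ha' : qn P ((a + 1 : ℕ) : ℂ) ≠ 0) {w : M} (hw : IsSym P s k w) :
    IsSym P s i (baxtOp P s k a (baxtOp P s i (a + 1) w)) := by
  have hb : s i * s k * s i - s i = s k * s i * s k - s k := by
    rcases hik with rfl | rfl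
    · exact H.braid i hi1 hk
    · exact (H.braid k hk1 hi).symm
  have hi2 := H.sq i hi
  have hk2 := H.sq k hk
  rw [loopWt_pos hi1] at hi2
  rw [loopWt_pos hk1] at hk2
  have e := yangBaxter_of_braid hi2 hk2 hb (baxt_yangBaxter hq hi1 hk1 a ha ha')
  rw [isSym_iff] at hw ⊢
  rw [loopWt_pos hi1]
  rw [loopWt_pos hk1] at hw
  have := congrArg (fun f : Module.End ℂ M => f w) e
  simp only [Module.End.mul_apply] at this
  rw [hw, map_zero, map_zero] at this
  exact this

include H in
/-- By the reflection equation, the symmetry of a vector is passed on through the column `0`. -/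
theorem HeckeRep.isSym_of_reflection (hq : Complex.exp P.η ≠ Complex.exp (-P.η))
    (hω : qn P (P.ω + 1) ≠ 0) (hN : 1 < N) {a : ℕ}
    (ha : qn P a ≠ 0) (ha' : qn P ((a + 1 : ℕ) : ℂ) ≠ 0) (ha'' : qn P ((a + 2 : ℕ) : ℂ) ≠ 0)
    {w : M} (hw : IsSym P s 1 w) :
    IsSym P s 1 (baxtOp P s 0 a (baxtOp P s 1 (a + 1) (baxtOp P s 0 (a + 2) w))) := by
  have h1 := H.sq 1 hN
  have h0 := H.sq 0 (by omega)
  rw [loopWt_pos le_rfl] at h1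
  have e := reflection_of_braid h1 h0 (H.braid₀ hN) (baxt_reflection hq hω a ha ha' ha'')
  rw [isSym_iff] at hw ⊢
  rw [loopWt_pos le_rfl] at hw ⊢
  have := congrArg (fun f : Module.End ℂ M => f w) e
  simp only [Module.End.mul_apply] at this
  rw [hw, map_zero, map_zero, map_zero] at this
  exact this

end Baxterised

/-! ### Paths -/

/-- A path with steps `±1`, heights at least `-1` and end point `(N, 0)`. It is continued by down
steps beyond `N`, so that the heights are a function on `ℕ`. -/
structure IsPath (N : ℕ) (a : ℕ → ℤ) : Prop where
  step : ∀ i, a (i + 1) = a i + 1 ∨ a (i + 1) = a i - 1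
  tail : ∀ i, N ≤ i → a i = N - i
  low : ∀ i, i ≤ N → -1 ≤ a i

/-- The maximal path. -/
def topPath (N : ℕ) : ℕ → ℤ := fun i => N - i

/-- `i` is a local minimum of the path, or `i = 0` and the path starts with an up step. -/
def IsValley (a : ℕ → ℤ) (i : ℕ) : Prop := (i = 0 ∨ a i < a (i - 1)) ∧ a i < a (i + 1)

/-- `i` is a local maximum of the path, or `i = 0` and the path starts with a down step. -/
def IsPeak (a : ℕ → ℤ) (i : ℕ) : Prop := (i = 0 ∨ a (i - 1) < a i) ∧ a (i + 1) < a i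

/-- The path obtained by adding `2` to the height at `i`. -/
def raiseAt (a : ℕ → ℤ) (i : ℕ) : ℕ → ℤ := Function.update a i (a i + 2)

theorem raiseAt_self (a : ℕ → ℤ) (i : ℕ) : raiseAt a i i = a i + 2 := by simp [raiseAt]

theorem raiseAt_of_ne (a : ℕ → ℤ) {i x : ℕ} (h : x ≠ i) : raiseAt a i x = a x := by
  simp [raiseAt, h]

theorem le_raiseAt (a : ℕ → ℤ) (i : ℕ) : a ≤ raiseAt a i := by
  intro x
  show a x ≤ raiseAt a i x
  by_cases h : x = i
  · subst h; rw [raiseAt_self]; omega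
  · rw [raiseAt_of_ne a h]

theorem topPath_isPath (N : ℕ) : IsPath N (topPath N) where
  step i := by
    right
    simp only [topPath]
    push_cast
    ring
  tail i _ := rfl
  low i h := by
    have : (i : ℤ) ≤ N := by exact_mod_cast h
    simp only [topPath]
    linarith

theorem raiseAt_le {a b : ℕ → ℤ} (hab : a ≤ b) {i : ℕ} (h : a i + 2 ≤ b i) :
    raiseAt a i ≤ b := by
  intro x
  by_cases hx : x = i
  · subst hx; rwa [raiseAt_self]
  · rw [raiseAt_of_ne a hx]; exact hab x

namespace IsPath

variable {N : ℕ} {a b : ℕ → ℤ}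

theorem le_top (ha : IsPath N a) : a ≤ topPath N := by
  have key : ∀ k i, N ≤ i + k → a i ≤ topPath N i := by
    intro k
    induction k with
    | zero => intro i h; rw [ha.tail i (by omega)]; exact le_rfl
    | succ k ih =>
      intro i h
      have := ih (i + 1) (by omega)
      have := ha.step i
      simp only [topPath] at *
      push_cast at *
      omega
  exact fun i => key N i (by omega)

theorem parity (ha : IsPath N a) (i : ℕ) : (a i + i - N) % 2 = 0 := by
  have key : ∀ k i, N ≤ i + k → (a i + i - N) % 2 = 0 := by
    intro k
    induction k with
    | zero => intro i h; rw [ha.tail i (by omega)]; omega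
    | succ k ih =>
      intro i h
      have := ih (i + 1) (by omega)
      have := ha.step i
      push_cast at *
      omega
  exact key N i (by omega)

theorem lip (ha : IsPath N a) (i k : ℕ) : a (i + k) ≤ a i + k ∧ a i - k ≤ a (i + k) := by
  induction k with
  | zero => simp
  | succ k ih =>
    have := ha.step (i + k)
    rw [← add_assoc]
    push_cast
    omega

theorem step' (ha : IsPath N a) {i : ℕ} (hi : 1 ≤ i) :
    a i = a (i - 1) + 1 ∨ a i = a (i - 1) - 1 := by
  have := ha.step (i - 1)
  rwa [Nat.sub_add_cancel hi] at this

/-- A path strictly below another one has a valley which can be raised without leaving the region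
below the other path. -/
theorem exists_valley (ha : IsPath N a) (hb : IsPath N b) (hab : a ≤ b) (hne : a ≠ b) :
    ∃ e < N, IsValley a e ∧ a e + 2 ≤ b e := by
  have hex : ∃ i, a i < b i := by
    by_contra! h
    exact hne (le_antisymm hab h)
  obtain ⟨i₀, hi₀⟩ := hex
  have hlt : ∀ i, a i < b i → i < N := by
    intro i hi
    by_contra! h
    rw [ha.tail i h, hb.tail i h] at hi
    omega
  -- a lowest point among those where the paths differ
  obtain ⟨e, he, hmin⟩ := Finset.exists_min_image ((Finset.range N).filter fun i => a i < b i) a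
    ⟨i₀, by simp [hi₀, hlt i₀ hi₀]⟩
  simp only [Finset.mem_filter, Finset.mem_range, and_imp] at he hmin
  refine ⟨e, he.1, ⟨?_, ?_⟩, ?_⟩
  · by_cases h0 : e = 0
    · exact Or.inl h0
    · right
      by_contra hc
      have h1 := ha.step' (i := e) (by omega)
      have h2 := hb.step' (i := e) (by omega)
      have := hmin (e - 1) (by omega) (by omega)
      omega
  · by_contra hc
    have h1 := ha.step e
    have h2 := hb.step e
    have h3 : a (e + 1) < b (e + 1) := by omega
    have := hmin (e + 1) (hlt _ h3) h3
    omega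
  · have := ha.parity e
    have := hb.parity e
    omega

theorem valley_lt (ha : IsPath N a) {i : ℕ} (hi : IsValley a i) : i < N := by
  by_contra! h
  have h1 := ha.tail i h
  have h2 := ha.tail (i + 1) (by omega)
  have := hi.2
  push_cast at *
  omega

theorem raise (ha : IsPath N a) {i : ℕ} (hi : IsValley a i) : IsPath N (raiseAt a i) := by
  have hiN := ha.valley_lt hi
  refine ⟨fun x => ?_, fun x hx => ?_, fun x hx => ?_⟩
  · have := ha.step x
    by_cases h1 : x = i
    · subst h1
      rw [raiseAt_self, raiseAt_of_ne a (by omega)]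
      have := hi.2
      omega
    · by_cases h2 : x + 1 = i
      · subst h2
        rw [raiseAt_self, raiseAt_of_ne a (by omega)]
        have := hi.1
        simp only [Nat.add_sub_cancel] at this
        omega
      · rwa [raiseAt_of_ne a h1, raiseAt_of_ne a h2]
  · rw [raiseAt_of_ne a (by omega)]; exact ha.tail x hx
  · exact (ha.low x hx).trans (le_raiseAt a i x)

end IsPath

/-- The total height missing to the maximal path. -/
def defect (N : ℕ) (a : ℕ → ℤ) : ℕ := ∑ i ∈ Finset.range N, (topPath N i - a i).toNat

theorem defect_lt {N : ℕ} {a b : ℕ → ℤ} (ha : IsPath N a) (hb : IsPath N b) (hab : a ≤ b)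
    (hne : a ≠ b) : defect N b < defect N a := by
  obtain ⟨e, he, -, h⟩ := ha.exists_valley hb hab hne
  refine Finset.sum_lt_sum (fun i _ => ?_) ⟨e, Finset.mem_range.2 he, ?_⟩
  · have : a i ≤ b i := hab i
    omega
  · have : b e ≤ topPath N e := hb.le_top e
    omega

theorem ne_raiseAt (a : ℕ → ℤ) (i : ℕ) : a ≠ raiseAt a i := by
  intro h
  have := congrFun h i
  rw [raiseAt_self] at this
  omega

theorem defect_raise_lt {N : ℕ} {a : ℕ → ℤ} (ha : IsPath N a) {i : ℕ} (hi : IsValley a i) :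
    defect N (raiseAt a i) < defect N a :=
  defect_lt ha (ha.raise hi) (le_raiseAt a i) (ne_raiseAt a i)

/-! ### Tiles and their readings -/

/-- The tile in the column `t.1` at the height `t.2` lies between the path and the maximal path. -/
def HasTile (N : ℕ) (a : ℕ → ℤ) (t : ℕ × ℕ) : Prop :=
  t.1 < N ∧ a t.1 < t.2 ∧ (t.2 : ℤ) < topPath N t.1 ∧ Odd ((t.2 : ℤ) - a t.1)

/-- A list of all the tiles above a path, each once, in which of two tiles in the same or in
neighbouring columns the lower one comes first. -/
structure IsReading (N : ℕ) (a : ℕ → ℤ) (l : List (ℕ × ℕ)) : Prop where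
  nodup : l.Nodup
  mem_iff : ∀ t, t ∈ l ↔ HasTile N a t
  pairwise : l.Pairwise fun t t' => t.2 < t'.2 ∨ t.1 + 2 ≤ t'.1 ∨ t'.1 + 2 ≤ t.1

theorem hasTile_parity {N : ℕ} {a : ℕ → ℤ} (ha : IsPath N a) {t : ℕ × ℕ} (h : HasTile N a t) :
    ((t.1 : ℤ) + t.2 - N) % 2 = 1 := by
  have h1 := ha.parity t.1
  obtain ⟨k, hk⟩ := h.2.2.2
  omega

theorem hasTile_iff {N : ℕ} {a : ℕ → ℤ} (ha : IsPath N a) (t : ℕ × ℕ) :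
    HasTile N a t ↔ t.1 < N ∧ a t.1 < t.2 ∧ (t.1 : ℤ) + t.2 < N ∧
      ((t.1 : ℤ) + t.2 - N) % 2 = 1 := by
  have h1 := ha.parity t.1
  unfold HasTile topPath
  rw [Int.odd_iff]
  omega

theorem hasTile_raise_iff {N : ℕ} {a : ℕ → ℤ} (ha : IsPath N a) {i : ℕ} (hi : IsValley a i)
    (t : ℕ × ℕ) : HasTile N a t ↔ t = (i, (a i + 1).toNat) ∨ HasTile N (raiseAt a i) t := by
  have hN := ha.valley_lt hi
  have h1 := ha.low i hN.le
  have h2 := ha.parity i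
  have h3 := ha.le_top (i + 1)
  have h4 := ha.step i
  have h5 := hi.2
  rw [hasTile_iff ha, hasTile_iff (ha.raise hi), Prod.ext_iff]
  simp only [topPath] at h3
  push_cast at h3
  by_cases h : t.1 = i
  · rw [h, raiseAt_self]; omega
  · rw [raiseAt_of_ne a h]; omega

theorem not_hasTile_raise {N : ℕ} {a : ℕ → ℤ} (ha : IsPath N a) {i : ℕ} (hi : IsValley a i) :
    ¬ HasTile N (raiseAt a i) (i, (a i + 1).toNat) := by
  have h1 := ha.low i (ha.valley_lt hi).le
  intro h
  have := h.2.1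
  rw [raiseAt_self] at this
  simp only at this
  omega

theorem not_hasTile_top {N : ℕ} (t : ℕ × ℕ) : ¬ HasTile N (topPath N) t := by
  intro h
  have := h.2.1
  have := h.2.2.1
  omega

theorem IsReading.cons {N : ℕ} {a : ℕ → ℤ} (ha : IsPath N a) {i : ℕ} (hi : IsValley a i)
    {l : List (ℕ × ℕ)} (hl : IsReading N (raiseAt a i) l) :
    IsReading N a ((i, (a i + 1).toNat) :: l) := by
  refine ⟨List.nodup_cons.2 ⟨?_, hl.nodup⟩, fun t => ?_, List.pairwise_cons.2 ⟨?_, hl.pairwise⟩⟩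
  · rw [hl.mem_iff]; exact not_hasTile_raise ha hi
  · rw [List.mem_cons, hl.mem_iff, ← hasTile_raise_iff ha hi]
  · intro t ht
    rw [hl.mem_iff] at ht
    have h0 := ht.2.1
    have hN := ha.low i (ha.valley_lt hi).le
    simp only
    by_cases h1 : t.1 = i
    · rw [h1, raiseAt_self] at h0; omega
    · rw [raiseAt_of_ne a h1] at h0
      by_cases h2 : t.1 = i + 1
      · have := hi.2
        rw [h2] at h0
        omega
      · by_cases h3 : t.1 + 1 = i
        · subst h3
          have := hi.1
          rw [Nat.add_sub_cancel] at this
          omega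
        · omega

theorem exists_isReading {N : ℕ} {a : ℕ → ℤ} (ha : IsPath N a) : ∃ l, IsReading N a l := by
  induction h : defect N a using Nat.strong_induction_on generalizing a with
  | _ n ih =>
    by_cases htop : a = topPath N
    · subst htop
      exact ⟨[], List.nodup_nil, fun t => by simp [not_hasTile_top], List.Pairwise.nil⟩
    · obtain ⟨e, -, he, -⟩ := ha.exists_valley (topPath_isPath N) ha.le_top htop
      obtain ⟨l, hl⟩ := ih _ (h ▸ defect_raise_lt ha he) (ha.raise he) rfl
      exact ⟨_, hl.cons ha he⟩

/-- Two arrangements of the same factors have the same product if any two factors whose order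
differs commute. -/
theorem prod_eq_of_perm_of_pairwise {ι A : Type*} [Monoid A] (f : ι → A) (R : ι → ι → Prop)
    (hR : ∀ x y, R x y → R y x → Commute (f x) (f y)) {l₁ l₂ : List ι} (hp : l₁.Perm l₂)
    (h₁ : l₁.Pairwise R) (h₂ : l₂.Pairwise R) : (l₁.map f).prod = (l₂.map f).prod := by
  induction l₁ generalizing l₂ with
  | nil => rw [List.Perm.nil_eq hp]
  | cons x t ih =>
    obtain ⟨p, q, rfl⟩ := List.append_of_mem (hp.subset List.mem_cons_self)
    have hp' : t.Perm (p ++ q) := (hp.trans List.perm_middle).cons_inv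
    rw [List.pairwise_cons] at h₁
    rw [List.pairwise_append, List.pairwise_cons] at h₂
    have hc : Commute (f x) (p.map f).prod := by
      refine Commute.list_prod_right _ _ fun z hz => ?_
      obtain ⟨y, hy, rfl⟩ := List.mem_map.1 hz
      exact hR x y (h₁.1 y (hp'.symm.subset (List.mem_append_left _ hy)))
        (h₂.2.2 y hy x List.mem_cons_self)
    have := ih hp' h₁.2 (List.pairwise_append.2
      ⟨h₂.1, h₂.2.1.2, fun y hy z hz => h₂.2.2 y hy z (List.mem_cons_of_mem _ hz)⟩)
    simp only [List.map_cons, List.prod_cons, List.map_append, List.prod_append] at *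
    rw [this, ← mul_assoc, hc.eq, mul_assoc]

section TileProd

variable {P : Params} {N : ℕ} {M : Type*} [AddCommGroup M] [Module ℂ M]
  {s : ℕ → Module.End ℂ M}

open Classical in
/-- A reading of the tiles above a path (there is one for every path, by `exists_isReading`; the
product does not depend on the choice, by `tileProd_eq`). -/
noncomputable def reading (N : ℕ) (a : ℕ → ℤ) : List (ℕ × ℕ) :=
  if h : ∃ l, IsReading N a l then h.choose else []

theorem reading_spec {a : ℕ → ℤ} (ha : IsPath N a) : IsReading N a (reading N a) := by
  have h := exists_isReading ha
  rw [reading, dif_pos h]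
  exact h.choose_spec

/-- The product of the Baxterised elements of the tiles above a path, where the tile in the column
`i` at the height `j` carries the integer `c i j`. -/
noncomputable def tileProd (P : Params) (N : ℕ) (s : ℕ → Module.End ℂ M) (c : ℕ → ℕ → ℕ)
    (a : ℕ → ℤ) : Module.End ℂ M :=
  ((reading N a).map fun t => baxtOp P s t.1 (c t.1 t.2)).prod

theorem tileProd_eq (H : HeckeRep P N s) (c : ℕ → ℕ → ℕ) {a : ℕ → ℤ} (ha : IsPath N a)
    {l : List (ℕ × ℕ)} (hl : IsReading N a l) :
    tileProd P N s c a = (l.map fun t => baxtOp P s t.1 (c t.1 t.2)).prod := by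
  have hr := reading_spec ha
  let R : ℕ × ℕ → ℕ × ℕ → Prop := fun t t' => (HasTile N a t ∧ HasTile N a t') ∧
    (t.2 < t'.2 ∨ t.1 + 2 ≤ t'.1 ∨ t'.1 + 2 ≤ t.1)
  have hR : ∀ {l}, IsReading N a l → l.Pairwise R := by
    intro l hl
    refine (List.Pairwise.imp_of_mem ?_ hl.pairwise)
    intro x y hx hy h
    exact ⟨⟨(hl.mem_iff x).1 hx, (hl.mem_iff y).1 hy⟩, h⟩
  refine prod_eq_of_perm_of_pairwise _ R (fun x y hxy hyx => ?_)
    ((List.perm_ext_iff_of_nodup hr.nodup hl.nodup).2 fun t => by rw [hr.mem_iff, hl.mem_iff])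
    (hR hr) (hR hl)
  exact H.baxtOp_commute hxy.1.1.1 hxy.1.2.1 (by
    have := hxy.2
    have := hyx.2
    omega) _ _

theorem tileProd_top (H : HeckeRep P N s) (c : ℕ → ℕ → ℕ) :
    tileProd P N s c (topPath N) = 1 := by
  rw [tileProd_eq H c (topPath_isPath N) (l := [])
    ⟨List.nodup_nil, fun t => by simp [not_hasTile_top], List.Pairwise.nil⟩]
  rfl

theorem tileProd_step (H : HeckeRep P N s) (c : ℕ → ℕ → ℕ) {a : ℕ → ℤ} (ha : IsPath N a)
    {i : ℕ} (hi : IsValley a i) : tileProd P N s c a =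
      baxtOp P s i (c i (a i + 1).toNat) * tileProd P N s c (raiseAt a i) := by
  rw [tileProd_eq H c ha ((reading_spec (ha.raise hi)).cons ha hi), List.map_cons,
    List.prod_cons]
  rfl

theorem tileProd_congr {c c' : ℕ → ℕ → ℕ} {a : ℕ → ℤ} (ha : IsPath N a)
    (h : ∀ t, HasTile N a t → c t.1 t.2 = c' t.1 t.2) :
    tileProd P N s c a = tileProd P N s c' a := by
  unfold tileProd
  congr 1
  refine List.map_congr_left fun t ht => ?_
  rw [h t (((reading_spec ha).mem_iff t).1 ht)]

/-- The factors of the tiles above a higher path stand to the right of all the other factors. -/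
theorem exists_tileProd_eq_mul (H : HeckeRep P N s) (c : ℕ → ℕ → ℕ) {a b : ℕ → ℤ}
    (ha : IsPath N a) (hb : IsPath N b) (hab : a ≤ b) :
    ∃ X, tileProd P N s c a = X * tileProd P N s c b := by
  induction h : defect N a using Nat.strong_induction_on generalizing a with
  | _ n ih =>
    by_cases hne : a = b
    · exact ⟨1, by rw [hne, one_mul]⟩
    · obtain ⟨e, -, he, h2⟩ := ha.exists_valley hb hab hne
      obtain ⟨X, hX⟩ := ih _ (h ▸ defect_raise_lt ha he) (ha.raise he)
        (raiseAt_le hab h2) rfl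
      exact ⟨_ * X, by rw [tileProd_step H c ha he, hX, mul_assoc]⟩

end TileProd

/-! ### The integers of the tiles -/

/-- The local heights at `0, …, N` of a path. -/
def toHeights (N : ℕ) (a : ℕ → ℤ) : Heights N := fun i => a i

/-- The integer of the tile in the column `i` at the height `j`; the value `0` for `i ≥ N` is never
used. -/
noncomputable def ct (N : ℕ) (a : ℕ → ℤ) (i j : ℕ) : ℕ :=
  if h : i < N then content (toHeights N a) j ⟨i, h⟩ else 0

theorem isTile_toHeights {N : ℕ} (a : ℕ → ℤ) (i : Fin N) (j : ℕ) :
    IsTile (toHeights N a) i j ↔ HasTile N a (i, j) := by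
  simp [IsTile, HasTile, toHeights, omega, topPath]

section Content

variable {N : ℕ} {a : ℕ → ℤ}

theorem ct_zero {i : ℕ} (hi : i < N) : ct N a i 0 = 1 := by
  simp [ct, hi, content]

theorem ct_lower {i i' j : ℕ} (hi : i < N) (hadj : i' + 1 = i ∨ i + 1 = i')
    (h : HasTile N a (i', j)) : ct N a i' j + 1 ≤ ct N a i (j + 1) := by
  classical
  simp only [ct, hi, h.1, dif_pos, content, add_le_add_iff_right]
  exact Finset.le_sup (f := content (toHeights N a) j)
    (Finset.mem_filter.2 ⟨Finset.mem_univ (⟨i', h.1⟩ : Fin N), hadj,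
      (isTile_toHeights a ⟨i', h.1⟩ j).2 h⟩)

theorem ct_upper {i : ℕ} (hi : i < N) (j : ℕ) :
    (ct N a i (j + 1) = 1 ∧ ∀ i', (i' + 1 = i ∨ i + 1 = i') → ¬ HasTile N a (i', j)) ∨
      ∃ i', (i' + 1 = i ∨ i + 1 = i') ∧ HasTile N a (i', j) ∧
        ct N a i (j + 1) = ct N a i' j + 1 := by
  classical
  simp only [ct, hi, dif_pos, content]
  rcases Finset.eq_empty_or_nonempty (Finset.univ.filter fun i' : Fin N =>
      ((i' : ℕ) + 1 = i ∨ i + 1 = (i' : ℕ)) ∧ IsTile (toHeights N a) i' j) with h | h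
  · left
    refine ⟨by rw [h]; simp, fun i' hi' ht => ?_⟩
    have : (⟨i', ht.1⟩ : Fin N) ∈ (∅ : Finset (Fin N)) := h ▸ Finset.mem_filter.2
      ⟨Finset.mem_univ _, hi', (isTile_toHeights a ⟨i', ht.1⟩ j).2 ht⟩
    simp at this
  · right
    obtain ⟨i', hi', e⟩ := Finset.exists_mem_eq_sup _ h (content (toHeights N a) j)
    rw [Finset.mem_filter] at hi'
    exact ⟨i', hi'.2.1, (isTile_toHeights a i' j).1 hi'.2.2, by rw [e]; simp⟩

theorem one_le_ct {i : ℕ} (hi : i < N) (j : ℕ) : 1 ≤ ct N a i j := by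
  cases j with
  | zero => rw [ct_zero hi]
  | succ j => rcases ct_upper (a := a) hi j with h | ⟨i', -, -, h⟩ <;> omega

theorem ct_le {i : ℕ} (hi : i < N) (j : ℕ) : ct N a i j ≤ j + 1 := by
  induction j generalizing i with
  | zero => rw [ct_zero hi]
  | succ j ih =>
    rcases ct_upper (a := a) hi j with h | ⟨i', -, ht, h⟩
    · omega
    · have := ih ht.1
      simp only at this
      omega

theorem HasTile.ct_le {t : ℕ × ℕ} (h : HasTile N a t) {b : ℕ → ℤ} : ct N b t.1 t.2 ≤ N := by
  have := TypeBqKZ.ct_le (a := b) h.1 t.2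
  have := h.2.2.1
  simp only [topPath] at this
  omega

/-- The integer of a valley tile is `1`. -/
theorem ct_valley (ha : IsPath N a) {i : ℕ} (hi : IsValley a i) :
    ct N a i (a i + 1).toNat = 1 := by
  have hN := ha.valley_lt hi
  have hlow := ha.low i hN.le
  rcases hj : (a i + 1).toNat with _ | j
  · exact ct_zero hN
  · rcases ct_upper (a := a) hN j with h | ⟨i', h1, ht, -⟩
    · exact h.1
    · exfalso
      have h2 := ht.2.1
      have h3 := hi.2
      simp only at h2
      rcases h1 with rfl | rfl
      · have := hi.1
        rw [Nat.add_sub_cancel] at this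
        omega
      · omega

/-- The integer of a tile is at least its height above every point of the path from which it can
be reached by going upwards. -/
theorem le_ct (ha : IsPath N a) {i j : ℕ} (ht : HasTile N a (i, j)) {l : ℕ}
    (h1 : (i : ℤ) - l < j - a l) (h2 : (l : ℤ) - i < j - a l) : (j : ℤ) - a l ≤ ct N a i j := by
  induction j generalizing i with
  | zero =>
    rw [ct_zero ht.1]
    have : l ≤ N := by
      by_contra! h
      have h3 := ha.tail l h.le
      have h4 := ht.2.2.1
      simp only [topPath] at h4
      omega
    have := ha.low l this
    push_cast
    omega
  | succ j ih =>
    have hi := ht.1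
    have hp := (hasTile_iff ha _).1 ht
    simp only at hp hi
    push_cast at hp h1 h2 ⊢
    have hpl := ha.parity l
    by_cases hone : (j : ℤ) + 1 - a l = 1
    · have := one_le_ct (a := a) hi (j + 1)
      omega
    -- move one step down towards the column `l`
    obtain ⟨i', hadj, e1, e2⟩ : ∃ i', (i' + 1 = i ∨ i + 1 = i') ∧ (i' : ℤ) - l < j - a l ∧
        (l : ℤ) - i' < j - a l := by
      rcases lt_trichotomy i l with h | h | h
      · exact ⟨i + 1, Or.inr rfl, by push_cast; omega, by push_cast; omega⟩
      · exact ⟨i + 1, Or.inr rfl, by push_cast; omega, by push_cast; omega⟩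
      · exact ⟨i - 1, Or.inl (by omega), by omega, by omega⟩
    have htile : HasTile N a (i', j) := by
      rw [hasTile_iff ha]
      simp only
      have hbound : a i' < j := by
        rcases le_total i' l with h | h
        · have := (ha.lip i' (l - i')).2
          rw [Nat.add_sub_cancel' h] at this
          omega
        · have := (ha.lip l (i' - l)).1
          rw [Nat.add_sub_cancel' h] at this
          omega
      have hpos : (0 : ℤ) ≤ j := by positivity
      omega
    have := ih htile e1 e2
    have := ct_lower hi hadj htile
    omega

/-- The integer of a tile is attained as its height above a point of the path. -/
theorem exists_ct_eq (ha : IsPath N a) {i j : ℕ} (ht : HasTile N a (i, j)) :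
    ∃ l, (i : ℤ) - l < j - a l ∧ (l : ℤ) - i < j - a l ∧ (ct N a i j : ℤ) = j - a l := by
  induction j generalizing i with
  | zero =>
    have h1 := ha.low i ht.1.le
    have h2 := ht.2.1
    refine ⟨i, ?_, ?_, ?_⟩
    all_goals first | rw [ct_zero ht.1] | skip
    all_goals simp only at *; push_cast at *; omega
  | succ j ih =>
    have hp := (hasTile_iff ha _).1 ht
    simp only at hp
    push_cast at hp
    rcases ct_upper (a := a) (i := i) ht.1 j with ⟨h, hno⟩ | ⟨i', hadj, ht', h⟩
    · have := hno (i + 1) (Or.inr rfl)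
      rw [hasTile_iff ha] at this
      simp only at this
      push_cast at this
      have h1 := ha.step i
      have h2 := ha.parity i
      have h3 := ha.low i ht.1.le
      refine ⟨i, ?_, ?_, ?_⟩ <;> push_cast <;> omega
    · obtain ⟨l, h1, h2, h3⟩ := ih ht'
      refine ⟨l, ?_, ?_, ?_⟩ <;> push_cast <;> omega

end Content

/-! ### Symmetry at the slopes -/

section Slope

variable {P : Params} {N : ℕ} {M : Type*} [AddCommGroup M] [Module ℂ M]
  {s : ℕ → Module.End ℂ M}

/-- The vector obtained from `v` by applying the factors of all the tiles above `a`, where the tile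
in the column `i` at the height `j` carries the integer `c i j`. Usually `c` is given by a path
below `a`, so that these tiles are the upper part of a larger tiling. -/
noncomputable def tileVec (P : Params) (N : ℕ) (s : ℕ → Module.End ℂ M) (c : ℕ → ℕ → ℕ)
    (a : ℕ → ℤ) (v : M) : M := tileProd P N s c a v

theorem tileVec_step (H : HeckeRep P N s) (c : ℕ → ℕ → ℕ) {a : ℕ → ℤ} (ha : IsPath N a)
    {i : ℕ} (hi : IsValley a i) (v : M) : tileVec P N s c a v =
      baxtOp P s i (c i (a i + 1).toNat) (tileVec P N s c (raiseAt a i) v) := by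
  rw [tileVec, tileProd_step H c ha hi]; rfl

theorem tileVec_top (H : HeckeRep P N s) (c : ℕ → ℕ → ℕ) (v : M) :
    tileVec P N s c (topPath N) v = v := by
  rw [tileVec, tileProd_top H]; rfl

/-- The parameters are generic: `q² ≠ 1`, and the `q`-numbers in the denominators do not vanish. -/
structure Generic (P : Params) (N : ℕ) : Prop where
  hq : Complex.exp P.η ≠ Complex.exp (-P.η)
  hω : qn P (P.ω + 1) ≠ 0
  hqn : ∀ k : ℕ, 1 ≤ k → k ≤ N → qn P k ≠ 0

theorem HasTile.mono {a b : ℕ → ℤ} (ha : IsPath N a) (hb : IsPath N b) (hab : a ≤ b)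
    {u : ℕ × ℕ} (hu : HasTile N b u) : HasTile N a u := by
  have : a u.1 ≤ b u.1 := hab u.1
  rw [hasTile_iff ha]; rw [hasTile_iff hb] at hu; omega

/-- Along a downhill slope the integers of the two diagonals above the slope differ by one; the
same holds one column further to the right and two steps higher. -/
theorem ct_pair_down {a b : ℕ → ℤ} (ha : IsPath N a) (hb : IsPath N b) (hab : a ≤ b) {j t : ℕ}
    (hj : HasTile N b (j + 1, t)) (h2 : HasTile N b (j + 2, t + 1))
    (hpair : ct N a j (t + 1) = ct N a (j + 1) t + 1) :
    ct N a (j + 1) (t + 2) = ct N a (j + 2) (t + 1) + 1 := by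
  have up : ∀ u, HasTile N b u → HasTile N a u := fun u hu => hu.mono ha hb hab
  have l1 := ct_lower (a := a) hj.1 (Or.inr rfl) (up _ h2)
  have l2 := ct_lower (a := a) h2.1 (Or.inl rfl) (up _ hj)
  simp only [add_assoc, Nat.reduceAdd] at l1 l2
  rcases ct_upper (a := a) (i := j + 1) hj.1 (t + 1) with ⟨-, h⟩ | ⟨i', hi', -, h⟩
  · exact absurd (up _ h2) (h _ (Or.inr rfl))
  · simp only [add_assoc, Nat.reduceAdd] at h hi'
    rcases hi' with hi' | hi'
    · obtain rfl : i' = j := by omega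
      omega
    · obtain rfl : i' = j + 2 := by omega
      exact h

/-- The mirror image of `ct_pair_down`, which holds for an uphill slope. -/
theorem ct_pair_up {a b : ℕ → ℤ} (ha : IsPath N a) (hb : IsPath N b) (hab : a ≤ b) {j t : ℕ}
    (hj : HasTile N b (j + 1, t)) (h2 : HasTile N b (j, t + 1))
    (hpair : ct N a (j + 2) (t + 1) = ct N a (j + 1) t + 1) :
    ct N a (j + 1) (t + 2) = ct N a j (t + 1) + 1 := by
  have up : ∀ u, HasTile N b u → HasTile N a u := fun u hu => hu.mono ha hb hab
  have l1 := ct_lower (a := a) hj.1 (Or.inl rfl) (up _ h2)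
  have l2 := ct_lower (a := a) h2.1 (Or.inr rfl) (up _ hj)
  simp only [add_assoc, Nat.reduceAdd] at l1 l2
  rcases ct_upper (a := a) (i := j + 1) hj.1 (t + 1) with ⟨-, h⟩ | ⟨i', hi', -, h⟩
  · exact absurd (up _ h2) (h _ (Or.inl rfl))
  · simp only [add_assoc, Nat.reduceAdd] at h hi'
    rcases hi' with hi' | hi'
    · obtain rfl : i' = j := by omega
      exact h
    · obtain rfl : i' = j + 2 := by omega
      omega

/-- A downhill slope of `b` at `j`, above which the integers given by `c` increase by one. -/
structure DownSlope (N : ℕ) (c : ℕ → ℕ → ℕ) (b : ℕ → ℤ) (j : ℕ) : Prop where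
  pos : 1 ≤ j
  lt : j < N
  left : b (j - 1) = b j + 1
  right : b (j + 1) = b j - 1
  pair : HasTile N b (j, (b j + 1).toNat) →
    c j (b j + 1).toNat = c (j + 1) (b j).toNat + 1

/-- An uphill slope of `b` at `j`, above which the integers given by `c` increase by one. -/
structure UpSlope (N : ℕ) (c : ℕ → ℕ → ℕ) (b : ℕ → ℤ) (j : ℕ) : Prop where
  pos : 1 ≤ j
  lt : j < N
  left : b (j - 1) = b j - 1
  right : b (j + 1) = b j + 1
  pair : c j (b j + 1).toNat = c (j - 1) (b j).toNat + 1

theorem downSlope_geometry {b : ℕ → ℤ} (hb : IsPath N b) {j t : ℕ} (hj1 : 1 ≤ j)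
    (hl : b (j - 1) = b j + 1) (hr : b (j + 1) = b j - 1) (he : IsValley b (j + 1))
    (ht : b j = t) :
    IsValley (raiseAt b (j + 1)) j ∧ raiseAt (raiseAt b (j + 1)) j j = t + 2 ∧
      raiseAt (raiseAt b (j + 1)) j (j + 1) = t + 1 ∧
      raiseAt (raiseAt b (j + 1)) j (j + 2) = t ∧ raiseAt b (j + 1) j = t ∧ b (j + 2) = t ∧
      HasTile N b (j, t + 1) ∧ HasTile N b (j + 1, t) := by
  have hv2 : b (j + 2) = t := by
    have h1 : b (j + 1) < b (j + 2) := he.2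
    have h2 : b (j + 2) = b (j + 1) + 1 ∨ b (j + 2) = b (j + 1) - 1 := hb.step (j + 1)
    omega
  have hbt : b (j + 2) ≤ topPath N (j + 2) := hb.le_top (j + 2)
  have hpj := hb.parity j
  have b'0 : raiseAt b (j + 1) j = t := by rw [raiseAt_of_ne b (by omega), ht]
  have b'1 : raiseAt b (j + 1) (j + 1) = t + 1 := by rw [raiseAt_self]; omega
  have b'm : raiseAt b (j + 1) (j - 1) = t + 1 := by rw [raiseAt_of_ne b (by omega)]; omega
  simp only [topPath] at hbt
  push_cast at hbt
  have hN := hb.valley_lt he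
  refine ⟨⟨Or.inr (by omega), by omega⟩, by rw [raiseAt_self, b'0],
    by rw [raiseAt_of_ne _ (by omega), b'1],
    by rw [raiseAt_of_ne _ (by omega), raiseAt_of_ne _ (by omega), hv2], b'0, hv2, ?_, ?_⟩
  · rw [hasTile_iff hb]; push_cast; omega
  · rw [hasTile_iff hb]; push_cast; omega

theorem upSlope_geometry {b : ℕ → ℤ} (hb : IsPath N b) {j t : ℕ}
    (hl : b j = b (j + 1) - 1) (hr : b (j + 2) = b (j + 1) + 1) (he : IsValley b j)
    (ht : b (j + 1) = t) :
    IsValley (raiseAt b j) (j + 1) ∧ raiseAt (raiseAt b j) (j + 1) j = t + 1 ∧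
      raiseAt (raiseAt b j) (j + 1) (j + 1) = t + 2 ∧
      raiseAt (raiseAt b j) (j + 1) (j + 2) = t + 1 ∧ raiseAt b j (j + 1) = t ∧
      HasTile N b (j + 1, t + 1) ∧ HasTile N b (j, t) ∧ (t : ℤ) + 1 ≤ N - (j + 2) := by
  have hbt : b (j + 2) ≤ topPath N (j + 2) := hb.le_top (j + 2)
  have hpj := hb.parity j
  have b'0 : raiseAt b j j = t + 1 := by rw [raiseAt_self]; omega
  have b'1 : raiseAt b j (j + 1) = t := by rw [raiseAt_of_ne b (by omega), ht]
  have b'2 : raiseAt b j (j + 1 + 1) = t + 1 := by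
    rw [raiseAt_of_ne b (by omega)]; exact hr.trans (by rw [ht])
  simp only [topPath] at hbt
  push_cast at hbt
  have hN := hb.valley_lt he
  refine ⟨⟨Or.inr (by rw [Nat.add_sub_cancel]; omega), by omega⟩,
    by rw [raiseAt_of_ne _ (by omega), b'0], by rw [raiseAt_self, b'1],
    by rw [raiseAt_of_ne _ (by omega)]; exact b'2, b'1, ?_, ?_, by omega⟩
  · rw [hasTile_iff hb]; push_cast; omega
  · rw [hasTile_iff hb]; push_cast; omega

theorem exists_valley_eq_of_downSlope {b : ℕ → ℤ} {j e : ℕ} (hj1 : 1 ≤ j)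
    (hl : b (j - 1) = b j + 1) (hr : b (j + 1) = b j - 1) (he : IsValley b e)
    (hej : ¬ (j + 2 ≤ e ∨ e + 2 ≤ j)) : e = j + 1 := by
  have h3 := he.1
  have h4 := he.2
  by_contra hne
  obtain rfl | rfl : e = j ∨ e + 1 = j := by omega
  · omega
  · simp only [Nat.add_sub_cancel] at hl
    omega

theorem exists_valley_eq_of_upSlope {b : ℕ → ℤ} {j e : ℕ}
    (hl : b j = b (j + 1) - 1) (hr : b (j + 2) = b (j + 1) + 1) (he : IsValley b e)
    (hej : ¬ (j + 3 ≤ e ∨ e + 2 ≤ j + 1)) : e = j := by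
  have h3 := he.1
  have h4 := he.2
  by_contra hne
  obtain rfl | rfl : e = j + 1 ∨ e = j + 2 := by omega
  · simp only [Nat.add_sub_cancel] at h3
    omega
  · have : j + 2 - 1 = j + 1 := by omega
    rw [this] at h3
    omega

/-- The symmetry of `v` under `s_i`, `i ≥ 1`, is transported through the tiles to the slopes of a
path: along a downhill slope it moves up to the right by the Yang-Baxter equation, along an uphill
slope it moves up to the left and is reflected in the column `0`. -/
theorem isSym_of_slope (G : Generic P N) (H : HeckeRep P N s) {v : M}
    (hv : ∀ i, 1 ≤ i → i < N → IsSym P s i v) {a : ℕ → ℤ} (ha : IsPath N a) {b : ℕ → ℤ}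
    (hb : IsPath N b) (hab : a ≤ b) {j : ℕ}
    (hj : DownSlope N (ct N a) b j ∨ UpSlope N (ct N a) b j) :
    IsSym P s j (tileVec P N s (ct N a) b v) := by
  induction h : defect N b using Nat.strong_induction_on generalizing b j with
  | _ n ih =>
    have hj1 : 1 ≤ j := hj.elim (·.pos) (·.pos)
    have hjN : j < N := hj.elim (·.lt) (·.lt)
    by_cases htop : b = topPath N
    · rw [htop, tileVec_top H]
      exact hv j hj1 hjN
    by_cases hfar : ∃ e, IsValley b e ∧ (j + 2 ≤ e ∨ e + 2 ≤ j)
    · -- a valley far from the slope: its factor commutes with `s_j`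
      obtain ⟨e, he, hje⟩ := hfar
      rw [tileVec_step H _ hb he]
      have e0 : raiseAt b e j = b j := raiseAt_of_ne b (by omega)
      have e1 : raiseAt b e (j - 1) = b (j - 1) := raiseAt_of_ne b (by omega)
      have e2 : raiseAt b e (j + 1) = b (j + 1) := raiseAt_of_ne b (by omega)
      refine H.isSym_of_far hjN (hb.valley_lt he) hje _ (ih _ (h ▸ defect_raise_lt hb he)
        (hb.raise he) (hab.trans (le_raiseAt b e)) ?_ rfl)
      rcases hj with hj | hj
      · refine Or.inl ⟨hj1, hjN, by rw [e0, e1, hj.left], by rw [e0, e2, hj.right], ?_⟩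
        rw [e0]
        intro ht
        exact hj.pair (ht.mono hb (hb.raise he) (le_raiseAt b e))
      · exact Or.inr ⟨hj1, hjN, by rw [e0, e1, hj.left], by rw [e0, e2, hj.right],
          by rw [e0]; exact hj.pair⟩
    · push Not at hfar
      obtain ⟨e, heN, he, -⟩ := hb.exists_valley (topPath_isPath N) hb.le_top htop
      have hej := hfar e he
      rcases hj with hj | hj
      · -- the only valley is the next point of the slope; its tile and the tile above the slope
        -- are the two factors of the Yang-Baxter equation
        obtain rfl : e = j + 1 := exists_valley_eq_of_downSlope hj1 hj.left hj.right he (by omega)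
        have hlow := hb.low (j + 1) heN.le
        obtain ⟨t, ht⟩ : ∃ t : ℕ, b j = t := ⟨(b j).toNat, by have := hj.right; omega⟩
        obtain ⟨he', b0, b1, b2, b'0, hv2, tj, tj1⟩ :=
          downSlope_geometry hb hj1 hj.left hj.right he ht
        have hb'p := hb.raise he
        have hb''p := hb'p.raise he'
        have hr := hj.right
        have n0 : (b j + 1).toNat = t + 1 := by omega
        have n1 : (b (j + 1) + 1).toNat = t := by omega
        have hpair : ct N a j (t + 1) = ct N a (j + 1) t + 1 := by
          have := hj.pair (by rw [n0]; exact tj)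
          rwa [n0, ht, Int.toNat_natCast] at this
        have hle := tj.ct_le (b := a)
        have hpos := one_le_ct (a := a) heN t
        have hd := (defect_raise_lt hb'p he').trans (h ▸ defect_raise_lt hb he)
        have hbb := (le_raiseAt b (j + 1)).trans (le_raiseAt (raiseAt b (j + 1)) j)
        rw [tileVec_step H _ hb he, tileVec_step H _ hb'p he', n1, b'0,
          show ((t : ℤ) + 1).toNat = t + 1 by omega, hpair]
        simp only at hle
        clear hej hfar htop
        refine H.isSym_of_adj G.hq hjN heN hj1 (Nat.le_add_left 1 j) (Or.inl rfl)
          (G.hqn _ hpos (by omega)) (G.hqn _ (by omega) (by omega)) ?_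
        refine ih _ hd hb''p (hab.trans hbb) (Or.inl ⟨Nat.le_add_left 1 j, heN, ?_, ?_, ?_⟩) rfl
        · rw [Nat.add_sub_cancel, b0, b1]; ring
        · rw [add_assoc, b2, b1]; ring
        · rw [b1, show ((t : ℤ) + 1 + 1).toNat = t + 2 by omega,
            show ((t : ℤ) + 1).toNat = t + 1 by omega]
          intro htile
          refine ct_pair_down ha hb hab tj1 ?_ hpair
          have := (hasTile_iff hb''p _).1 htile
          rw [hasTile_iff hb, hv2]
          simp only at this ⊢
          push_cast at this ⊢
          clear ih hb''p hb'p b0 b1 b2 he' hd hbb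
          omega
      · obtain ⟨j, rfl⟩ : ∃ j', j = j' + 1 := ⟨j - 1, by omega⟩
        have hl := hj.left
        rw [Nat.add_sub_cancel] at hl
        obtain rfl : e = j := exists_valley_eq_of_upSlope hl hj.right he (by omega)
        have hlow := hb.low e heN.le
        obtain ⟨t, ht⟩ : ∃ t : ℕ, b (e + 1) = t := ⟨(b (e + 1)).toNat, by omega⟩
        obtain ⟨he', b0, b1, b2, b'1, tj, tj1, ht2⟩ := upSlope_geometry hb hl hj.right he ht
        have hb'p := hb.raise he
        have hb''p := hb'p.raise he'
        have n0 : (b (e + 1) + 1).toNat = t + 1 := by omega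
        have n1 : (b e + 1).toNat = t := by omega
        have hpair : ct N a (e + 1) (t + 1) = ct N a e t + 1 := by
          have := hj.pair
          rwa [n0, ht, Int.toNat_natCast, Nat.add_sub_cancel] at this
        have hle := tj.ct_le (b := a)
        have hpos := one_le_ct (a := a) heN t
        simp only at hle
        have hd := (defect_raise_lt hb'p he').trans (h ▸ defect_raise_lt hb he)
        have hbb := (le_raiseAt b e).trans (le_raiseAt (raiseAt b e) (e + 1))
        rw [tileVec_step H _ hb he, tileVec_step H _ hb'p he', n1, b'1,
          show ((t : ℤ) + 1).toNat = t + 1 by omega, hpair]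
        clear hej hfar htop
        rcases e with _ | e
        · -- the slope has reached the left boundary: by the reflection equation it becomes a
          -- downhill slope after three tiles
          simp only [zero_add] at *
          have he'' : IsValley (raiseAt (raiseAt b 0) 1) 0 :=
            ⟨Or.inl rfl, by rw [b0, b1]; omega⟩
          have hb3p := hb''p.raise he''
          have b30 : raiseAt (raiseAt (raiseAt b 0) 1) 0 0 = t + 3 := by
            rw [raiseAt_self, b0]; ring
          have b31 : raiseAt (raiseAt (raiseAt b 0) 1) 0 1 = t + 2 := by
            rw [raiseAt_of_ne _ (by omega), b1]
          have b32 : raiseAt (raiseAt (raiseAt b 0) 1) 0 2 = t + 1 := by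
            rw [raiseAt_of_ne _ (by omega), b2]
          have t1 := tj.mono ha hb hab
          have hc : ct N a 0 (t + 2) = ct N a 0 t + 2 := by
            rcases ct_upper (a := a) (i := 0) heN (t + 1) with ⟨-, hh⟩ | ⟨i', hi', -, hh⟩
            · exact absurd t1 (hh _ (Or.inr rfl))
            · obtain rfl : i' = 1 := by omega
              exact hh.trans (by omega)
          have hct2 : ct N a 0 (t + 2) ≤ t + 2 + 1 := ct_le heN _
          rw [tileVec_step H _ hb''p he'', b0, show ((t : ℤ) + 1 + 1).toNat = t + 2 by omega, hc]
          refine H.isSym_of_reflection G.hq G.hω hjN (G.hqn _ hpos (by omega))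
            (G.hqn _ (by omega) (by omega)) (G.hqn _ (by omega) (by omega)) ?_
          refine ih _ ((defect_raise_lt hb''p he'').trans hd) hb3p
            (hab.trans (hbb.trans (le_raiseAt _ 0))) (Or.inl ⟨le_rfl, hjN, ?_, ?_, ?_⟩) rfl
          · rw [Nat.sub_self, b30, b31]; ring
          · rw [b32, b31]; ring
          · rw [b31, show ((t : ℤ) + 2 + 1).toNat = t + 3 by omega,
              show ((t : ℤ) + 2).toNat = t + 2 by omega]
            intro htile
            refine ct_pair_down (j := 0) (t := t + 1) ha hb hab tj ?_ (by
              rw [zero_add, hpair]; exact hc)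
            have := (hasTile_iff hb3p _).1 htile
            have e3 : b 2 = t + 1 := by rw [← ht]; exact hj.right
            rw [hasTile_iff hb]
            simp only [zero_add, e3] at this ⊢
            push_cast at this ⊢
            clear ih hb''p hb'p hb3p b0 b1 b2 b30 b31 b32 he' hd hbb
            omega
        · refine H.isSym_of_adj G.hq hjN heN hj1 (Nat.le_add_left 1 e) (Or.inr rfl)
            (G.hqn _ hpos (by omega)) (G.hqn _ (by omega) (by omega)) ?_
          have hbm : b e = t := by
            have h1 := hb.step e
            have h2 := he.1
            rw [Nat.add_sub_cancel] at h2
            omega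
          have b''m : raiseAt (raiseAt b (e + 1)) (e + 1 + 1) e = t := by
            rw [raiseAt_of_ne _ (by omega), raiseAt_of_ne b (by omega), hbm]
          refine ih _ hd hb''p (hab.trans hbb)
            (Or.inr ⟨Nat.le_add_left 1 e, heN, ?_, ?_, ?_⟩) rfl
          · rw [Nat.add_sub_cancel, b0, b''m]; ring
          · rw [b1, b0]; ring
          · rw [b0, show ((t : ℤ) + 1 + 1).toNat = t + 2 by omega,
              show ((t : ℤ) + 1).toNat = t + 1 by omega, Nat.add_sub_cancel]
            refine ct_pair_up ha hb hab tj1 ?_ hpair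
            rw [hasTile_iff hb, hbm]
            have := (hasTile_iff hb _).1 tj1
            simp only at this ⊢
            push_cast at this ⊢
            clear ih hb''p hb'p b0 b1 b2 he' hd hbb
            omega

end Slope

/-! ### The vectors of the paths -/

section Weak

variable {P : Params} {N : ℕ} {M : Type*} [AddCommGroup M] [Module ℂ M]
  {s : ℕ → Module.End ℂ M}

/-- The vector `H_a v`, each tile carrying its own integer. -/
noncomputable def hVec (P : Params) (N : ℕ) (s : ℕ → Module.End ℂ M) (a : ℕ → ℤ) (v : M) : M :=
  tileVec P N s (ct N a) a v

theorem hVec_top (H : HeckeRep P N s) (v : M) : hVec P N s (topPath N) v = v :=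
  tileVec_top H _ v

theorem hVec_valley (H : HeckeRep P N s) {a : ℕ → ℤ} (ha : IsPath N a) {i : ℕ}
    (hi : IsValley a i) (v : M) :
    hVec P N s a v = s i (tileVec P N s (ct N a) (raiseAt a i) v) := by
  rw [hVec, tileVec_step H _ ha hi, ct_valley ha hi, baxtOp_one]

theorem downSlope_self {a : ℕ → ℤ} (ha : IsPath N a) {j : ℕ} (h1 : 1 ≤ j) (hj : j < N)
    (hl : a (j - 1) = a j + 1) (hr : a (j + 1) = a j - 1) : DownSlope N (ct N a) a j := by
  refine ⟨h1, hj, hl, hr, fun ht => ?_⟩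
  have hlow := ha.low (j + 1) hj
  obtain ⟨t, ht'⟩ : ∃ t : ℕ, a j = t := ⟨(a j).toNat, by omega⟩
  have e1 : (a j + 1).toNat = t + 1 := by omega
  have e2 : (a j).toNat = t := by omega
  rw [e1] at ht
  rw [e1, e2]
  rcases ct_upper (a := a) hj t with ⟨-, h⟩ | ⟨i', hi', hti, h⟩
  · refine absurd ?_ (h (j + 1) (Or.inr rfl))
    rw [hasTile_iff ha] at ht ⊢
    simp only at ht ⊢
    push_cast at ht ⊢
    omega
  · rcases hi' with rfl | rfl
    · rw [Nat.add_sub_cancel] at hl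
      have := hti.2.1
      simp only at this
      omega
    · exact h

theorem upSlope_self {a : ℕ → ℤ} (ha : IsPath N a) {j : ℕ} (h1 : 1 ≤ j) (hj : j < N)
    (hl : a (j - 1) = a j - 1) (hr : a (j + 1) = a j + 1) : UpSlope N (ct N a) a j := by
  refine ⟨h1, hj, hl, hr, ?_⟩
  have hlow := ha.low (j - 1) (by omega)
  obtain ⟨t, ht'⟩ : ∃ t : ℕ, a j = t := ⟨(a j).toNat, by omega⟩
  rw [ht', Int.toNat_natCast, show ((t : ℤ) + 1).toNat = t + 1 by omega]
  rcases ct_upper (a := a) hj t with ⟨-, h⟩ | ⟨i', hi', hti, h⟩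
  · refine absurd ?_ (h (j - 1) (Or.inl (by omega)))
    have htop : a (j + 1) ≤ topPath N (j + 1) := ha.le_top (j + 1)
    have hp := ha.parity j
    simp only [topPath] at htop
    rw [hasTile_iff ha]
    simp only
    push_cast at htop ⊢
    omega
  · rcases hi' with rfl | rfl
    · rw [Nat.add_sub_cancel]; exact h
    · have := hti.2.1
      simp only at this
      omega

/-- `H_a v` is symmetric under `s_j` unless `a` has a peak at `j`. -/
theorem isSym_hVec (G : Generic P N) (H : HeckeRep P N s) {v : M}
    (hv : ∀ i, 1 ≤ i → i < N → IsSym P s i v) {a : ℕ → ℤ} (ha : IsPath N a) {j : ℕ}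
    (hj : j < N) (hp : ¬ IsPeak a j) : IsSym P s j (hVec P N s a v) := by
  by_cases hval : IsValley a j
  · rw [hVec_valley H ha hval]
    exact H.isSym_self hj _
  · have h1 := ha.step j
    unfold IsPeak at hp
    unfold IsValley at hval
    have hj1 : 1 ≤ j := by omega
    have h2 := ha.step' hj1
    refine isSym_of_slope G H hv ha ha le_rfl ?_
    by_cases h3 : a (j + 1) < a j
    · exact Or.inl (downSlope_self ha hj1 hj (by omega) (by omega))
    · exact Or.inr (upSlope_self ha hj1 hj (by omega) (by omega))

/-- The path obtained by subtracting `2` from the height at `i`. -/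
def lowerAt (a : ℕ → ℤ) (i : ℕ) : ℕ → ℤ := Function.update a i (a i - 2)

theorem lowerAt_self (a : ℕ → ℤ) (i : ℕ) : lowerAt a i i = a i - 2 := by simp [lowerAt]

theorem lowerAt_of_ne (a : ℕ → ℤ) {i x : ℕ} (h : x ≠ i) : lowerAt a i x = a x := by
  simp [lowerAt, h]

theorem raiseAt_lowerAt (a : ℕ → ℤ) (i : ℕ) : raiseAt (lowerAt a i) i = a := by
  funext x
  by_cases h : x = i
  · subst h; rw [raiseAt_self, lowerAt_self]; ring
  · rw [raiseAt_of_ne _ h, lowerAt_of_ne _ h]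

theorem IsPath.lower {a : ℕ → ℤ} (ha : IsPath N a) {i : ℕ} (hi : IsPeak a i) (hiN : i < N)
    (h1 : 1 ≤ a i) : IsPath N (lowerAt a i) := by
  refine ⟨fun x => ?_, fun x hx => ?_, fun x hx => ?_⟩
  · have := ha.step x
    have h2 := hi.2
    by_cases hx : x = i
    · subst hx
      rw [lowerAt_self, lowerAt_of_ne a (by omega)]
      omega
    · by_cases hx' : x + 1 = i
      · subst hx'
        have h3 := hi.1
        rw [Nat.add_sub_cancel] at h3
        rw [lowerAt_self, lowerAt_of_ne a (by omega)]
        omega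
      · rwa [lowerAt_of_ne a hx, lowerAt_of_ne a hx']
  · rw [lowerAt_of_ne a (by omega)]; exact ha.tail x hx
  · by_cases h : x = i
    · subst h; rw [lowerAt_self]; omega
    · rw [lowerAt_of_ne a h]; exact ha.low x hx

theorem IsPath.valley_lower {a : ℕ → ℤ} (ha : IsPath N a) {i : ℕ} (hi : IsPeak a i) :
    IsValley (lowerAt a i) i := by
  have h1 := ha.step i
  have h2 := hi.2
  refine ⟨?_, ?_⟩
  · rcases Nat.eq_zero_or_pos i with h0 | h0
    · exact Or.inl h0
    · right
      have := ha.step' h0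
      rw [lowerAt_self, lowerAt_of_ne a (by omega)]
      omega
  · rw [lowerAt_self, lowerAt_of_ne a (by omega)]
    omega

/-- The span of the vectors `H_b v` for the paths `b` strictly above `a`. -/
def aboveSpan (P : Params) (N : ℕ) (s : ℕ → Module.End ℂ M) (v : M) (a : ℕ → ℤ) :
    Submodule ℂ M :=
  Submodule.span ℂ {w | ∃ b, IsPath N b ∧ a ≤ b ∧ a ≠ b ∧ hVec P N s b v = w}

theorem hVec_mem_aboveSpan (v : M) {a b : ℕ → ℤ} (hb : IsPath N b) (hab : a ≤ b) (hne : a ≠ b) :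
    hVec P N s b v ∈ aboveSpan P N s v a :=
  Submodule.subset_span ⟨b, hb, hab, hne, rfl⟩

theorem aboveSpan_mono (v : M) {a b : ℕ → ℤ} (hab : a ≤ b) :
    aboveSpan P N s v b ≤ aboveSpan P N s v a := by
  refine Submodule.span_mono ?_
  rintro w ⟨b', hb', h1, h2, rfl⟩
  refine ⟨b', hb', hab.trans h1, ?_, rfl⟩
  rintro rfl
  exact h2 (le_antisymm h1 hab)

/-- Up to vectors of paths strictly above `a`, the vector `H_a v` arises by applying `s_i` to the
vector of the path with the valley at `i` raised, and does not depend on the integers of the tiles.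
-/
theorem weak_triangularity (G : Generic P N) (H : HeckeRep P N s) {v : M}
    (hv : ∀ i, 1 ≤ i → i < N → IsSym P s i v) {a : ℕ → ℤ} (ha : IsPath N a) :
    (∀ i, IsValley a i →
      s i (hVec P N s (raiseAt a i) v) - hVec P N s a v ∈ aboveSpan P N s v a) ∧
    ∀ c, tileVec P N s c a v - hVec P N s a v ∈ aboveSpan P N s v a := by
  induction h : defect N a using Nat.strong_induction_on generalizing a with
  | _ n ih =>
    -- `s_i` maps the vectors of the paths above the raised path to vectors of paths above `a`:
    -- at a peak by induction, and otherwise by symmetry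
    have star : ∀ i, IsValley a i → ∀ x ∈ aboveSpan P N s v (raiseAt a i),
        s i x ∈ aboveSpan P N s v a := by
      intro i hi x hx
      have hiN := ha.valley_lt hi
      refine Submodule.span_induction (p := fun x _ => s i x ∈ aboveSpan P N s v a)
        ?_ ?_ ?_ ?_ hx
      · rintro _ ⟨b, hb, hab, hne, rfl⟩
        have hab' : a ≤ b := (le_raiseAt a i).trans hab
        have hnb : a ≠ b := by
          rintro rfl
          exact hne (le_antisymm hab (le_raiseAt _ i))
        by_cases hp : IsPeak b i
        · have h1 : raiseAt a i i ≤ b i := hab i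
          rw [raiseAt_self] at h1
          have h0 := ha.low i hiN.le
          have hlp := hb.lower hp hiN (by omega)
          have hval := hb.valley_lower hp
          have hal : a ≤ lowerAt b i := by
            intro x
            by_cases hx : x = i
            · subst hx; rw [lowerAt_self]; exact le_sub_iff_add_le.2 h1
            · rw [lowerAt_of_ne b hx]; exact hab' x
          have hal' : a ≠ lowerAt b i := by
            intro e
            apply hne
            rw [e, raiseAt_lowerAt]
          have := (ih _ (h ▸ defect_lt ha hlp hal hal') hlp rfl).1 i hval
          rw [raiseAt_lowerAt] at this
          have h2 := (aboveSpan P N s v a).add_mem (aboveSpan_mono v hal this)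
            (hVec_mem_aboveSpan v hlp hal hal')
          rwa [sub_add_cancel] at h2
        · have := isSym_hVec G H hv hb hiN hp
          rw [IsSym] at this
          rw [this]
          exact Submodule.smul_mem _ _ (hVec_mem_aboveSpan v hb hab' hnb)
      · rw [map_zero]; exact Submodule.zero_mem _
      · intro x y _ _ hx hy
        rw [map_add]; exact Submodule.add_mem _ hx hy
      · intro r x _ hx
        rw [map_smul]; exact Submodule.smul_mem _ _ hx
    have first : ∀ i, IsValley a i →
        s i (hVec P N s (raiseAt a i) v) - hVec P N s a v ∈ aboveSpan P N s v a := by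
      intro i hi
      have h1 := (ih _ (h ▸ defect_raise_lt ha hi) (ha.raise hi) rfl).2 (ct N a)
      have h2 := star i hi _ h1
      rw [map_sub, ← hVec_valley H ha hi] at h2
      rw [← neg_sub]
      exact Submodule.neg_mem _ h2
    refine ⟨first, fun c => ?_⟩
    by_cases htop : a = topPath N
    · subst htop
      rw [hVec, tileVec_top H, tileVec_top H, sub_self]
      exact Submodule.zero_mem _
    · obtain ⟨i, -, hi, -⟩ := ha.exists_valley (topPath_isPath N) ha.le_top htop
      have h1 := (ih _ (h ▸ defect_raise_lt ha hi) (ha.raise hi) rfl).2 c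
      have h2 := star i hi _ h1
      have h3 := first i hi
      have h4 := aboveSpan_mono v (le_raiseAt a i) h1
      have h5 := hVec_mem_aboveSpan (P := P) (s := s) v (ha.raise hi) (le_raiseAt a i)
        (ne_raiseAt a i)
      rw [tileVec_step H c ha hi, baxtOp_apply]
      rw [map_sub] at h2
      set k := baxt P i (c i (a i + 1).toNat)
      have := Submodule.sub_mem _ (Submodule.add_mem _ h2 h3)
        (Submodule.smul_mem _ k (Submodule.add_mem _ h4 h5))
      convert this using 1
      module

/-- The path which goes down from the left boundary to the height `-1` at `m`, up to the maximal
path, and then down along the maximal path. -/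
def gammaPath (N m : ℕ) : ℕ → ℤ := fun j => min (|(j : ℤ) - m| - 1) (N - j)

theorem le_gammaPath {a : ℕ → ℤ} (ha : IsPath N a) {m : ℕ} (hm : a m = -1) :
    a ≤ gammaPath N m := by
  intro j
  refine le_min ?_ (ha.le_top j)
  rcases le_total m j with h | h
  · have := (ha.lip m (j - m)).1
    rw [Nat.add_sub_cancel' h, hm] at this
    have : ((j - m : ℕ) : ℤ) ≤ |(j : ℤ) - m| := by
      rw [Nat.cast_sub h]; exact le_abs_self _
    linarith
  · have := (ha.lip j (m - j)).2
    rw [Nat.add_sub_cancel' h, hm] at this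
    have : ((m - j : ℕ) : ℤ) ≤ |(j : ℤ) - m| := by
      rw [Nat.cast_sub h, abs_sub_comm]; exact le_abs_self _
    linarith

theorem gammaPath_isPath {m : ℕ} (hm : m < N) (hpar : ((m : ℤ) - N) % 2 = 1) :
    IsPath N (gammaPath N m) := by
  refine ⟨fun i => ?_, fun i hi => ?_, fun i hi => ?_⟩
  · simp only [gammaPath]
    push_cast
    rcases le_or_gt m i with h | h
    · rw [abs_of_nonneg (by omega), abs_of_nonneg (by omega)]; omega
    · rw [abs_of_nonpos (by omega), abs_of_nonpos (by omega)]; omega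
  · simp only [gammaPath]
    rw [abs_of_nonneg (by omega)]; omega
  · simp only [gammaPath]
    have := abs_nonneg ((i : ℤ) - m)
    omega

theorem gammaPath_self {m : ℕ} (hm : m < N) : gammaPath N m m = -1 := by
  simp only [gammaPath, sub_self, abs_zero]
  omega

/-- For a path through the height `-1` at `m` the tiles above `gammaPath N m` have the maximal
possible integers. -/
theorem ct_eq_of_gamma {a : ℕ → ℤ} (ha : IsPath N a) {m : ℕ} (hm : a m = -1) (hmN : m < N)
    (hpar : ((m : ℤ) - N) % 2 = 1) {t : ℕ × ℕ} (ht : HasTile N (gammaPath N m) t) :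
    ct N a t.1 t.2 = t.2 + 1 := by
  have hg := gammaPath_isPath hmN hpar
  have ht' := ht.mono ha hg (le_gammaPath ha hm)
  have h0 := (hasTile_iff hg t).1 ht
  simp only [gammaPath] at h0
  have h1 := le_abs_self ((t.1 : ℤ) - m)
  have h2 := neg_abs_le ((t.1 : ℤ) - m)
  have h3 := le_ct ha (i := t.1) (j := t.2) ht' (l := m) (by omega) (by omega)
  have h4 := ct_le (a := a) ht.1 t.2
  omega

/-- If the truncation conditions hold, then `H_a v = 0` for all paths which are not Ballot paths:
the factors of the tiles above `gammaPath N m` stand on the right, with the same integers. -/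
theorem hVec_eq_zero_of_truncation (H : HeckeRep P N s) {v : M}
    (htr : ∀ m < N, ((m : ℤ) - N) % 2 = 1 → hVec P N s (gammaPath N m) v = 0)
    {a : ℕ → ℤ} (ha : IsPath N a) {m : ℕ} (hcase : m < N) (hm : a m < 0) : hVec P N s a v = 0 := by
  have hm1 : a m = -1 := by
    have := ha.low m hcase.le
    omega
  have hpar : ((m : ℤ) - N) % 2 = 1 := by
    have := ha.parity m
    omega
  have hg := gammaPath_isPath hcase hpar
  obtain ⟨X, hX⟩ := exists_tileProd_eq_mul H (ct N a) ha hg (le_gammaPath ha hm1)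
  have : tileProd P N s (ct N a) (gammaPath N m) =
      tileProd P N s (ct N (gammaPath N m)) (gammaPath N m) := by
    refine tileProd_congr hg fun t ht => ?_
    rw [ct_eq_of_gamma ha hm1 hcase hpar ht,
      ct_eq_of_gamma hg (gammaPath_self hcase) hcase hpar ht]
  have h0 := htr m hcase hpar
  rw [hVec, tileVec] at h0
  rw [hVec, tileVec, hX, this, Module.End.mul_apply, h0, map_zero]

end Weak

/-! ### The action of the Temperley-Lieb generators on Ballot paths -/

/-- Ballot paths, as functions on `ℕ` (see `IsPath`). -/
structure IsBal (N : ℕ) (a : ℕ → ℤ) : Prop extends IsPath N a where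
  nonneg : ∀ i ≤ N, 0 ≤ a i

/-- An uphill slope at `i`, and the first point `R` after `i` with the same height. -/
structure UpArc (a : ℕ → ℤ) (i R : ℕ) : Prop where
  pos : 1 ≤ i
  left : a (i - 1) = a i - 1
  right : a (i + 1) = a i + 1
  lt : i + 1 < R
  gt : ∀ l, i < l → l < R → a i < a l
  eq : a R = a i

/-- A downhill slope at `i`, and the last point `K - 1` before `i` with the same height; `K = 0` if
there is none. -/
structure DownArc (a : ℕ → ℤ) (i K : ℕ) : Prop where
  pos : 1 ≤ i
  left : a (i - 1) = a i + 1
  right : a (i + 1) = a i - 1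
  lt : K < i
  gt : ∀ l, K ≤ l → l < i → a i < a l
  eq : K = 0 ∨ a (K - 1) = a i

/-- The ways in which a generator can act on a path at a point `i`: a valley is raised, a peak is
kept, at a slope the heights between `i` and the next (or last) return to the height at `i` are
lowered. -/
inductive Move
  | valley
  | peak
  | up (R : ℕ)
  | down (K : ℕ)

namespace Move

/-- The change of the heights. -/
def shift (i : ℕ) : Move → ℕ → ℤ
  | valley, x => if x = i then 2 else 0
  | peak, _ => 0
  | up R, x => if i < x ∧ x < R then -2 else 0
  | down K, x => if K ≤ x ∧ x < i then -2 else 0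

/-- The move which the generator `e_i` performs on the path `a`. -/
def Valid (a : ℕ → ℤ) (i : ℕ) : Move → Prop
  | valley => IsValley a i
  | peak => IsPeak a i
  | up R => UpArc a i R
  | down K => DownArc a i K

/-- The coefficient of the path proportional to `e_i |a⟩`. -/
noncomputable def coeff (P : Params) (i : ℕ) : Move → ℂ
  | valley => 1
  | peak => -loopWt P i
  | up _ => 1
  | down K => if K = 0 ∧ Even i then -loopWt P 0 else 1

end Move

theorem exists_upArc {N : ℕ} {a : ℕ → ℤ} (ha : IsPath N a) {i : ℕ} (h0 : 0 ≤ a i) (hi : i < N)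
    (hr : a (i + 1) = a i + 1) :
    ∃ R, i + 1 < R ∧ (∀ l, i < l → l < R → a i < a l) ∧ a R = a i := by
  classical
  have hex : ∃ r, i < r ∧ a r ≤ a i := ⟨N, hi, by rw [ha.tail N le_rfl]; omega⟩
  have h1 := (Nat.find_spec hex).1
  have h2 := (Nat.find_spec hex).2
  have h3 : ∀ l, i < l → l < Nat.find hex → a i < a l := fun l hl hl' => by
    have := Nat.find_min hex hl'
    omega
  have hne : Nat.find hex ≠ i + 1 := fun e => by rw [e] at h2; omega
  refine ⟨Nat.find hex, by omega, h3, ?_⟩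
  have h4 := h3 (Nat.find hex - 1) (by omega) (by omega)
  have h5 := ha.step' (i := Nat.find hex) (by omega)
  omega

theorem exists_downArc {N : ℕ} {a : ℕ → ℤ} (ha : IsPath N a) {i : ℕ} (hi : 1 ≤ i)
    (hl : a (i - 1) = a i + 1) :
    ∃ K, K < i ∧ (∀ l, K ≤ l → l < i → a i < a l) ∧ (K = 0 ∨ a (K - 1) = a i) := by
  classical
  have hex : ∃ K, K < i ∧ ∀ l, K ≤ l → l < i → a i < a l := by
    refine ⟨i - 1, by omega, fun l h1 h2 => ?_⟩
    obtain rfl : l = i - 1 := by omega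
    omega
  have h1 := (Nat.find_spec hex).1
  have h2 := (Nat.find_spec hex).2
  refine ⟨Nat.find hex, h1, h2, ?_⟩
  by_contra! h
  have h3 := Nat.find_min hex (m := Nat.find hex - 1) (by omega)
  apply h3
  refine ⟨by omega, fun l h4 h5 => ?_⟩
  rcases Nat.lt_or_ge l (Nat.find hex) with h6 | h6
  · obtain rfl : l = Nat.find hex - 1 := by omega
    have h7 := h2 (Nat.find hex) le_rfl h1
    have h8 := ha.step' (i := Nat.find hex) (by omega)
    have h9 := h.2
    omega
  · exact h2 l h6 h5

theorem exists_valid {N : ℕ} {a : ℕ → ℤ} (ha : IsBal N a) {i : ℕ} (hi : i < N) :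
    ∃ m : Move, m.Valid a i := by
  by_cases hv : IsValley a i
  · exact ⟨.valley, hv⟩
  by_cases hp : IsPeak a i
  · exact ⟨.peak, hp⟩
  have h1 := ha.step i
  unfold IsValley at hv
  unfold IsPeak at hp
  have hi1 : 1 ≤ i := by omega
  have h2 := ha.step' hi1
  by_cases hr : a (i + 1) = a i + 1
  · obtain ⟨R, h3, h4, h5⟩ := exists_upArc ha.toIsPath (ha.nonneg i hi.le) hi hr
    exact ⟨.up R, hi1, by omega, hr, h3, h4, h5⟩
  · obtain ⟨K, h3, h4, h5⟩ := exists_downArc ha.toIsPath hi1 (by omega)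
    exact ⟨.down K, hi1, by omega, by omega, h3, h4, h5⟩

open Classical in
/-- The move performed by `e_i` on `a`; there is exactly one valid move if `a` is a Ballot path. -/
noncomputable def moveAt (i : ℕ) (a : ℕ → ℤ) : Move :=
  if h : ∃ m : Move, m.Valid a i then h.choose else .peak

/-- The path proportional to `e_i |a⟩`. -/
noncomputable def img (i : ℕ) (a : ℕ → ℤ) : ℕ → ℤ := a + (moveAt i a).shift i

/-- The coefficient of the path proportional to `e_i |a⟩`. -/
noncomputable def kap (P : Params) (i : ℕ) (a : ℕ → ℤ) : ℂ := (moveAt i a).coeff P i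

section Img

variable {P : Params} {N : ℕ} {a : ℕ → ℤ} {i j : ℕ}

theorem UpArc.unique {R R' : ℕ} (h : UpArc a i R) (h' : UpArc a i R') : R = R' := by
  have := h.gt R'
  have := h'.gt R
  have := h.eq
  have := h'.eq
  have := h.lt
  have := h'.lt
  omega

theorem DownArc.unique {K K' : ℕ} (h : DownArc a i K) (h' : DownArc a i K') : K = K' := by
  have := h.gt (K' - 1)
  have := h'.gt (K - 1)
  have := h.eq
  have := h'.eq
  have := h.lt
  have := h'.lt
  omega

theorem Move.Valid.unique {m m' : Move} (h : m.Valid a i) (h' : m'.Valid a i) : m = m' := by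
  cases m <;> cases m' <;> simp only [Move.Valid] at h h'
  all_goals first
    | rfl
    | rw [h.unique h']
    | (exfalso; have := h.1; have := h.2; have := h'.1; have := h'.2
       first
        | omega
        | (have := h'.pos; have := h'.left; have := h'.right; omega)
        | (have := h.pos; have := h.left; have := h.right; omega))

theorem Move.Valid.moveAt_eq {m : Move} (h : m.Valid a i) : moveAt i a = m := by
  have hex : ∃ m : Move, m.Valid a i := ⟨m, h⟩
  rw [moveAt, dif_pos hex]
  exact hex.choose_spec.unique h

theorem Move.Valid.img_eq {m : Move} (h : m.Valid a i) : img i a = a + m.shift i := by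
  rw [img, h.moveAt_eq]

theorem Move.Valid.kap_eq {m : Move} (h : m.Valid a i) : kap P i a = m.coeff P i := by
  rw [kap, h.moveAt_eq]

theorem valid_moveAt (ha : IsBal N a) (hi : i < N) : (moveAt i a).Valid a i := by
  obtain ⟨m, h⟩ := exists_valid ha hi
  rwa [h.moveAt_eq]

theorem add_shift_valley (a : ℕ → ℤ) (i : ℕ) : a + Move.valley.shift i = raiseAt a i := by
  funext x
  by_cases h : x = i
  · subst h; simp [Move.shift, raiseAt_self]
  · simp [Move.shift, h, raiseAt_of_ne]

/-- The image of `e_i` is spanned by paths with a peak at `i`. -/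
theorem Move.Valid.isPeak (ha : IsPath N a) {m : Move} (h : m.Valid a i) :
    IsPeak (a + m.shift i) i := by
  cases m with
  | valley =>
    have h1 := h.1
    have h2 := h.2
    have h3 := ha.step i
    have h4 := fun hi => ha.step' (i := i) hi
    simp only [IsPeak, Pi.add_apply, Move.shift]
    split_ifs <;> omega
  | peak => simpa [IsPeak, Move.shift, Move.Valid] using h
  | up R =>
    have h1 := h.pos
    have h2 := h.left
    have h3 := h.right
    have h4 := h.lt
    simp only [IsPeak, Pi.add_apply, Move.shift]
    split_ifs <;> omega
  | down K =>
    have h1 := h.pos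
    have h2 := h.left
    have h3 := h.right
    have h4 := h.lt
    simp only [IsPeak, Pi.add_apply, Move.shift]
    split_ifs <;> omega

theorem Move.Valid.isBal (ha : IsBal N a) (hi : i < N) {m : Move} (h : m.Valid a i) :
    IsBal N (a + m.shift i) := by
  cases m with
  | valley =>
    rw [add_shift_valley]
    exact ⟨ha.raise h, fun x hx => (ha.nonneg x hx).trans (le_raiseAt a i x)⟩
  | peak => convert ha using 1; funext x; simp [Move.shift]
  | up R =>
    have h1 := h.pos
    have h2 := h.left
    have h3 := h.right
    have h4 := h.lt
    have h6 := h.eq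
    have h0 := ha.nonneg (i - 1) (by omega)
    have hR : R ≤ N := by
      by_contra! hR
      have := h.gt N hi hR
      rw [ha.tail N le_rfl] at this
      have := ha.nonneg i hi.le
      omega
    have hnn : ∀ x ≤ N, 0 ≤ (a + (Move.up R).shift i) x := fun x hx => by
      have := ha.nonneg x hx
      have := h.gt x
      simp only [Pi.add_apply, Move.shift]
      split_ifs <;> omega
    refine ⟨⟨fun x => ?_, fun x hx => ?_, fun x hx => ?_⟩, hnn⟩
    · have s1 := ha.step x
      have s3 := h.gt (R - 1) (by omega) (by omega)
      have s4 := ha.step' (i := R) (by omega)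
      have e1 : x + 1 = R → a (x + 1) = a R ∧ a x = a (R - 1) := fun e => by subst e; simp
      have e2 : x = i → a x = a i ∧ a (x + 1) = a (i + 1) := fun e => by subst e; simp
      simp only [Pi.add_apply, Move.shift]
      split_ifs <;> omega
    · simp only [Pi.add_apply, Move.shift]
      rw [if_neg (by omega), add_zero]; exact ha.tail x hx
    · have := hnn x hx
      omega
  | down K =>
    have h1 := h.pos
    have h2 := h.left
    have h3 := h.right
    have h4 := h.lt
    have h6 := h.eq
    have h0 := ha.nonneg (i + 1) hi
    have hnn : ∀ x ≤ N, 0 ≤ (a + (Move.down K).shift i) x := fun x hx => by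
      have := ha.nonneg x hx
      have := h.gt x
      simp only [Pi.add_apply, Move.shift]
      split_ifs <;> omega
    refine ⟨⟨fun x => ?_, fun x hx => ?_, fun x hx => ?_⟩, hnn⟩
    · have s1 := ha.step x
      have s3 := h.gt K le_rfl h4
      have e1 : x + 1 = i → a (x + 1) = a i ∧ a x = a (i - 1) := fun e => by subst e; simp
      have e2 : x + 1 = K → a x = a (K - 1) ∧ a (x + 1) = a K := fun e => by subst e; simp
      simp only [Pi.add_apply, Move.shift]
      split_ifs <;> omega
    · simp only [Pi.add_apply, Move.shift]
      rw [if_neg (by omega), add_zero]; exact ha.tail x hx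
    · have := hnn x hx
      omega

/-- For neighbouring `i` and `j`, the product `e_j e_i` fixes the paths with a peak at `j`. As the
image of `e_j` is spanned by such paths, `e_j e_i e_j = e_j`. -/
theorem valid_return (ha : IsPath N a) (hj : 1 ≤ j) (hp : IsPeak a j)
    (hij : i = j + 1 ∨ i + 1 = j) {m : Move} (hm : m.Valid a i) :
    ∃ n : Move, n.Valid (a + m.shift i) j ∧ m.shift i + n.shift j = 0 ∧
      m.coeff P i * n.coeff P j = 1 := by
  have p1 := hp.1
  have p2 := hp.2
  have s1 := ha.step' hj
  have s2 := ha.step j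
  have s3 := ha.step i
  rcases hij with rfl | rfl
  · cases m with
    | valley =>
      have h2 := hm.2
      refine ⟨.up (j + 2), ⟨hj, ?_, ?_, by omega, fun l h1 h2 => ?_, ?_⟩, ?_, ?_⟩
      · simp only [Pi.add_apply, Move.shift]; split_ifs <;> omega
      · simp only [Pi.add_apply, Move.shift]; split_ifs <;> omega
      · obtain rfl : l = j + 1 := by omega
        simp only [Pi.add_apply, Move.shift]; split_ifs <;> omega
      · simp only [Pi.add_apply, Move.shift, show j + 2 ≠ j + 1 by omega, if_false]
        rw [show j + 1 + 1 = j + 2 by ring] at h2 s3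
        split_ifs <;> omega
      · funext x
        simp only [Pi.add_apply, Move.shift, Pi.zero_apply]; split_ifs <;> omega
      · simp [Move.coeff]
    | peak =>
      have := hm.1
      rw [Nat.add_sub_cancel] at this
      omega
    | up R =>
      have := hm.left
      rw [Nat.add_sub_cancel] at this
      omega
    | down K =>
      obtain rfl : K = j := by
        have h1 := hm.lt
        have h2 := hm.eq
        have h3 := hm.gt (j - 1)
        have h4 : K = j + 1 → a (K - 1) = a j := by rintro rfl; simp
        omega
      refine ⟨.valley, ⟨Or.inr ?_, ?_⟩, ?_, ?_⟩
      · simp only [Pi.add_apply, Move.shift]; split_ifs <;> omega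
      · simp only [Pi.add_apply, Move.shift]; split_ifs <;> omega
      · funext x
        simp only [Pi.add_apply, Move.shift, Pi.zero_apply]; split_ifs <;> omega
      · simp [Move.coeff]; omega
  · rw [Nat.add_sub_cancel] at p1 s1
    have s4 := fun hi => ha.step' (i := i) hi
    cases m with
    | valley =>
      have h1 := hm.1
      refine ⟨.down i, ⟨hj, ?_, ?_, by omega, fun l h1 h2 => ?_, ?_⟩, ?_, ?_⟩
      · rw [Nat.add_sub_cancel]
        simp only [Pi.add_apply, Move.shift]; split_ifs <;> omega
      · simp only [Pi.add_apply, Move.shift]; split_ifs <;> omega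
      · obtain rfl : l = i := by omega
        simp only [Pi.add_apply, Move.shift]; split_ifs <;> omega
      · simp only [Pi.add_apply, Move.shift]; split_ifs <;> omega
      · funext x
        simp only [Pi.add_apply, Move.shift, Pi.zero_apply]; split_ifs <;> omega
      · simp only [Move.coeff, one_mul]
        rw [if_neg]
        rintro ⟨rfl, h⟩
        simp at h
    | peak =>
      have := hm.2
      omega
    | up R =>
      have h1 := hm.pos
      obtain rfl : R = i + 2 := by
        have h1 := hm.lt
        have h2 := hm.eq
        have h3 := hm.gt (i + 1 + 1)
        omega
      refine ⟨.valley, ⟨Or.inr ?_, ?_⟩, ?_, ?_⟩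
      · rw [Nat.add_sub_cancel]
        simp only [Pi.add_apply, Move.shift]; split_ifs <;> omega
      · simp only [Pi.add_apply, Move.shift]; split_ifs <;> omega
      · funext x
        simp only [Pi.add_apply, Move.shift, Pi.zero_apply]; split_ifs <;> omega
      · simp [Move.coeff]
    | down K =>
      have := hm.right
      omega

end Img

/-! ### Commutation of distant generators -/

section Comm

variable {P : Params} {N : ℕ} {a : ℕ → ℤ} {i j : ℕ}

/-- The moves `m` of `e_i` and `m'` of `e_j` on `a` can be completed to the two products `e_j e_i`
and `e_i e_j`, which lead to the same path with the same coefficient. -/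
def Square (P : Params) (a : ℕ → ℤ) (i j : ℕ) (m m' : Move) : Prop :=
  ∃ n n' : Move, n.Valid (a + m.shift i) j ∧ n'.Valid (a + m'.shift j) i ∧
    m.shift i + n.shift j = m'.shift j + n'.shift i ∧
    m.coeff P i * n.coeff P j = m'.coeff P j * n'.coeff P i

/-- The generic case: neither move affects the other one. -/
theorem Square.of_valid {m m' : Move} (h : m'.Valid (a + m.shift i) j)
    (h' : m.Valid (a + m'.shift j) i) : Square P a i j m m' :=
  ⟨m', m, h, h', add_comm _ _, mul_comm _ _⟩

theorem IsValley.add_of_eq {f : ℕ → ℤ} (h : IsValley a i) (h1 : f (i + 1) = f i)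
    (h2 : i = 0 ∨ f (i - 1) = f i) : IsValley (a + f) i := by
  have := h.1
  have := h.2
  simp only [IsValley, Pi.add_apply]
  omega

theorem IsPeak.add_of_eq {f : ℕ → ℤ} (h : IsPeak a i) (h1 : f (i + 1) = f i)
    (h2 : i = 0 ∨ f (i - 1) = f i) : IsPeak (a + f) i := by
  have := h.1
  have := h.2
  simp only [IsPeak, Pi.add_apply]
  omega

/-- An arc survives a change of the heights which is constant along its feet and does not lower its
interior to the height of the feet. -/
theorem UpArc.add_of_eq {f : ℕ → ℤ} {R : ℕ} (h : UpArc a i R) (h1 : f (i + 1) = f i)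
    (h2 : f (i - 1) = f i) (h3 : f R = f i)
    (h4 : ∀ l, i < l → l < R → f i ≤ f l ∨ a i + 2 < a l ∧ f i ≤ f l + 2) :
    UpArc (a + f) i R := by
  have e1 := h.left
  have e2 := h.right
  have e3 := h.eq
  refine ⟨h.pos, ?_, ?_, h.lt, fun l hl hl' => ?_, ?_⟩
  · simp only [Pi.add_apply]; omega
  · simp only [Pi.add_apply]; omega
  · have := h.gt l hl hl'
    have := h4 l hl hl'
    simp only [Pi.add_apply]; omega
  · simp only [Pi.add_apply]; omega

theorem DownArc.add_of_eq {f : ℕ → ℤ} {K : ℕ} (h : DownArc a i K) (h1 : f (i + 1) = f i)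
    (h2 : f (i - 1) = f i) (h3 : K = 0 ∨ f (K - 1) = f i)
    (h4 : ∀ l, K ≤ l → l < i → f i ≤ f l ∨ a i + 2 < a l ∧ f i ≤ f l + 2) :
    DownArc (a + f) i K := by
  have e1 := h.left
  have e2 := h.right
  have e3 := h.eq
  refine ⟨h.pos, ?_, ?_, h.lt, fun l hl hl' => ?_, ?_⟩
  · simp only [Pi.add_apply]; omega
  · simp only [Pi.add_apply]; omega
  · have := h.gt l hl hl'
    have := h4 l hl hl'
    simp only [Pi.add_apply]; omega
  · simp only [Pi.add_apply]; omega

theorem add_shift_peak (a : ℕ → ℤ) (i : ℕ) : a + Move.peak.shift i = a := by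
  funext x; simp [Move.shift]

/-- A generator `e_i` acting at a valley or a peak, and a generator `e_j` with `j ≥ i + 2`. -/
theorem square_local (ha : IsPath N a) (hij : i + 2 ≤ j) {m m' : Move}
    (hm : m = .valley ∨ m = .peak) (h : m.Valid a i) (h' : m'.Valid a j) :
    Square P a i j m m' := by
  have hloc : ∀ {f : ℕ → ℤ}, f (i + 1) = f i → (i = 0 ∨ f (i - 1) = f i) →
      m.Valid (a + f) i := by
    intro f h1 h2
    rcases hm with rfl | rfl
    · exact IsValley.add_of_eq h h1 h2
    · exact IsPeak.add_of_eq h h1 h2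
  have hs : ∀ x, x ≠ i → m.shift i x = 0 := by
    intro x hx
    rcases hm with rfl | rfl
    · simp [Move.shift, hx]
    · rfl
  have hs0 : 0 ≤ m.shift i i := by
    rcases hm with rfl | rfl <;> simp [Move.shift]
  have hs1 : ∀ x, 0 ≤ m.shift i x := fun x => by
    by_cases hx : x = i
    · rw [hx]; exact hs0
    · rw [hs x hx]
  cases m' with
  | valley =>
    refine .of_valid (IsValley.add_of_eq h' ?_ (Or.inr ?_)) (hloc ?_ ?_)
    · rw [hs _ (by omega), hs _ (by omega)]
    · rw [hs _ (by omega), hs _ (by omega)]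
    · simp only [Move.shift]; split_ifs <;> omega
    · simp only [Move.shift]; split_ifs <;> omega
  | peak => exact .of_valid (IsPeak.add_of_eq h' (by rw [hs _ (by omega), hs _ (by omega)])
      (Or.inr (by rw [hs _ (by omega), hs _ (by omega)]))) (hloc rfl (Or.inr rfl))
  | up R =>
    have h1 := UpArc.lt h'
    refine .of_valid (UpArc.add_of_eq h' ?_ ?_ ?_ fun l h2 h3 => Or.inl ?_) (hloc ?_ ?_)
    · rw [hs _ (by omega), hs _ (by omega)]
    · rw [hs _ (by omega), hs _ (by omega)]
    · rw [hs _ (by omega), hs _ (by omega)]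
    · rw [hs _ (by omega), hs _ (by omega)]
    · simp only [Move.shift]; split_ifs <;> omega
    · simp only [Move.shift]; split_ifs <;> omega
  | down K =>
    have k1 := DownArc.lt h'
    have k2 := DownArc.eq h'
    have k3 := DownArc.gt h'
    by_cases hK : K = i + 1
    · -- the valley at `i` is the last visit to the height at `j`
      subst hK
      have e : a i = a j := by simpa using k2
      obtain rfl : m = .valley := by
        rcases hm with rfl | rfl
        · rfl
        · have := h.2
          have := k3 (i + 1) (by omega) (by omega)
          omega
      have v1 := h.1
      have v2 := h.2
      have p1 := ha.parity i
      have p2 := ha.parity j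
      have s1 := ha.step i
      rcases Nat.eq_zero_or_pos i with rfl | hi
      · refine ⟨.down 0, .peak, ⟨DownArc.pos h', ?_, ?_, by omega, fun l hl hl' => ?_, Or.inl rfl⟩,
          ⟨Or.inl rfl, ?_⟩, ?_, ?_⟩
        · have := DownArc.left h'
          simp only [Pi.add_apply, Move.shift]; split_ifs <;> omega
        · have := DownArc.right h'
          simp only [Pi.add_apply, Move.shift]; split_ifs <;> first | omega | contradiction
        · have := k3 l
          have : l = 0 → a l = a 0 := by rintro rfl; rfl
          simp only [Pi.add_apply, Move.shift]; split_ifs <;> omega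
        · simp only [Pi.add_apply, Move.shift]; split_ifs <;> omega
        · funext x
          simp only [Pi.add_apply, Move.shift]; split_ifs <;> omega
        · have : Even j := by rw [Nat.even_iff]; omega
          simp [Move.coeff, this]
      · have s2 := ha.step' hi
        obtain ⟨K, q1, q2, q3⟩ := exists_downArc ha hi (by omega)
        refine ⟨.down K, .down K, ⟨DownArc.pos h', ?_, ?_, by omega, fun l hl hl' => ?_, ?_⟩,
          ⟨hi, ?_, ?_, q1, fun l hl hl' => ?_, ?_⟩, ?_, ?_⟩
        · have := DownArc.left h'
          simp only [Pi.add_apply, Move.shift]; split_ifs <;> omega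
        · have := DownArc.right h'
          simp only [Pi.add_apply, Move.shift]; split_ifs <;> omega
        · have := k3 l
          have := q2 l
          have : l = i → a l = a i := by rintro rfl; rfl
          simp only [Pi.add_apply, Move.shift]; split_ifs <;> omega
        · simp only [Pi.add_apply, Move.shift]; split_ifs <;> omega
        · simp only [Pi.add_apply, Move.shift]; split_ifs <;> omega
        · simp only [Pi.add_apply, Move.shift]; split_ifs <;> omega
        · have := q2 l hl hl'
          simp only [Pi.add_apply, Move.shift]; split_ifs <;> omega
        · simp only [Pi.add_apply, Move.shift]; split_ifs <;> omega
        · funext x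
          simp only [Pi.add_apply, Move.shift]; split_ifs <;> omega
        · have : Even j ↔ Even i := by rw [Nat.even_iff, Nat.even_iff]; omega
          simp [Move.coeff, this]
    · have hKi : K ≠ i ∨ K = 0 := by
        by_contra! hc
        obtain ⟨rfl, hc⟩ := hc
        have q1 := k3 K le_rfl k1
        have q2 := k3 (K + 1) (by omega) (by omega)
        rcases hm with rfl | rfl
        · have := h.1
          omega
        · have := h.2
          have := ha.step K
          have := ha.step' (i := K) (by omega)
          have := h.1
          omega
      refine .of_valid (DownArc.add_of_eq h' ?_ ?_ ?_ fun l h2 h3 => Or.inl ?_) (hloc ?_ ?_)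
      · rw [hs _ (by omega), hs _ (by omega)]
      · rw [hs _ (by omega), hs _ (by omega)]
      · rcases Nat.eq_zero_or_pos K with h0 | h0
        · exact Or.inl h0
        · right; rw [hs _ (by omega), hs _ (by omega)]
      · rw [hs j (by omega)]; exact hs1 l
      · simp only [Move.shift]; split_ifs <;> omega
      · simp only [Move.shift]; split_ifs <;> omega

/-- A generator `e_i` acting at a downhill slope, and a generator `e_j` with `j ≥ i + 2`. -/
theorem square_down (hij : i + 2 ≤ j) {K : ℕ} {m' : Move}
    (h : DownArc a i K) (h' : m'.Valid a j) : Square P a i j (.down K) m' := by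
  have h1 := h.lt
  have h2 := h.eq
  have h3 := h.gt
  have h4 := h.right
  cases m' with
  | valley =>
    refine .of_valid (IsValley.add_of_eq h' ?_ (Or.inr ?_))
      (DownArc.add_of_eq h ?_ ?_ (Or.inr ?_) fun l h2 h3 => Or.inl ?_) <;>
    · simp only [Move.shift]; split_ifs <;> omega
  | peak =>
    refine .of_valid (IsPeak.add_of_eq h' ?_ (Or.inr ?_))
      (DownArc.add_of_eq h rfl rfl (Or.inr rfl) fun l h2 h3 => Or.inl le_rfl) <;>
    · simp only [Move.shift]; split_ifs <;> omega
  | up R =>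
    have k1 := UpArc.lt h'
    refine .of_valid (UpArc.add_of_eq h' ?_ ?_ ?_ fun l h2 h3 => Or.inl ?_)
      (DownArc.add_of_eq h ?_ ?_ (Or.inr ?_) fun l h2 h3 => Or.inl ?_) <;>
    · simp only [Move.shift]; split_ifs <;> omega
  | down K' =>
    have k1 := DownArc.lt h'
    have k2 := DownArc.eq h'
    have k3 := DownArc.gt h'
    have q0 : K' ≠ i + 1 := by
      rintro rfl
      have := k3 (i + 1) (by omega) (by omega)
      rw [Nat.add_sub_cancel] at k2
      omega
    by_cases hK : K' ≤ i
    · have q1 := k3 i hK (by omega)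
      have q2 := k3 (i + 1) (by omega) (by omega)
      have q3 : K' + 1 ≤ K ∨ K = 0 ∧ K' = 0 := by
        have := h3 (K' - 1)
        by_contra! hc
        by_cases e : K' = K
        · subst e; omega
        · omega
      refine .of_valid (DownArc.add_of_eq h' ?_ ?_ ?_ fun l h5 h6 => ?_)
        (DownArc.add_of_eq h ?_ ?_ ?_ fun l h5 h6 => Or.inl ?_)
      · simp only [Move.shift]; split_ifs <;> omega
      · simp only [Move.shift]; split_ifs <;> omega
      · simp only [Move.shift]; split_ifs <;> omega
      · have := h3 l
        simp only [Move.shift]; split_ifs <;> omega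
      · simp only [Move.shift]; split_ifs <;> omega
      · simp only [Move.shift]; split_ifs <;> omega
      · simp only [Move.shift]; split_ifs <;> omega
      · simp only [Move.shift]; split_ifs <;> omega
    · refine .of_valid (DownArc.add_of_eq h' ?_ ?_ (Or.inr ?_) fun l h5 h6 => Or.inl ?_)
        (DownArc.add_of_eq h ?_ ?_ (Or.inr ?_) fun l h5 h6 => Or.inl ?_) <;>
      · simp only [Move.shift]; split_ifs <;> omega

/-- A generator `e_i` acting at an uphill slope, and a generator `e_j` with `j ≥ i + 2`. -/
theorem square_up (ha : IsBal N a) (hij : i + 2 ≤ j) (hj : j < N) {R : ℕ} {m' : Move}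
    (h : UpArc a i R) (h' : m'.Valid a j) : Square P a i j (.up R) m' := by
  have h0 := h.pos
  have h1 := h.lt
  have h2 := h.eq
  have h3 := h.gt
  have h4 := h.right
  have h5 := h.left
  have g1 := h3 j (by omega)
  have g2 := h3 (j + 1) (by omega)
  have g3 := h3 (j - 1) (by omega)
  have e1 : R = j → a R = a j := by rintro rfl; rfl
  have e2 : R = j + 1 → a R = a (j + 1) := by rintro rfl; rfl
  cases m' with
  | valley =>
    have v2 := h'.1
    have v3 := h'.2
    have s1 := ha.step j
    have s2 := ha.step' (i := j) (by omega)
    have q : R ≠ j + 1 := fun e => by have := e2 e; omega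
    by_cases hR : R = j
    · -- the valley at `j` is the first return to the height at `i`
      subst hR
      obtain ⟨R', q1, q2, q3⟩ := exists_upArc ha.toIsPath (ha.nonneg R hj.le) hj (by omega)
      refine ⟨.up R', .up R', ⟨by omega, ?_, ?_, q1, fun l hl hl' => ?_, ?_⟩,
          ⟨h0, ?_, ?_, by omega, fun l hl hl' => ?_, ?_⟩, ?_, ?_⟩
      · simp only [Pi.add_apply, Move.shift]; split_ifs <;> omega
      · simp only [Pi.add_apply, Move.shift]; split_ifs <;> omega
      · have := q2 l hl hl'
        simp only [Pi.add_apply, Move.shift]; split_ifs <;> omega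
      · simp only [Pi.add_apply, Move.shift]; split_ifs <;> omega
      · simp only [Pi.add_apply, Move.shift]; split_ifs <;> omega
      · simp only [Pi.add_apply, Move.shift]; split_ifs <;> omega
      · have := h3 l hl
        have := q2 l
        have : l = R → a l = a R := by rintro rfl; rfl
        simp only [Pi.add_apply, Move.shift]; split_ifs <;> omega
      · simp only [Pi.add_apply, Move.shift]; split_ifs <;> omega
      · funext x
        simp only [Pi.add_apply, Move.shift]; split_ifs <;> omega
      · simp [Move.coeff]
    · refine .of_valid (IsValley.add_of_eq h' ?_ (Or.inr ?_))
        (UpArc.add_of_eq h ?_ ?_ ?_ fun l h5 h6 => Or.inl ?_) <;>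
      · simp only [Move.shift]; split_ifs <;> omega
  | peak =>
    have v2 := h'.1
    have v3 := h'.2
    have s2 := ha.step' (i := j) (by omega)
    have s1 := ha.step j
    have q1 : R ≠ j := fun e => by have := e1 e; omega
    have q2 : R ≠ j + 1 := fun e => by have := e2 e; omega
    refine .of_valid (IsPeak.add_of_eq h' ?_ (Or.inr ?_))
      (UpArc.add_of_eq h rfl rfl rfl fun l h5 h6 => Or.inl le_rfl) <;>
    · simp only [Move.shift]; split_ifs <;> omega
  | up R' =>
    have k1 := UpArc.lt h'
    have k2 := UpArc.eq h'
    have k3 := UpArc.gt h'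
    have k4 := UpArc.left h'
    have k5 := UpArc.right h'
    have q1 : R ≠ j := fun e => by have := e1 e; omega
    have q2 : R ≠ j + 1 := fun e => by have := e2 e; omega
    have k6 := k3 R
    have q3 : R ≤ j - 1 ∨ R' < R := by
      by_contra! hc
      rcases hc.2.eq_or_lt with e | e
      · subst e; omega
      · omega
    refine .of_valid (UpArc.add_of_eq h' ?_ ?_ ?_ fun l h5 h6 => Or.inl ?_)
      (UpArc.add_of_eq h ?_ ?_ ?_ fun l h5 h6 => ?_)
    · simp only [Move.shift]; split_ifs <;> omega
    · simp only [Move.shift]; split_ifs <;> omega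
    · simp only [Move.shift]; split_ifs <;> omega
    · simp only [Move.shift]; split_ifs <;> omega
    · simp only [Move.shift]; split_ifs <;> omega
    · simp only [Move.shift]; split_ifs <;> omega
    · simp only [Move.shift]; split_ifs <;> omega
    · have := k3 l
      simp only [Move.shift]; split_ifs <;> omega
  | down K =>
    have k1 := DownArc.lt h'
    have k2 := DownArc.eq h'
    have k3 := DownArc.gt h'
    have k4 := DownArc.left h'
    have k5 := DownArc.right h'
    have hi := k3 i
    have hi1 := k3 (i + 1)
    have him := k3 (i - 1)
    have f1 : K = i → a (K - 1) = a (i - 1) := by rintro rfl; rfl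
    have f2 : K = i + 1 → a (K - 1) = a i := by rintro rfl; simp
    have f3 : K = i + 2 → a (K - 1) = a (i + 1) := by rintro rfl; simp
    rcases Nat.lt_or_ge R j with hR | hR
    · by_cases hK : R + 1 ≤ K
      · refine .of_valid (DownArc.add_of_eq h' ?_ ?_ (Or.inr ?_) fun l h5 h6 => Or.inl ?_)
          (UpArc.add_of_eq h ?_ ?_ ?_ fun l h5 h6 => Or.inl ?_) <;>
        · simp only [Move.shift]; split_ifs <;> omega
      · have q1 := k3 R (by omega) hR
        have q2 : K ≤ i := by
          have := h3 (K - 1)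
          omega
        by_cases hKi : K = i
        · -- the uphill step to `i` starts from the last visit to the height at `j`
          subst hKi
          have k2' : a (K - 1) = a j := by omega
          have s1 := h3 (R - 1) (by omega) (by omega)
          have s2 := ha.step' (i := R) (by omega)
          refine ⟨.down R, .valley, ⟨by omega, ?_, ?_, hR, fun l hl hl' => ?_, Or.inr ?_⟩,
            ⟨Or.inr ?_, ?_⟩, ?_, ?_⟩
          · simp only [Pi.add_apply, Move.shift]; split_ifs <;> omega
          · simp only [Pi.add_apply, Move.shift]; split_ifs <;> omega
          · have := k3 l (by omega) hl'
            simp only [Pi.add_apply, Move.shift]; split_ifs <;> omega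
          · simp only [Pi.add_apply, Move.shift]; split_ifs <;> omega
          · simp only [Pi.add_apply, Move.shift]; split_ifs <;> omega
          · simp only [Pi.add_apply, Move.shift]; split_ifs <;> omega
          · funext x
            simp only [Pi.add_apply, Move.shift]; split_ifs <;> omega
          · have e1 : R ≠ 0 := by omega
            have e2 : K ≠ 0 := by omega
            simp [Move.coeff, e1, e2]
        · refine .of_valid (DownArc.add_of_eq h' ?_ ?_ ?_ fun l h5 h6 => ?_)
            (UpArc.add_of_eq h ?_ ?_ ?_ fun l h5 h6 => Or.inl ?_)
          · simp only [Move.shift]; split_ifs <;> omega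
          · simp only [Move.shift]; split_ifs <;> omega
          · right; simp only [Move.shift]; split_ifs <;> omega
          · have := h3 l
            simp only [Move.shift]; split_ifs <;> omega
          · simp only [Move.shift]; split_ifs <;> omega
          · simp only [Move.shift]; split_ifs <;> omega
          · simp only [Move.shift]; split_ifs <;> omega
          · simp only [Move.shift]; split_ifs <;> omega
    · have q1 : i + 1 ≤ K := by
        by_contra! hc
        have := hi (by omega) (by omega)
        rcases hR.eq_or_lt with e | e
        · have := e1 e.symm
          omega
        · omega
      by_cases hRj : R = j
      · -- both generators lower the whole arc between `i` and `j`
        subst hRj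
        obtain rfl : K = i + 1 := by
          have := h3 (K - 1)
          omega
        refine ⟨.peak, .peak, ⟨Or.inr ?_, ?_⟩, ⟨Or.inr ?_, ?_⟩, ?_, ?_⟩
        · simp only [Pi.add_apply, Move.shift]; split_ifs <;> omega
        · simp only [Pi.add_apply, Move.shift]; split_ifs <;> omega
        · simp only [Pi.add_apply, Move.shift]; split_ifs <;> omega
        · simp only [Pi.add_apply, Move.shift]; split_ifs <;> omega
        · funext x
          simp only [Pi.add_apply, Move.shift]; split_ifs <;> omega
        · have e1 : 1 ≤ R := by omega
          simp [Move.coeff, loopWt_pos h0, loopWt_pos e1]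
      · have q2 : i + 2 ≤ K := by omega
        have q3 := ha.step' (i := K) (by omega)
        have q4 := k3 K le_rfl k1
        by_cases hRj1 : R = j + 1
        · -- the arc over `i` ends with the downhill step after `j`
          subst hRj1
          refine ⟨.valley, .up K, ⟨Or.inr ?_, ?_⟩, ⟨h0, ?_, ?_, by omega, fun l hl hl' => ?_, ?_⟩,
            ?_, ?_⟩
          · simp only [Pi.add_apply, Move.shift]; split_ifs <;> omega
          · simp only [Pi.add_apply, Move.shift]; split_ifs <;> omega
          · simp only [Pi.add_apply, Move.shift]; split_ifs <;> omega
          · simp only [Pi.add_apply, Move.shift]; split_ifs <;> omega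
          · have := h3 l
            simp only [Pi.add_apply, Move.shift]; split_ifs <;> omega
          · simp only [Pi.add_apply, Move.shift]; split_ifs <;> omega
          · funext x
            simp only [Pi.add_apply, Move.shift]; split_ifs <;> omega
          · have e2 : K ≠ 0 := by omega
            simp [Move.coeff, e2]
        · refine .of_valid (DownArc.add_of_eq h' ?_ ?_ (Or.inr ?_) fun l h5 h6 => Or.inl ?_)
            (UpArc.add_of_eq h ?_ ?_ ?_ fun l h5 h6 => ?_)
          · simp only [Move.shift]; split_ifs <;> omega
          · simp only [Move.shift]; split_ifs <;> omega
          · simp only [Move.shift]; split_ifs <;> omega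
          · simp only [Move.shift]; split_ifs <;> omega
          · simp only [Move.shift]; split_ifs <;> omega
          · simp only [Move.shift]; split_ifs <;> omega
          · simp only [Move.shift]; split_ifs <;> omega
          · have := k3 l
            simp only [Move.shift]; split_ifs <;> omega

/-- Generators whose indices differ by at least two commute. -/
theorem square_of_valid (ha : IsBal N a) (hij : i + 2 ≤ j) (hj : j < N) {m m' : Move}
    (h : m.Valid a i) (h' : m'.Valid a j) : Square P a i j m m' := by
  cases m with
  | valley => exact square_local ha.toIsPath hij (Or.inl rfl) h h'
  | peak => exact square_local ha.toIsPath hij (Or.inr rfl) h h'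
  | up R => exact square_up ha hij hj h h'
  | down K => exact square_down hij h h'

end Comm

/-! ### The dual of the Ballot path representation -/

section Ring

variable {A : Type*} [Ring A] [Algebra ℂ A]

theorem symmetrizer_sq {e : A} {d : ℂ} (he : e * e = -d • e) :
    (e + d • 1) * (e + d • 1) = d • (e + d • 1) := by
  simp only [add_mul, mul_add, smul_mul_assoc, mul_smul_comm, mul_one, one_mul, smul_add,
    smul_smul, he]
  module

theorem symmetrizer_braid {e f : A} {d : ℂ} (he : e * e = -d • e) (hf : f * f = -d • f)
    (h1 : e * f * e = e) (h2 : f * e * f = f) :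
    (e + d • 1) * (f + d • 1) * (e + d • 1) - (e + d • 1) =
      (f + d • 1) * (e + d • 1) * (f + d • 1) - (f + d • 1) := by
  simp only [add_mul, mul_add, smul_mul_assoc, mul_smul_comm, mul_one, one_mul, smul_add,
    smul_smul, he, hf, h1, h2]
  module

theorem symmetrizer_braid₀ {e f : A} {d τ : ℂ} (he : e * e = -d • e) (hf : f * f = -τ • f)
    (h1 : e * f * e = e) :
    (e + d • 1) * (f + τ • 1) * (e + d • 1) * (f + τ • 1) -
      (f + τ • 1) * (e + d • 1) * (f + τ • 1) * (e + d • 1) =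
      (e + d • 1) * (f + τ • 1) - (f + τ • 1) * (e + d • 1) := by
  have h1' : e * (f * e) = e := by rw [← mul_assoc, h1]
  simp only [add_mul, mul_add, smul_mul_assoc, mul_smul_comm, mul_one, one_mul, smul_add,
    smul_smul, mul_assoc, he, hf, h1']
  module

end Ring

/-- The Ballot paths, as functions on `ℕ`. -/
abbrev Bal (N : ℕ) : Type := {a : ℕ → ℤ // IsBal N a}

theorem img_isBal {N : ℕ} {i : ℕ} (hi : i < N) (a : Bal N) : IsBal N (img i a.1) :=
  (valid_moveAt a.2 hi).isBal a.2 hi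

/-- The transposed action of the Temperley-Lieb generators, on the functions on Ballot paths. As
`e_i |a⟩` is a multiple of a single path, its transpose evaluates a function at that path. -/
noncomputable def eDual (P : Params) (N i : ℕ) : Module.End ℂ (Bal N → ℂ) :=
  if hi : i < N then
    LinearMap.mulLeft ℂ (fun a : Bal N => kap P i a.1) *
      LinearMap.funLeft ℂ ℂ (fun a => ⟨img i a.1, img_isBal hi a⟩)
  else 0

/-- The symmetrisers `s_i = e_i + [2]` and `s_0 = e_0 + [ω]/[ω+1]`, transposed. -/
noncomputable def sDual (P : Params) (N i : ℕ) : Module.End ℂ (Bal N → ℂ) :=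
  eDual P N i + loopWt P i • 1

section Dual

variable {P : Params} {N : ℕ}

theorem eDual_apply {i : ℕ} (hi : i < N) (f : Bal N → ℂ) {a : Bal N} {m : Move}
    (hm : m.Valid a.1 i) :
    eDual P N i f a = m.coeff P i * f ⟨a.1 + m.shift i, hm.isBal a.2 hi⟩ := by
  have h1 : (⟨img i a.1, img_isBal hi a⟩ : Bal N) = ⟨a.1 + m.shift i, hm.isBal a.2 hi⟩ :=
    Subtype.ext hm.img_eq
  rw [eDual, dif_pos hi]
  show kap P i a.1 * f ⟨img i a.1, img_isBal hi a⟩ = _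
  rw [h1, hm.kap_eq]

theorem eDual_sq {i : ℕ} (hi : i < N) :
    eDual P N i * eDual P N i = -loopWt P i • eDual P N i := by
  refine LinearMap.ext fun f => funext fun a => ?_
  have hm := valid_moveAt a.2 hi
  have hp : Move.peak.Valid (a.1 + (moveAt i a.1).shift i) i := hm.isPeak a.2.toIsPath
  rw [Module.End.mul_apply, eDual_apply hi _ hm, eDual_apply hi _ hp, LinearMap.smul_apply,
    Pi.smul_apply, eDual_apply hi _ hm]
  simp only [add_shift_peak, Move.coeff, smul_eq_mul]
  ring

/-- The relation `e_j e_i e_j = e_j` for neighbouring `i` and `j ≥ 1`. -/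
theorem eDual_return {i j : ℕ} (hi : i < N) (hj : j < N) (hj1 : 1 ≤ j)
    (hij : i = j + 1 ∨ i + 1 = j) :
    eDual P N j * eDual P N i * eDual P N j = eDual P N j := by
  refine LinearMap.ext fun f => funext fun a => ?_
  have hm := valid_moveAt a.2 hj
  have hb := hm.isBal a.2 hj
  have hm' := valid_moveAt hb hi
  obtain ⟨n, hn, h1, h2⟩ := valid_return (P := P) hb.toIsPath hj1 (hm.isPeak a.2.toIsPath) hij hm'
  rw [Module.End.mul_apply, Module.End.mul_apply, eDual_apply hj _ hm, eDual_apply hi _ hm',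
    eDual_apply hj _ hn, eDual_apply hj _ hm]
  simp only [add_assoc, h1, add_zero]
  rw [← mul_assoc (Move.coeff P i _), h2, one_mul]

theorem eDual_comm {i j : ℕ} (hij : i + 2 ≤ j) (hj : j < N) :
    eDual P N i * eDual P N j = eDual P N j * eDual P N i := by
  refine LinearMap.ext fun f => funext fun a => ?_
  have hi : i < N := by omega
  have hm := valid_moveAt a.2 hi
  have hm' := valid_moveAt a.2 hj
  obtain ⟨n, n', h1, h2, h3, h4⟩ := square_of_valid (P := P) a.2 hij hj hm hm'
  rw [Module.End.mul_apply, Module.End.mul_apply, eDual_apply hi _ hm, eDual_apply hj _ h1,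
    eDual_apply hj _ hm', eDual_apply hi _ h2]
  simp only [add_assoc, h3]
  rw [← mul_assoc, h4, mul_assoc]

theorem sDual_heckeRep : HeckeRep P N (sDual P N) where
  sq i hi := symmetrizer_sq (eDual_sq hi)
  comm i j hij hj := by
    have h : Commute (eDual P N i) (eDual P N j) := eDual_comm hij hj
    exact (h.add_right ((Commute.one_right _).smul_right _)).add_left
      (((Commute.one_left _).smul_left _))
  braid i hi hN := by
    have h1 := eDual_sq (P := P) (show i < N by omega)
    have h2 := eDual_sq (P := P) hN
    rw [loopWt_pos hi] at h1
    rw [loopWt_pos (show 1 ≤ i + 1 by omega)] at h2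
    have := symmetrizer_braid h1 h2
      (eDual_return (by omega) (by omega) hi (Or.inl rfl))
      (eDual_return (by omega) (by omega) (by omega) (Or.inr rfl))
    simpa only [sDual, loopWt_pos hi, loopWt_pos (show 1 ≤ i + 1 by omega)] using this
  braid₀ hN := symmetrizer_braid₀ (eDual_sq hN) (eDual_sq (by omega))
    (eDual_return (by omega) hN le_rfl (Or.inr rfl))

end Dual

/-! ### The highest valley of a path -/

/-- Between a down step and a later up step there is a valley. -/
theorem exists_valley_between {N : ℕ} {a : ℕ → ℤ} (ha : IsPath N a) {p r : ℕ} (hpr : p < r)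
    (hp : a (p + 1) < a p) (hr : a (r - 1) < a r) : ∃ v, p < v ∧ v < r ∧ IsValley a v := by
  classical
  have hex : ∃ v, p < v ∧ a v < a (v + 1) := by
    refine ⟨r - 1, ?_, by rwa [Nat.sub_add_cancel (by omega)]⟩
    by_contra! h
    obtain rfl : p + 1 = r := by omega
    rw [Nat.add_sub_cancel] at hr
    omega
  have h1 := Nat.find_spec hex
  have h2 : Nat.find hex ≤ r - 1 := Nat.find_le ⟨by
    by_contra! h
    obtain rfl : p + 1 = r := by omega
    rw [Nat.add_sub_cancel] at hr
    omega, by rwa [Nat.sub_add_cancel (by omega)]⟩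
  refine ⟨Nat.find hex, h1.1, by omega, Or.inr ?_, h1.2⟩
  have h3 := ha.step' (i := Nat.find hex) (by omega)
  by_cases h4 : Nat.find hex - 1 = p
  · have h5 : Nat.find hex = p + 1 := by omega
    rw [h4, h5]; exact hp
  · have h5 := Nat.find_min hex (m := Nat.find hex - 1) (by omega)
    rw [Nat.sub_add_cancel (by omega)] at h5
    have : ¬ a (Nat.find hex - 1) < a (Nat.find hex) := fun h => h5 ⟨by omega, h⟩
    omega

/-- `i` is a valley of maximal height; the path descends to `i` from the point `k` (a peak, or the
left boundary) and ascends from `i` to the peak `p`. The fields `low_right`, `low_left` and `low`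
express the maximality: beyond `k` and `p` the path cannot turn back at a height above `a i`. -/
structure HighValley (a : ℕ → ℤ) (k i p : ℕ) : Prop where
  valley : IsValley a i
  le : k ≤ i
  lt : i < p
  lt_of_pos : 0 < k → k < i
  left : ∀ x, k ≤ x → x ≤ i → a x = a i + (i - x)
  right : ∀ x, i ≤ x → x ≤ p → a x = a i + (x - i)
  low_right : ∀ r, p < r → a (r - 1) < a r → ∃ l, p ≤ l ∧ l < r ∧ a l ≤ a i
  low_left : ∀ x, x < k → a (x + 1) < a x → ∃ l, x < l ∧ l ≤ k ∧ a l ≤ a i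
  low : 0 < k → ∃ l ≤ k, a l ≤ a i

theorem exists_highValley {N : ℕ} {a : ℕ → ℤ} (ha : IsPath N a) (hne : a ≠ topPath N) :
    ∃ k i p, HighValley a k i p := by
  classical
  obtain ⟨e, heN, he, -⟩ := ha.exists_valley (topPath_isPath N) ha.le_top hne
  obtain ⟨i, hi, hmax⟩ := Finset.exists_max_image ((Finset.range N).filter (IsValley a)) a
    ⟨e, Finset.mem_filter.2 ⟨Finset.mem_range.2 heN, he⟩⟩
  have hv : IsValley a i := (Finset.mem_filter.1 hi).2
  have hiN := ha.valley_lt hv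
  have hmax' : ∀ v, IsValley a v → a v ≤ a i := fun v hv =>
    hmax v (Finset.mem_filter.2 ⟨Finset.mem_range.2 (ha.valley_lt hv), hv⟩)
  have hexp : ∃ p, i < p ∧ a (p + 1) < a p := ⟨N, hiN, by
    rw [ha.tail N le_rfl, ha.tail (N + 1) (by omega)]; push_cast; omega⟩
  obtain ⟨p, hp1, hp2, hpmin⟩ : ∃ p, i < p ∧ a (p + 1) < a p ∧
      ∀ x, i < x → x < p → a x < a (x + 1) := by
    refine ⟨Nat.find hexp, (Nat.find_spec hexp).1, (Nat.find_spec hexp).2, fun x h1 h2 => ?_⟩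
    have h3 := Nat.find_min hexp h2
    have h4 := ha.step x
    have : ¬ a (x + 1) < a x := fun h => h3 ⟨h1, h⟩
    omega
  have hexk : ∃ k, k ≤ i ∧ ∀ x, k ≤ x → x < i → a (x + 1) < a x :=
    ⟨i, le_rfl, fun x h1 h2 => by omega⟩
  obtain ⟨k, hk1, hk2, hk3⟩ : ∃ k, k ≤ i ∧ (∀ x, k ≤ x → x < i → a (x + 1) < a x) ∧
      (0 < k → a (k - 1) < a k) := by
    refine ⟨Nat.find hexk, (Nat.find_spec hexk).1, (Nat.find_spec hexk).2, fun h => ?_⟩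
    have h1 := Nat.find_spec hexk
    have h3 := Nat.find_min hexk (m := Nat.find hexk - 1) (by omega)
    have h4 := ha.step' h
    by_contra h5
    refine h3 ⟨by omega, fun x h6 h7 => ?_⟩
    by_cases h8 : x = Nat.find hexk - 1
    · rw [h8, Nat.sub_add_cancel h]; omega
    · exact h1.2 x (by omega) h7
  refine ⟨k, i, p, hv, hk1, hp1, fun h => ?_, fun x h1 h2 => ?_, fun x h1 h2 => ?_,
    fun r h1 h2 => ?_, fun x h1 h2 => ?_, fun h => ?_⟩
  · by_contra hki
    obtain rfl : k = i := by omega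
    have := hv.1
    have := hk3 h
    omega
  · induction h : i - x generalizing x with
    | zero =>
      obtain rfl : x = i := by omega
      omega
    | succ n ih =>
      have h3 := ih (x + 1) (by omega) (by omega) (by omega)
      have h4 := hk2 x h1 (by omega)
      have h5 := ha.step x
      push_cast at h3
      omega
  · induction x, h1 using Nat.le_induction with
    | base => omega
    | succ x hx ih =>
      have h3 := ih (by omega)
      have h4 := ha.step x
      have h5 : a x < a (x + 1) := by
        rcases hx.eq_or_lt with rfl | h
        · exact hv.2
        · exact hpmin x h (by omega)
      push_cast
      omega
  · obtain ⟨v, h3, h4, h5⟩ := exists_valley_between ha h1 hp2 h2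
    exact ⟨v, h3.le, h4, hmax' v h5⟩
  · obtain ⟨v, h3, h4, h5⟩ := exists_valley_between ha h1 h2 (hk3 (by omega))
    exact ⟨v, h3, h4.le, hmax' v h5⟩
  · by_cases h0 : a 0 < a (0 + 1)
    · exact ⟨0, by omega, hmax' 0 ⟨Or.inl rfl, h0⟩⟩
    · have := ha.step 0
      obtain ⟨v, h3, h4, h5⟩ := exists_valley_between ha h (by omega) (hk3 h)
      exact ⟨v, h4.le, hmax' v h5⟩

/-- The path obtained by filling the highest valley: the maximal path which agrees with `a` outside
of the valley. If the valley reaches the left boundary, so does the filling. -/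
def fill (a : ℕ → ℤ) (k p : ℕ) : ℕ → ℤ := fun x =>
  if p ≤ x then a x else if k = 0 then a p + (p - x) else if x ≤ k then a x
  else min (a k + (x - k)) (a p + (p - x))

namespace HighValley

variable {N : ℕ} {a : ℕ → ℤ} {k i p : ℕ}

theorem le_N (ha : IsPath N a) (h : HighValley a k i p) : p ≤ N := by
  have h1 := h.lt
  have h2 := h.right (p - 1) (by omega) (by omega)
  have h3 := h.right p (by omega) le_rfl
  by_contra! h4
  have h5 := ha.tail p (by omega)
  have h6 := ha.tail (p - 1) (by omega)
  omega

theorem le_fill (ha : IsPath N a) (h : HighValley a k i p) : a ≤ fill a k p := by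
  intro x
  have h1 := h.lt
  have h2 := h.le
  have h3 := h.lt_of_pos
  have l1 := fun (hx : k ≤ x) => (ha.lip k (x - k)).1
  have l2 := fun (hx : x ≤ p) => (ha.lip x (p - x)).2
  simp only [fill]
  split_ifs with q1 q2 q3
  · exact le_rfl
  · have := l2 (by omega)
    rw [Nat.add_sub_cancel' (by omega)] at this
    omega
  · exact le_rfl
  · have e1 := l2 (by omega)
    rw [Nat.add_sub_cancel' (by omega)] at e1
    have e2 := l1 (by omega)
    rw [Nat.add_sub_cancel' (by omega)] at e2
    omega

theorem fill_isPath (ha : IsPath N a) (h : HighValley a k i p) : IsPath N (fill a k p) := by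
  have h1 := h.lt
  have h2 := h.le
  have h3 := h.lt_of_pos
  have h4 := h.right p (by omega) le_rfl
  have h5 := h.left k le_rfl h2
  have h6 := h.le_N ha
  refine ⟨fun x => ?_, fun x hx => ?_, fun x hx => (ha.low x hx).trans (h.le_fill ha x)⟩
  · have s := ha.step x
    have e1 : x = k → a x = a k := by rintro rfl; rfl
    have e2 : x + 1 = p → a (x + 1) = a p := by rintro rfl; rfl
    simp only [fill]
    push_cast
    split_ifs <;> omega
  · simp only [fill]
    rw [if_pos (by omega)]; exact ha.tail x hx

theorem fill_ne (h : HighValley a k i p) : a ≠ fill a k p := by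
  intro e
  have h1 := h.lt
  have h2 := h.le
  have h3 := h.lt_of_pos
  have h4 := h.right p (by omega) le_rfl
  have h5 := h.left k le_rfl h2
  have := congrFun e i
  simp only [fill] at this
  split_ifs at this <;> omega

/-- To the right of the valley the path comes back to the height of the valley along a straight
line. -/
theorem exists_right (ha : IsPath N a) (h : HighValley a k i p) :
    ∃ r, p ≤ r ∧ a r = a i ∧ (r : ℤ) = p + (a p - a i) := by
  have h1 := h.lt
  have h4 := h.right p (by omega) le_rfl
  have key : ∀ n : ℕ, (n : ℤ) ≤ a p - a i → a (p + n) = a p - n := by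
    intro n
    induction n using Nat.strong_induction_on with
    | _ n ih =>
      intro hn
      rcases Nat.eq_zero_or_pos n with rfl | hn0
      · simp
      · have e1 := ih (n - 1) (by omega) (by omega)
        have e2 := ha.step (p + (n - 1))
        rw [show p + (n - 1) + 1 = p + n by omega] at e2
        by_contra hne
        obtain ⟨l, q1, q2, q3⟩ := h.low_right (p + n) (by omega)
          (by rw [show p + n - 1 = p + (n - 1) by omega]; omega)
        have e3 := ih (l - p) (by omega) (by omega)
        rw [Nat.add_sub_cancel' q1] at e3
        omega
  obtain ⟨n, hn⟩ : ∃ n : ℕ, (n : ℤ) = a p - a i := ⟨(a p - a i).toNat, by omega⟩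
  refine ⟨p + n, by omega, ?_, by push_cast; omega⟩
  rw [key n hn.le]; omega

/-- If the valley does not reach the left boundary, then to its left the path comes back to the
height of the valley along a straight line. -/
theorem exists_left (ha : IsPath N a) (h : HighValley a k i p) (hk : 0 < k) :
    ∃ r, r ≤ k ∧ a r = a i ∧ (r : ℤ) = k - (a k - a i) := by
  have h1 := h.le
  have h4 := h.left k le_rfl (by omega)
  have key : ∀ n : ℕ, (n : ℤ) ≤ a k - a i → n ≤ k ∧ a (k - n) = a k - n := by
    intro n
    induction n using Nat.strong_induction_on with
    | _ n ih =>
      intro hn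
      rcases Nat.eq_zero_or_pos n with rfl | hn0
      · simp
      · have e1 := ih (n - 1) (by omega) (by omega)
        have hnk : n ≤ k := by
          by_contra hnk
          obtain ⟨l, q1, q2⟩ := h.low hk
          have e3 := (ih (k - l) (by omega) (by omega)).2
          rw [Nat.sub_sub_self q1] at e3
          omega
        refine ⟨hnk, ?_⟩
        have e2 := ha.step (k - n)
        rw [show k - n + 1 = k - (n - 1) by omega] at e2
        by_contra hne
        obtain ⟨l, q1, q2, q3⟩ := h.low_left (k - n) (by omega)
          (by rw [show k - n + 1 = k - (n - 1) by omega]; omega)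
        have e3 := (ih (k - l) (by omega) (by omega)).2
        rw [Nat.sub_sub_self q2] at e3
        omega
  obtain ⟨n, hn⟩ : ∃ n : ℕ, (n : ℤ) = a k - a i := ⟨(a k - a i).toNat, by omega⟩
  have := key n hn.le
  refine ⟨k - n, by omega, ?_, by omega⟩
  rw [this.2]; omega

/-- Filling the highest valley does not change the integers of the tiles which remain. -/
theorem ct_fill (ha : IsPath N a) (h : HighValley a k i p) {t : ℕ × ℕ}
    (ht : HasTile N (fill a k p) t) : ct N a t.1 t.2 = ct N (fill a k p) t.1 t.2 := by
  have hf := h.fill_isPath ha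
  have hle := h.le_fill ha
  have ht' : HasTile N a t := ht.mono ha hf hle
  have h1 := h.lt
  have h2 := h.le
  have h3 := h.lt_of_pos
  have h4 := h.right p (by omega) le_rfl
  have h5 := h.left k le_rfl h2
  apply le_antisymm
  · obtain ⟨l, c1, c2, c3⟩ := exists_ct_eq ha (i := t.1) (j := t.2) ht'
    suffices ∃ r, a r ≤ a l ∧ fill a k p r = a r ∧ (t.1 : ℤ) - r < t.2 - a r ∧
        (r : ℤ) - t.1 < t.2 - a r by
      obtain ⟨r, r1, r2, r3, r4⟩ := this
      have := le_ct hf (i := t.1) (j := t.2) ht (l := r) (by rw [r2]; exact r3)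
        (by rw [r2]; exact r4)
      rw [r2] at this
      omega
    -- a point inside the valley is replaced by a point outside at the height of the valley
    by_cases hl : (0 < k ∧ l ≤ k) ∨ p ≤ l
    · refine ⟨l, le_rfl, ?_, c1, c2⟩
      simp only [fill]
      split_ifs <;> first | rfl | omega
    · have hli : a l = a i + |(l : ℤ) - i| := by
        rcases le_total l i with q | q
        · rw [h.left l (by omega) q, abs_of_nonpos (by omega)]; ring
        · rw [h.right l q (by omega), abs_of_nonneg (by omega)]
      have a1 := le_abs_self ((l : ℤ) - i)
      have a2 := neg_abs_le ((l : ℤ) - i)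
      have hT := ht.2.1
      obtain ⟨r, r1, r2, r3⟩ := h.exists_right ha
      have fr : fill a k p r = a r := by simp only [fill]; rw [if_pos r1]
      rcases Nat.eq_zero_or_pos k with hk | hk
      · refine ⟨r, by omega, fr, ?_, ?_⟩
        · simp only [fill] at hT
          split_ifs at hT <;> omega
        · simp only [fill] at hT
          split_ifs at hT <;> omega
      · obtain ⟨r', r1', r2', r3'⟩ := h.exists_left ha hk
        have fr' : fill a k p r' = a r' := by
          simp only [fill]
          rw [if_neg (by omega), if_neg (by omega), if_pos r1']
        by_cases hc : (t.1 : ℤ) + t.2 ≤ p + a p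
        · refine ⟨r', by omega, fr', ?_, ?_⟩
          · simp only [fill] at hT
            split_ifs at hT <;> omega
          · omega
        · refine ⟨r, by omega, fr, ?_, ?_⟩ <;> omega
  · obtain ⟨l, c1, c2, c3⟩ := exists_ct_eq hf (i := t.1) (j := t.2) ht
    have hl : a l ≤ fill a k p l := hle l
    have := le_ct ha (i := t.1) (j := t.2) ht' (l := l) (by omega) (by omega)
    omega

end HighValley

/-! ### The vectors of the paths in the dual representation -/

section Dual

variable {P : Params} {N : ℕ}

open Classical in
/-- The indicator function of the path `a`. -/
noncomputable def delta (N : ℕ) (a : ℕ → ℤ) : Bal N → ℂ := fun b => if b.1 = a then 1 else 0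

theorem sDual_apply {i : ℕ} (hi : i < N) (f : Bal N → ℂ) {a : Bal N} {m : Move}
    (hm : m.Valid a.1 i) :
    sDual P N i f a = m.coeff P i * f ⟨a.1 + m.shift i, hm.isBal a.2 hi⟩ + loopWt P i * f a := by
  rw [← eDual_apply hi f hm]
  simp [sDual]

/-- A function on Ballot paths which is symmetric under `s_j` vanishes on the paths with a peak at
`j`: there `e_j` acts as `-[2]`, so that `s_j` acts as zero. -/
theorem apply_eq_zero_of_isSym (G : Generic P N) {j : ℕ} (h1 : 1 ≤ j) (hj : j < N)
    {f : Bal N → ℂ} (hf : IsSym P (sDual P N) j f) {b : Bal N} (hb : IsPeak b.1 j) : f b = 0 := by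
  have h := congrFun hf b
  have hm : Move.peak.Valid b.1 j := hb
  rw [sDual_apply hj f hm] at h
  simp only [add_shift_peak, Move.coeff, Pi.smul_apply, smul_eq_mul, loopWt_pos h1] at h
  have h2 := G.hqn 2 (by norm_num) (by omega)
  push_cast at h2
  have h3 : qn P 2 * f b = 0 := by linear_combination -h
  exact (mul_eq_zero.1 h3).resolve_left h2

theorem isSym_delta_top {i : ℕ} (h1 : 1 ≤ i) (hi : i < N) :
    IsSym P (sDual P N) i (delta N (topPath N)) := by
  refine funext fun b => ?_
  have hm := valid_moveAt b.2 hi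
  rw [sDual_apply hi _ hm]
  have hp : IsPeak (b.1 + (moveAt i b.1).shift i) i := hm.isPeak b.2.toIsPath
  have hne : ¬ b.1 + (moveAt i b.1).shift i = topPath N := by
    intro e
    rw [e] at hp
    have := hp.1
    simp only [topPath] at this
    omega
  simp [delta, hne]

/-- A path without peaks between two points lies below all the paths with the same ends. -/
theorem le_of_no_peak {a b : ℕ → ℤ} (ha : IsPath N a) (hb : IsPath N b) {k p : ℕ}
    (hk : b k = a k) (hp : b p = a p) (hno : ∀ j, k < j → j < p → ¬ IsPeak b j) {x : ℕ}
    (h1 : k ≤ x) (h2 : x ≤ p) : b x ≤ a x := by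
  rcases h1.eq_or_lt with rfl | h1
  · omega
  by_cases hx : b (x - 1) < b x
  · have up : ∀ n, x + n ≤ p → b (x + n - 1) < b (x + n) ∧ b (x + n) = b x + n := by
      intro n
      induction n with
      | zero => intro _; exact ⟨hx, by simp⟩
      | succ n ih =>
        intro hn
        have e1 := ih (by omega)
        have e2 := hb.step (x + n)
        have e3 := hno (x + n) (by omega) (by omega)
        unfold IsPeak at e3
        rw [← add_assoc, Nat.add_sub_cancel]
        push_cast
        omega
    have e := (up (p - x) (by omega)).2
    have l := (ha.lip x (p - x)).1
    rw [Nat.add_sub_cancel' h2] at e l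
    omega
  · have down : ∀ n, k + n + 1 ≤ x →
        b (x - n) = b (x - n - 1) - 1 ∧ b (x - n - 1) = b x + n + 1 := by
      intro n
      induction n with
      | zero =>
        intro _
        have := hb.step' (i := x) (by omega)
        simp only [Nat.sub_zero]
        push_cast
        omega
      | succ n ih =>
        intro hn
        have e1 := ih (by omega)
        have e2 := hb.step' (i := x - n - 1) (by omega)
        have e3 := hno (x - n - 1) (by omega) (by omega)
        unfold IsPeak at e3
        rw [show x - n - 1 + 1 = x - n by omega] at e3
        rw [show x - (n + 1) - 1 = x - n - 1 - 1 by omega, show x - (n + 1) = x - n - 1 by omega]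
        push_cast
        omega
    have e := (down (x - k - 1) (by omega)).2
    rw [show x - (x - k - 1) - 1 = k by omega] at e
    have l := (ha.lip k (x - k)).2
    rw [Nat.add_sub_cancel' h1.le] at l
    omega

end Dual

/-! ### Filling the highest valley -/

section Support

variable {P : Params} {N : ℕ} {a : ℕ → ℤ} {k i p : ℕ}

/-- A generator at a point of the highest valley does not change the heights outside of the valley:
an arc which starts inside the valley above its bottom cannot pass the low points on both sides. -/
theorem HighValley.shift_eq_zero (h : HighValley a k i p) {e : ℕ}
    (hek : 0 < k → k < e) (hep : e < p) {β : ℕ → ℤ} (hβ : IsPath N β) {m : Move}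
    (hm : m.Valid β e) (he : a i + 2 ≤ β e + m.shift e e)
    (hout : ∀ x, (0 < k ∧ x ≤ k ∨ p ≤ x) → β x + m.shift e x = a x)
    {x : ℕ} (hx : 0 < k ∧ x ≤ k ∨ p ≤ x) : m.shift e x = 0 := by
  cases m with
  | valley => simp only [Move.shift]; rw [if_neg (by omega)]
  | peak => rfl
  | up R =>
    have q1 := UpArc.lt hm
    have q2 := UpArc.gt hm
    have q3 := UpArc.eq hm
    suffices R ≤ p by
      simp only [Move.shift]; rw [if_neg (by omega)]
    by_contra! hR
    have q4 := hβ.step' (i := R) (by omega)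
    have q5 := q2 (R - 1) (by omega) (by omega)
    have o1 := hout R (by omega)
    have o2 := hout (R - 1) (by omega)
    simp only [Move.shift] at o1 o2 he
    rw [if_neg (by omega)] at o1 he
    rw [if_pos (by omega)] at o2
    obtain ⟨l, l1, l2, l3⟩ := h.low_right R hR (by omega)
    have o3 := hout l (by omega)
    have q6 := q2 l (by omega) l2
    simp only [Move.shift] at o3
    rw [if_pos (by omega)] at o3
    omega
  | down K =>
    have q1 := DownArc.lt hm
    have q2 := DownArc.gt hm
    have q3 := DownArc.eq hm
    simp only [Move.shift] at hout he ⊢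
    rw [if_neg (by omega)] at he
    rcases Nat.eq_zero_or_pos k with hk | hk
    · rw [if_neg (by omega)]
    suffices k < K by rw [if_neg (by omega)]
    by_contra! hK
    rcases Nat.eq_zero_or_pos K with hK0 | hK0
    · obtain ⟨l, l1, l2⟩ := h.low hk
      have o := hout l (by omega)
      have q := q2 l (by omega) (by omega)
      rw [if_pos (by omega)] at o
      omega
    · have o1 := hout K (by omega)
      have o2 := hout (K - 1) (by omega)
      rw [if_pos (by omega)] at o1
      rw [if_neg (by omega)] at o2
      have q4 := hβ.step' (i := K) hK0
      have q5 := q2 K le_rfl q1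
      obtain ⟨l, l1, l2, l3⟩ := h.low_left (K - 1) (by omega)
        (by rw [Nat.sub_add_cancel hK0]; omega)
      have o := hout l (by omega)
      have q := q2 l (by omega) (by omega)
      rw [if_pos (by omega)] at o
      omega

/-- Triangularity inside the highest valley: for a path `b` between `a` and the filled path, the
tiles above `b` produce the path `b` with the coefficient `1`, and otherwise only paths above `b`
which agree with `a` outside of the valley. -/
theorem HighValley.support (ha : IsPath N a) (h : HighValley a k i p)
    (hF : tileVec P N (sDual P N) (ct N a) (fill a k p) (delta N (topPath N)) =
      delta N (fill a k p)) {b : ℕ → ℤ} (hb : IsPath N b) (hab : a ≤ b) (hbf : b ≤ fill a k p)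
    (β : Bal N) :
    (tileVec P N (sDual P N) (ct N a) b (delta N (topPath N)) β ≠ 0 →
      b ≤ β.1 ∧ ∀ x, (0 < k ∧ x ≤ k ∨ p ≤ x) → β.1 x = a x) ∧
    (β.1 = b → tileVec P N (sDual P N) (ct N a) b (delta N (topPath N)) β = 1) := by
  have hf := h.fill_isPath ha
  have hfout : ∀ x, (0 < k ∧ x ≤ k ∨ p ≤ x) → fill a k p x = a x := by
    intro x hx
    have := h.lt
    have := h.lt_of_pos
    simp only [fill]
    split_ifs <;> first | rfl | omega
  induction hd : defect N b using Nat.strong_induction_on generalizing b β with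
  | _ n ih =>
    by_cases hne : b = fill a k p
    · rw [hne, hF]
      refine ⟨fun hβ => ?_, fun hβ => if_pos hβ⟩
      have e : β.1 = fill a k p := by
        by_contra h
        exact hβ (if_neg h)
      rw [e]
      exact ⟨le_rfl, hfout⟩
    obtain ⟨e, heN, hve, he⟩ := hb.exists_valley hf hbf hne
    have hb' := hb.raise hve
    have hab' : a ≤ raiseAt b e := hab.trans (le_raiseAt b e)
    have hbf' := raiseAt_le hbf he
    have hdef : defect N (raiseAt b e) < n := hd ▸ defect_raise_lt hb hve
    have hae : a e ≤ b e := hab e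
    have hin : ¬ (0 < k ∧ e ≤ k ∨ p ≤ e) := fun hc => by
      have := hfout e hc
      omega
    have haie : a i ≤ a e := by
      rcases le_total e i with q | q
      · rw [h.left e (by omega) q]; omega
      · rw [h.right e q (by omega)]; omega
    have hm := valid_moveAt β.2 heN
    rw [tileVec_step sDual_heckeRep _ hb hve, baxtOp_apply, Pi.sub_apply,
      sDual_apply heN _ hm, Pi.smul_apply, smul_eq_mul]
    set y := tileVec P N (sDual P N) (ct N a) (raiseAt b e) (delta N (topPath N)) with hy
    constructor
    · intro hβ
      by_cases hz : y β = 0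
      · rw [hz, mul_zero, mul_zero, add_zero, sub_zero] at hβ
        obtain ⟨i1, i2⟩ := (ih _ hdef hb' hab' hbf'
          ⟨β.1 + (moveAt e β.1).shift e, hm.isBal β.2 heN⟩ rfl).1 (right_ne_zero_of_mul hβ)
        simp only at i1 i2
        have i3 : raiseAt b e e ≤ β.1 e + (moveAt e β.1).shift e e := i1 e
        rw [raiseAt_self] at i3
        have hs : ∀ x, (0 < k ∧ x ≤ k ∨ p ≤ x) → (moveAt e β.1).shift e x = 0 := fun x hx =>
          h.shift_eq_zero (by omega) (by omega) β.2.toIsPath hm (by omega) i2 hx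
        refine ⟨fun x => ?_, fun x hx => ?_⟩
        · show b x ≤ β.1 x
          have i4 : raiseAt b e x ≤ β.1 x + (moveAt e β.1).shift e x := i1 x
          have i5 : (moveAt e β.1).shift e x ≤ if x = e then 2 else 0 := by
            generalize moveAt e β.1 = m
            cases m <;> simp only [Move.shift] <;> split_ifs <;> omega
          by_cases hxe : x = e
          · subst hxe
            rw [raiseAt_self] at i4
            rw [if_pos rfl] at i5
            omega
          · rw [raiseAt_of_ne b hxe] at i4
            rw [if_neg hxe] at i5
            omega
        · have := i2 x hx
          rw [Pi.add_apply, hs x hx] at this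
          omega
      · obtain ⟨i1, i2⟩ := (ih _ hdef hb' hab' hbf' β rfl).1 hz
        exact ⟨(le_raiseAt b e).trans i1, i2⟩
    · intro hβ
      have hv : Move.valley.Valid β.1 e := by rw [hβ]; exact hve
      have h1 := (ih _ hdef hb' hab' hbf' ⟨β.1 + (moveAt e β.1).shift e, hm.isBal β.2 heN⟩
        rfl).2 (by simp only; rw [hv.moveAt_eq, add_shift_valley, hβ])
      have h2 : y β = 0 := by
        by_contra hz
        have : raiseAt b e e ≤ β.1 e := ((ih _ hdef hb' hab' hbf' β rfl).1 hz).1 e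
        rw [hβ, raiseAt_self] at this
        omega
      rw [← hy] at h1
      rw [h1, h2, hv.moveAt_eq]
      simp [Move.coeff]

end Support

/-! ### A row of tiles along the left boundary -/

/-- The sum which determines the constant of `h_0(n)`: it collects the contributions of a row of
tiles which ends at the left boundary. The alternating weights are those of the generators which
lower the heights up to the left boundary. -/
theorem sum_row {P : Params} (hq : Complex.exp P.η ≠ Complex.exp (-P.η))
    (hω : qn P (P.ω + 1) ≠ 0) (n : ℕ) (hn : 1 ≤ n) :
    ∑ t ∈ Finset.range (n - 1), (if Even (t + 1) then -loopWt P 0 else 1) * qn P (n - (t + 1 : ℕ))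
      = qn P ((n / 2 : ℕ) : ℂ) * qn P (P.ω + (((n + 1) / 2 : ℕ) : ℂ)) / qn P (P.ω + 1) := by
  induction n using Nat.strong_induction_on with
  | _ n ih =>
    rcases n with _ | _ | _ | n
    · omega
    · simp [qn_zero]
    · simp [qn_one hq, show (2 : ℂ) - 1 = 1 by norm_num]
      field_simp
    · have h := ih (n + 1) (by omega) (by omega)
      rw [show n + 1 + 1 + 1 - 1 = n + 1 - 1 + 1 + 1 by omega, Finset.sum_range_succ',
        Finset.sum_range_succ']
      have e : ∀ t : ℕ, (if Even (t + 1 + 1 + 1) then -loopWt P 0 else 1) *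
          qn P (((n + 1 + 1 + 1 : ℕ) : ℂ) - (t + 1 + 1 + 1 : ℕ)) =
          (if Even (t + 1) then -loopWt P 0 else 1) * qn P (((n + 1 : ℕ) : ℂ) - (t + 1 : ℕ)) := by
        intro t
        congr 1
        · simp [Nat.even_add_one]
        · congr 1; push_cast; ring
      simp only [e]
      rw [h]
      have d1 : (n + 1 + 1 + 1) / 2 = (n + 1) / 2 + 1 := by omega
      have d2 : (n + 1 + 1 + 1 + 1) / 2 = (n + 1 + 1) / 2 + 1 := by omega
      obtain ⟨x, hx⟩ : ∃ x, (n + 1) / 2 = x := ⟨_, rfl⟩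
      obtain ⟨y, hy⟩ : ∃ y, (n + 1 + 1) / 2 = y := ⟨_, rfl⟩
      have hnxy : (n : ℂ) = x + y - 1 := by
        have : n + 1 = x + y := by omega
        have := congrArg (Nat.cast : ℕ → ℂ) this
        push_cast at this
        linear_combination this
      rw [d1, d2, hx, hy, loopWt_zero]
      push_cast
      rw [hnxy]
      simp only [Nat.not_even_one, if_false, even_two, if_true]
      rw [show (x : ℂ) + y - 1 + 1 + 1 + 1 - 2 = x + y by ring,
        show (x : ℂ) + y - 1 + 1 + 1 + 1 - 1 = x + y + 1 by ring]
      have key : qn P x * qn P (P.ω + y) - qn P P.ω * qn P (x + y) + qn P (x + y + 1) *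
          qn P (P.ω + 1) = qn P (x + 1) * qn P (P.ω + (y + 1)) := by
        have h0 := qexp_ne P 1
        have h1 := qexp_ne P x
        have h2 := qexp_ne P y
        have h3 := qexp_ne P P.ω
        have h4 := qden_ne hq
        simp only [qn_eq, qexp_add]
        field_simp
        ring
      rw [← key]
      field_simp
      ring

/-- The path obtained by raising the heights at `m, …, i`. -/
def rowPath (a : ℕ → ℤ) (i m : ℕ) : ℕ → ℤ := fun x => if m ≤ x ∧ x ≤ i then a x + 2 else a x

section Row

variable {P : Params} {N : ℕ} {a : ℕ → ℤ} {i p m j : ℕ}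

theorem rowPath_last (a : ℕ → ℤ) (i : ℕ) : rowPath a i (i + 1) = a := by
  funext x; simp only [rowPath]; rw [if_neg (by omega)]

theorem raiseAt_rowPath (a : ℕ → ℤ) (hm : m ≤ i) :
    raiseAt (rowPath a i (m + 1)) m = rowPath a i m := by
  funext x
  by_cases hx : x = m
  · subst hx
    rw [raiseAt_self]
    simp only [rowPath]
    rw [if_neg (by omega), if_pos (by omega)]
  · rw [raiseAt_of_ne _ hx]
    simp only [rowPath]
    split_ifs <;> omega

theorem le_rowPath (a : ℕ → ℤ) (i m : ℕ) : a ≤ rowPath a i m := by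
  intro x
  simp only [rowPath]
  split_ifs <;> omega

namespace HighValley

theorem isValley_rowPath (h : HighValley a 0 i p) (hm : m ≤ i) :
    IsValley (rowPath a i (m + 1)) m := by
  have h1 := h.left m (by omega) hm
  have h2 := h.left (m - 1) (by omega) (by omega)
  have h3 := fun hx => h.left (m + 1) (by omega) hx
  have h4 := h.right (i + 1) (by omega) h.lt
  have h5 : m = i → a (m + 1) = a (i + 1) := by rintro rfl; rfl
  simp only [IsValley, rowPath]
  split_ifs <;> omega

theorem rowPath_isPath (ha : IsPath N a) (h : HighValley a 0 i p) (hm : m ≤ i + 1) :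
    IsPath N (rowPath a i m) := by
  induction hd : i + 1 - m generalizing m with
  | zero =>
    obtain rfl : m = i + 1 := by omega
    rwa [rowPath_last]
  | succ n ih =>
    rw [← raiseAt_rowPath a (by omega)]
    exact (ih (m := m + 1) (by omega) (by omega)).raise (h.isValley_rowPath (by omega))

theorem hasTile_row (ha : IsPath N a) (h : HighValley a 0 i p) (hm : m ≤ i) :
    HasTile N a (m, (a m + 1).toNat) := by
  have h1 := h.left m (by omega) hm
  have h2 := h.right (i + 1) (by omega) h.lt
  have h3 : a (i + 1) ≤ topPath N (i + 1) := ha.le_top (i + 1)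
  have h4 := ha.valley_lt h.valley
  have h5 := ha.low i h4.le
  have h6 := ha.parity m
  simp only [topPath] at h3
  rw [hasTile_iff ha]
  push_cast at *
  omega

/-- The integers of the tiles along the downhill slope which ends at the highest valley. -/
theorem ct_row (ha : IsPath N a) (h : HighValley a 0 i p) (hm : m ≤ i) :
    ct N a m (a m + 1).toNat = i - m + 1 := by
  have ht := h.hasTile_row ha hm
  have h1 := h.left m (by omega) hm
  have h4 := ha.valley_lt h.valley
  have h5 := ha.low i h4.le
  apply le_antisymm
  · obtain ⟨l, c1, c2, c3⟩ := exists_ct_eq ha ht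
    rcases le_or_gt l i with hl | hl
    · have := h.left l (by omega) hl
      omega
    · have := (ha.lip i (l - i)).2
      rw [Nat.add_sub_cancel' hl.le] at this
      by_contra hc
      have h6 := h.right (i + 1) (by omega) h.lt
      have := (ha.lip (i + 1) (l - (i + 1))).2
      rw [Nat.add_sub_cancel' hl] at this
      omega
  · have := le_ct ha ht (l := i) (by omega) (by omega)
    omega

/-- The raised part of the row is a downhill slope to which `isSym_of_slope` applies. -/
theorem downSlope_rowPath (ha : IsPath N a) (h : HighValley a 0 i p) (hmj : m < j) (hj : j ≤ i) :
    DownSlope N (ct N a) (rowPath a i m) j := by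
  have hr := h.rowPath_isPath ha (m := m) (by omega)
  have h1 := h.left j (by omega) hj
  have h2 := h.left (j - 1) (by omega) (by omega)
  have h3 := fun hx => h.left (j + 1) (by omega) hx
  have h4 := h.right (i + 1) (by omega) h.lt
  have h5 : j = i → a (j + 1) = a (i + 1) := by rintro rfl; rfl
  have h6 := ha.valley_lt h.valley
  have h7 := ha.low i h6.le
  refine ⟨by omega, by omega, ?_, ?_, fun ht => ?_⟩
  · simp only [rowPath]; split_ifs <;> omega
  · simp only [rowPath]; split_ifs <;> omega
  · have e : rowPath a i m j = a j + 2 := by simp only [rowPath]; rw [if_pos (by omega)]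
    rw [e] at ht ⊢
    have ht0 := (hasTile_iff hr _).1 ht
    have ht1 := ht.mono ha hr (le_rowPath a i m)
    have ht2 : HasTile N a (j + 1, (a j + 2).toNat) := by
      have hp := ha.parity j
      have hs := ha.step j
      rw [hasTile_iff ha]
      simp only at ht0 ⊢
      push_cast at *
      omega
    have l1 := ct_lower (a := a) (i := j) ht.1 (Or.inr rfl) ht2
    rw [show (a j + 2 + 1).toNat = (a j + 2).toNat + 1 by omega] at ht1 ⊢
    obtain ⟨l, c1, c2, c3⟩ := exists_ct_eq ha ht1
    have l2 := le_ct ha ht2 (l := i) (by push_cast; omega) (by push_cast; omega)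
    push_cast at c1 c2 c3
    rcases le_or_gt l j with hl | hl
    · have hl1 := h.left l (by omega) (by omega)
      omega
    · have := le_ct ha ht2 (l := l) (by push_cast; omega) (by push_cast; omega)
      omega

end HighValley

/-- The tiles above `rowPath a i m` do not produce paths with a peak on the raised part of the
slope. -/
theorem rowVec_zero_of_isPeak (G : Generic P N) (ha : IsPath N a) (h : HighValley a 0 i p)
    (hmj : m < j) (hj : j ≤ i) {b : Bal N} (hb : IsPeak b.1 j) :
    tileVec P N (sDual P N) (ct N a) (rowPath a i m) (delta N (topPath N)) b = 0 := by
  have hiN := ha.valley_lt h.valley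
  exact apply_eq_zero_of_isSym G (by omega) (by omega)
    (isSym_of_slope G sDual_heckeRep (fun l h1 h2 => isSym_delta_top h1 h2) ha
      (h.rowPath_isPath ha (by omega)) (le_rowPath a i m)
      (Or.inl (h.downSlope_rowPath ha hmj hj))) hb

/-- The effect of the tile in the column `m` of the row. -/
theorem rowVec_succ (ha : IsPath N a) (h : HighValley a 0 i p) (hm : m ≤ i) (b : Bal N)
    {n : Move} (hn : n.Valid b.1 m) (hmN : m < N) :
    tileVec P N (sDual P N) (ct N a) (rowPath a i (m + 1)) (delta N (topPath N)) b =
      n.coeff P m * tileVec P N (sDual P N) (ct N a) (rowPath a i m) (delta N (topPath N))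
        ⟨b.1 + n.shift m, hn.isBal b.2 hmN⟩ +
      (loopWt P m - baxt P m (i - m + 1)) *
        tileVec P N (sDual P N) (ct N a) (rowPath a i m) (delta N (topPath N)) b := by
  have e : rowPath a i (m + 1) m = a m := by simp only [rowPath]; rw [if_neg (by omega)]
  rw [tileVec_step sDual_heckeRep _ (h.rowPath_isPath ha (by omega)) (h.isValley_rowPath hm),
    raiseAt_rowPath a hm, e, h.ct_row ha hm, baxtOp_apply, Pi.sub_apply, sDual_apply hmN _ hn,
    Pi.smul_apply, smul_eq_mul]
  ring

/-- The coefficient of the path `β`, which goes down from the left boundary beyond the valley, with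
the heights to the left of `l` lowered. -/
theorem rowVec_lowered (G : Generic P N) (ha : IsPath N a) (h : HighValley a 0 i p) {β : Bal N}
    (hβ : ∀ x, x ≤ i + 1 → β.1 x = β.1 0 - x) (l : ℕ) (hl : l ≤ i) (d : Bal N)
    (hd : d.1 = β.1 + (Move.down 0).shift l) :
    tileVec P N (sDual P N) (ct N a) (rowPath a i l) (delta N (topPath N)) d =
      tileVec P N (sDual P N) (ct N a) (rowPath a i 0) (delta N (topPath N)) β := by
  have hiN := ha.valley_lt h.valley
  induction l generalizing d with
  | zero =>
    have : d = β := by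
      refine Subtype.ext (hd.trans (funext fun x => ?_))
      simp [Move.shift]
    rw [this]
  | succ l ih =>
    have e0 := hβ l (by omega)
    have e1 := hβ (l + 1) (by omega)
    have e2 := hβ (l + 2) (by omega)
    have e3 := hβ (l - 1) (by omega)
    have hv : Move.valley.Valid d.1 l := by
      rw [hd]
      simp only [Move.Valid, IsValley, Pi.add_apply, Move.shift]
      push_cast at e1
      split_ifs <;> omega
    have hp : IsPeak d.1 (l + 1) := by
      rw [hd]
      simp only [IsPeak, Pi.add_apply, Move.shift]
      rw [Nat.add_sub_cancel, show l + 1 + 1 = l + 2 by ring]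
      push_cast at e1 e2
      split_ifs <;> omega
    rw [rowVec_succ ha h (by omega) d hv (by omega),
      rowVec_zero_of_isPeak G ha h (j := l + 1) (by omega) hl hp, ih (by omega)]
    · simp [Move.coeff]
    · show d.1 + Move.valley.shift l = _
      rw [hd]
      funext x
      simp only [Pi.add_apply, Move.shift]
      split_ifs <;> omega

/-- The coefficient of the path `β`, which goes down from the left boundary beyond the valley,
vanishes. The tiles of the row are added from the left to the right; each contributes a term of
`sum_row`, and the constant of the half-tile cancels the sum. -/
theorem rowVec_eq_zero (G : Generic P N) (ha : IsPath N a) (h : HighValley a 0 i p) {β : Bal N}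
    (hβ : ∀ x, x ≤ i + 1 → β.1 x = β.1 0 - x) :
    tileVec P N (sDual P N) (ct N a) a (delta N (topPath N)) β = 0 := by
  have hiN := ha.valley_lt h.valley
  have hq := G.hq
  have hω := G.hω
  set Z := fun m => tileVec P N (sDual P N) (ct N a) (rowPath a i m) (delta N (topPath N))
    with hZ
  have hni : qn P ((i + 1 : ℕ) : ℂ) ≠ 0 := G.hqn (i + 1) (by omega) hiN
  have key : ∀ l, l ≤ i → qn P ((i : ℂ) + 1 - l) * Z (l + 1) β = Z 0 β *
      (∑ t ∈ Finset.range l, (if Even (t + 1) then -loopWt P 0 else 1) *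
        qn P ((i + 1 : ℕ) - (t + 1 : ℕ)) - qn P ((i + 1 : ℕ) : ℂ) * baxt P 0 (i + 1)) := by
    intro l
    induction l with
    | zero =>
      intro _
      have hp : Move.peak.Valid β.1 0 := by
        have := hβ (0 + 1) (by omega)
        exact ⟨Or.inl rfl, by omega⟩
      have e := rowVec_succ (P := P) ha h (Nat.zero_le i) β hp (by omega)
      simp only [add_shift_peak, Move.coeff] at e
      simp only [hZ]
      rw [e]
      simp only [Nat.sub_zero, Finset.range_zero, Finset.sum_empty]
      push_cast
      rw [sub_zero]
      ring
    | succ l ih =>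
      intro hl
      have e0 := hβ l (by omega)
      have e1 := hβ (l + 1) (by omega)
      have e2 := hβ (l + 2) (by omega)
      have hd : (Move.down 0).Valid β.1 (l + 1) := by
        refine ⟨by omega, ?_, ?_, by omega, fun x h1 h2 => ?_, Or.inl rfl⟩
        · rw [Nat.add_sub_cancel]; push_cast at e1; omega
        · rw [show l + 1 + 1 = l + 2 by ring]; push_cast at e1 e2; omega
        · have := hβ x (by omega)
          push_cast at e1
          omega
      have e := rowVec_succ (P := P) ha h hl β hd (by omega)
      rw [rowVec_lowered G ha h hβ (l + 1) hl _ rfl] at e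
      have hu : qn P ((i - (l + 1) + 1 : ℕ) : ℂ) ≠ 0 := G.hqn _ (by omega) (by omega)
      rw [loopWt_sub_baxt hq (by omega) _ hu] at e
      have ihl := ih (by omega)
      rw [Finset.sum_range_succ]
      have c1 : ((i - (l + 1) + 1 : ℕ) : ℂ) = (i : ℂ) + 1 - (l + 1 : ℕ) := by
        rw [Nat.cast_add, Nat.cast_sub hl]; push_cast; ring
      have c2 : ((i - (l + 1) + 1 + 1 : ℕ) : ℂ) = (i : ℂ) + 1 - l := by
        rw [Nat.cast_add, Nat.cast_add, Nat.cast_sub hl]; push_cast; ring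
      simp only [c1, c2, Move.coeff, true_and] at e hu
      simp only [hZ] at ihl ⊢
      rw [e]
      push_cast at ihl hu ⊢
      rw [mul_add, ← mul_assoc _ (_ / _), mul_div_cancel₀ _ hu]
      linear_combination ihl
  have h1 := key i le_rfl
  have h2 := sum_row hq hω (i + 1) (by omega)
  rw [Nat.add_sub_cancel] at h2
  rw [h2, baxt_zero] at h1
  simp only [hZ, rowPath_last] at h1
  rw [show (i : ℂ) + 1 - i = 1 by ring, qn_one hq, one_mul] at h1
  rw [h1]
  field_simp
  ring

/-- In the dual representation, `H_a δ_Ω` is the indicator function of the path `a`; it vanishes if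
`a` is not a Ballot path. -/
theorem hVec_delta (G : Generic P N) (ha : IsPath N a) :
    hVec P N (sDual P N) a (delta N (topPath N)) = delta N a := by
  induction hd : defect N a using Nat.strong_induction_on generalizing a with
  | _ n ih =>
    by_cases hne : a = topPath N
    · rw [hne, hVec_top sDual_heckeRep]
    obtain ⟨k, i, p, h⟩ := exists_highValley ha hne
    have hf := h.fill_isPath ha
    have hle := h.le_fill ha
    have hF : tileVec P N (sDual P N) (ct N a) (fill a k p) (delta N (topPath N)) =
        delta N (fill a k p) := by
      rw [← ih _ (hd ▸ defect_lt ha hf hle h.fill_ne) hf rfl, hVec, tileVec, tileVec,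
        tileProd_congr hf fun t ht => h.ct_fill ha ht]
    funext β
    obtain ⟨h1, h2⟩ := h.support ha hF ha le_rfl hle β
    by_cases hβ : β.1 = a
    · rw [hVec, h2 hβ, delta, if_pos hβ]
    rw [delta, if_neg hβ]
    by_contra hz
    obtain ⟨h3, h4⟩ := h1 hz
    apply hβ
    have hpN := h.le_N ha
    have hno : ∀ j, 1 ≤ j → k < j → j < p → ¬ IsPeak β.1 j := by
      intro j h5 h6 h7 hp
      refine hz (apply_eq_zero_of_isSym G h5 (by omega) (isSym_hVec G sDual_heckeRep
        (fun l h1 h2 => isSym_delta_top h1 h2) ha (by omega) ?_) hp)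
      rintro ⟨hpl, hpk⟩
      rcases Nat.lt_or_ge j i with hj | hj
      · have := h.left (j - 1) (by omega) (by omega)
        have := h.left j (by omega) (by omega)
        omega
      · have := h.right j hj h7.le
        have := h.right (j + 1) (by omega) h7
        push_cast at this
        omega
    funext x
    refine le_antisymm ?_ (h3 x)
    rcases Nat.lt_or_ge x p with hxp | hxp
    swap
    · exact (h4 x (Or.inr hxp)).le
    rcases Nat.eq_zero_or_pos k with rfl | hk
    · have up : ∀ y, y < p → β.1 y < β.1 (y + 1) → ∀ n, y + n + 1 ≤ p →
          β.1 (y + n) < β.1 (y + n + 1) ∧ β.1 (y + n + 1) = β.1 y + n + 1 := by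
        intro y hy hy' n
        have s := β.2.step y
        induction n with
        | zero => intro _; exact ⟨hy', by rw [add_zero]; push_cast; omega⟩
        | succ n ih =>
          intro hn
          have e1 := ih (by omega)
          have e2 := β.2.step (y + n + 1)
          have e3 := hno (y + n + 1) (by omega) (by omega) (by omega)
          unfold IsPeak at e3
          rw [Nat.add_sub_cancel] at e3
          rw [show y + (n + 1) = y + n + 1 by ring]
          push_cast
          omega
      have hp := h4 p (Or.inr le_rfl)
      have hip := h.lt
      -- an up step of `β` before the valley of `a` would take `β` below `a`
      have first : ∀ y, y ≤ i → β.1 y < β.1 (y + 1) → y = i ∧ β.1 i = a i := by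
        intro y hy hy'
        have e1 := (up y (by omega) hy' (p - y - 1) (by omega)).2
        rw [show y + (p - y - 1) + 1 = p by omega] at e1
        have e2 := h.left y (Nat.zero_le _) hy
        have e3 : a y ≤ β.1 y := h3 y
        have e4 := h.right p hip.le le_rfl
        obtain rfl : y = i := by omega
        exact ⟨rfl, by omega⟩
      have down : ∀ y, y < i → β.1 (y + 1) = β.1 y - 1 := by
        intro y hy
        rcases β.2.step y with e | e
        · have := (first y hy.le (by omega)).1
          omega
        · exact e
      have hdown : ∀ y, y ≤ i → β.1 y = β.1 0 - y := by
        intro y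
        induction y with
        | zero => intro _; simp
        | succ y ih =>
          intro hy
          rw [down y (by omega), ih (by omega)]
          push_cast
          ring
      rcases β.2.step i with e | e
      · have hi := (first i le_rfl (by omega)).2
        rcases le_total x i with hxi | hxi
        · rw [hdown x hxi, h.left x (Nat.zero_le _) hxi, ← hi, hdown i le_rfl]
          omega
        · rw [h.right x hxi hxp.le]
          rcases hxi.eq_or_lt with rfl | hxi
          · omega
          · have e1 := (up i hip (by omega) (x - i - 1) (by omega)).2
            rw [show i + (x - i - 1) + 1 = x by omega] at e1
            omega
      · refine absurd (rowVec_eq_zero G ha h (β := β) fun y hy => ?_) hz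
        rcases hy.eq_or_lt with rfl | hy
        · rw [e, hdown i le_rfl]
          push_cast
          ring
        · exact hdown y (by omega)
    · rcases Nat.lt_or_ge k x with hkx | hkx
      · exact le_of_no_peak ha β.2.toIsPath (h4 k (Or.inl ⟨hk, le_rfl⟩)) (h4 p (Or.inr le_rfl))
          (fun j h6 h7 => hno j (by omega) h6 h7) hkx.le hxp.le
      · exact (h4 x (Or.inl ⟨hk, hkx⟩)).le

end Row

/-! ### The functional representation -/

/-- The scalar identity behind the braid relation of `s_i` and `s_{i+1}`, with `x = x_i - x_{i+1}`
and `y = x_{i+1} - x_{i+2}`. -/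
theorem qn_braid_key {P : Params} (hq : Complex.exp P.η ≠ Complex.exp (-P.η)) {x y : ℂ}
    (hx : qn P x ≠ 0) (hy : qn P y ≠ 0) (hxy : qn P (x + y) ≠ 0) :
    qn P (x + 1) / qn P x * (qn P (y + 1) / qn P y) +
      qn P (x + y + 1) / qn P (x + y) * (qn P 2 - qn P (x + 1) / qn P x) =
      1 + qn P (y + 1) / qn P y * (qn P (x + y + 1) / qn P (x + y)) := by
  have h0 := qexp_ne P 1
  have h1 := qexp_ne P x
  have h2 := qexp_ne P y
  have h4 := qden_ne' hq
  field_simp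
  simp only [qn_eq, qexp_add, qexp_two]
  field_simp
  ring

/-- The scalar identity behind the braid relation of `s_0` and `s_1`, with `x = x_1` and `y = x_2`.
-/
theorem qn_braid₀_key {P : Params} (hq : Complex.exp P.η ≠ Complex.exp (-P.η))
    (hω : qn P (P.ω + 1) ≠ 0) {x y : ℂ} (hx : qn P (2 * x) ≠ 0) (hy : qn P (2 * y) ≠ 0)
    (hxy : qn P (x - y) ≠ 0) (hxy' : qn P (-x - y) ≠ 0) :
    qn P (x - y + 1) / qn P (x - y) * (kfun P y / (qn P (2 * y) * qn P (P.ω + 1)) -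
        kfun P x / (qn P (2 * x) * qn P (P.ω + 1))) -
      (qn P P.ω / qn P (P.ω + 1) - kfun P x / (qn P (2 * x) * qn P (P.ω + 1))) *
        (qn P (-x - y + 1) / qn P (-x - y)) -
      kfun P y / (qn P (2 * y) * qn P (P.ω + 1)) *
        (qn P 2 - qn P (-x - y + 1) / qn P (-x - y)) + 1 = 0 := by
  have h0 := qexp_ne P 1
  have h1 := qexp_ne P x
  have h2 := qexp_ne P y
  have h4 := qden_ne' hq
  have h5 := qexp_ne P ((P.ω + P.δ) / 2)
  have h6 := qexp_ne P ((P.ω - P.δ) / 2)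
  have hw : qexp P P.ω = qexp P ((P.ω + P.δ) / 2) * qexp P ((P.ω - P.δ) / 2) := by
    rw [← qexp_add]; congr 1; ring
  have key : qn P (x - y + 1) * qn P (-x - y) *
        (kfun P y * qn P (2 * x) - kfun P x * qn P (2 * y)) -
      qn P (x - y) * qn P (2 * y) * (qn P P.ω * qn P (2 * x) - kfun P x) * qn P (-x - y + 1) -
      kfun P y * qn P (x - y) * qn P (2 * x) * (qn P 2 * qn P (-x - y) - qn P (-x - y + 1)) +
      qn P (x - y) * qn P (-x - y) * qn P (2 * x) * qn P (2 * y) * qn P (P.ω + 1) = 0 := by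
    simp only [kfun, qn_eq, qexp_add, qexp_sub, qexp_neg, qexp_two_mul, qexp_two, hw]
    generalize qexp P ((P.ω + P.δ) / 2) = A at *
    generalize qexp P ((P.ω - P.δ) / 2) = B at *
    field_simp
    ring
  generalize qn P (x - y + 1) = a' at *
  generalize qn P (-x - y + 1) = b' at *
  generalize qn P (x - y) = a at *
  generalize qn P (-x - y) = b at *
  generalize qn P (2 * x) = c at *
  generalize qn P (2 * y) = d at *
  field_simp
  linear_combination key

/-- The divided difference operator `c (1 - σ)`. -/
noncomputable def diffOp {X : Type*} (c : X → ℂ) (σ : X → X) : Module.End ℂ (X → ℂ) :=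
  LinearMap.mulLeft ℂ c * (1 - LinearMap.funLeft ℂ ℂ σ)

section DiffOp

variable {X : Type*} {σ ρ : X → X} {c e : X → ℂ} {d τ : ℂ}

theorem diffOp_apply (c : X → ℂ) (σ : X → X) (f : X → ℂ) (x : X) :
    diffOp c σ f x = c x * (f x - f (σ x)) := rfl

theorem diffOp_sq (hσ : ∀ x, σ (σ x) = x) (hc : ∀ x, c x + c (σ x) = d) :
    diffOp c σ * diffOp c σ = d • diffOp c σ := by
  refine LinearMap.ext fun f => funext fun x => ?_
  simp only [Module.End.mul_apply, LinearMap.smul_apply, Pi.smul_apply, diffOp_apply, hσ,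
    smul_eq_mul]
  linear_combination c x * (f x - f (σ x)) * hc x

theorem diffOp_comm (h : ∀ x, σ (ρ x) = ρ (σ x)) (hc : ∀ x, c (ρ x) = c x)
    (he : ∀ x, e (σ x) = e x) : diffOp c σ * diffOp e ρ = diffOp e ρ * diffOp c σ := by
  refine LinearMap.ext fun f => funext fun x => ?_
  simp only [Module.End.mul_apply, diffOp_apply, hc, he, h]
  ring

theorem diffOp_braid (hσ : ∀ x, σ (σ x) = x) (hρ : ∀ x, ρ (ρ x) = x)
    (hσρ : ∀ x, σ (ρ (σ x)) = ρ (σ (ρ x))) (hc : ∀ x, c x + c (σ x) = d)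
    (he : ∀ x, e x + e (ρ x) = d) (hce : ∀ x, c (ρ x) = e (σ x)) 
    (key : ∀ x, c x * e x + c (ρ x) * (d - c x) = 1 + e x * c (ρ x)) :
    diffOp c σ * diffOp e ρ * diffOp c σ - diffOp c σ =
      diffOp e ρ * diffOp c σ * diffOp e ρ - diffOp e ρ := by
  refine LinearMap.ext fun f => funext fun x => ?_
  have h1 : c (σ x) = d - c x := by rw [← hc x]; ring
  have h2 : e (ρ x) = d - e x := by rw [← he x]; ring
  have h3 : c (ρ (σ x)) = e x := by rw [hce, hσ]
  have h4 : e (σ (ρ x)) = c x := by rw [← hce, hρ]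
  simp only [Module.End.mul_apply, LinearMap.sub_apply, Pi.sub_apply, diffOp_apply, hσ, hρ, h1, h2,
    h3, h4, ← hce, hσρ]
  linear_combination (c x * (f x - f (σ x)) - e x * (f x - f (ρ x))) * key x

theorem diffOp_braid₀ (hσ : ∀ x, σ (σ x) = x) (hρ : ∀ x, ρ (ρ x) = x)
    (hσρ : ∀ x, σ (ρ (σ (ρ x))) = ρ (σ (ρ (σ x)))) (hc : ∀ x, c x + c (σ x) = d)
    (he : ∀ x, e x + e (ρ x) = τ) (hcc : ∀ x, c (ρ (σ (ρ x))) = c x)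
    (hee : ∀ x, e (σ (ρ (σ x))) = e x)
    (key : ∀ x, c x * (e (σ x) - e x) - (τ - e x) * c (ρ x) - e (σ x) * (d - c (ρ x)) + 1 = 0) :
    diffOp c σ * diffOp e ρ * diffOp c σ * diffOp e ρ -
        diffOp e ρ * diffOp c σ * diffOp e ρ * diffOp c σ =
      diffOp c σ * diffOp e ρ - diffOp e ρ * diffOp c σ := by
  refine LinearMap.ext fun f => funext fun x => ?_
  have h1 : c (σ x) = d - c x := by rw [← hc x]; ring
  have h2 : e (ρ x) = τ - e x := by rw [← he x]; ring
  have h3 : c (σ (ρ x)) = d - c (ρ x) := by rw [← hc (ρ x)]; ring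
  have h4 : e (ρ (σ x)) = τ - e (σ x) := by rw [← he (σ x)]; ring
  have h5 : c (ρ (σ x)) = c (ρ x) := by
    have := hcc (ρ x)
    rwa [hρ] at this
  have h6 : e (σ (ρ x)) = e (σ x) := by
    have := hee (σ x)
    rwa [hσ] at this
  simp only [Module.End.mul_apply, LinearMap.sub_apply, Pi.sub_apply, diffOp_apply, hσ, hρ, h1, h2,
    h3, h4, h5, h6, hσρ, hcc, hee]
  linear_combination (f (ρ x) * e x * (c x - c (ρ x)) + f (σ (ρ x)) * e x * c (ρ x) -
    f (ρ (σ x)) * c x * e (σ x) + f (σ x) * c x * (e (σ x) - e x)) * key x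

end DiffOp

section Fn

variable {P : Params} {N : ℕ} [NeZero N] (D : Domain P N)

/-- The coefficient `[x_i - x_{i+1} + 1] / [x_i - x_{i+1}]`, or `k(x_1, δ) / ([2 x_1] [ω + 1])` for
`i = 0`. -/
noncomputable def sCoeff (i : Fin N) (x : D.carrier) : ℂ :=
  if 1 ≤ (i : ℕ) then
    qn P (x.1 (prev i) - x.1 i + 1) / qn P (x.1 (prev i) - x.1 i)
  else kfun P (x.1 0) / (qn P (2 * x.1 0) * qn P (P.ω + 1))

theorem sOp_eq (i : Fin N) : sOp D i = diffOp (sCoeff D i) (move D i) := rfl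

/-- The operators `s_i` of the functional representation, indexed by natural numbers. -/
noncomputable def sFun (i : ℕ) : Module.End ℂ (Fn D) :=
  if h : i < N then sOp D ⟨i, h⟩ else 0

variable {D}

theorem sFun_of_lt {i : ℕ} (h : i < N) : sFun D i = sOp D ⟨i, h⟩ := dif_pos h

theorem move_pos {i : Fin N} (h : 1 ≤ (i : ℕ)) (x : D.carrier) (j : Fin N) :
    (move D i x).1 j = x.1 (Equiv.swap (prev i) i j) := by
  rw [move, dif_pos h]; rfl

theorem move_zero {i : Fin N} (h : (i : ℕ) = 0) (x : D.carrier) (j : Fin N) :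
    (move D i x).1 j = if j = 0 then -x.1 0 else x.1 j := by
  rw [move, dif_neg (by omega)]
  simp [reflFirst, Function.update_apply]

theorem move_prev {i : Fin N} (h : 1 ≤ (i : ℕ)) (x : D.carrier) :
    (move D i x).1 (prev i) = x.1 i := by
  rw [move_pos h, Equiv.swap_apply_left]

theorem move_self {i : Fin N} (h : 1 ≤ (i : ℕ)) (x : D.carrier) :
    (move D i x).1 i = x.1 (prev i) := by
  rw [move_pos h, Equiv.swap_apply_right]

theorem move_of_ne {i : Fin N} (h : 1 ≤ (i : ℕ)) (x : D.carrier) {j : Fin N}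
    (h1 : (j : ℕ) ≠ i - 1) (h2 : (j : ℕ) ≠ i) : (move D i x).1 j = x.1 j := by
  rw [move_pos h, Equiv.swap_apply_of_ne_of_ne]
  · exact fun e => h1 (congrArg Fin.val e)
  · exact fun e => h2 (congrArg Fin.val e)

theorem move_zero_self {i : Fin N} (h : (i : ℕ) = 0) (x : D.carrier) :
    (move D i x).1 0 = -x.1 0 := by
  rw [move_zero h, if_pos rfl]

theorem move_zero_of_ne {i : Fin N} (h : (i : ℕ) = 0) (x : D.carrier) {j : Fin N}
    (hj : (j : ℕ) ≠ 0) : (move D i x).1 j = x.1 j := by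
  rw [move_zero h, if_neg]
  exact fun e => hj (congrArg Fin.val e)

theorem move_move (i : Fin N) (x : D.carrier) : move D i (move D i x) = x := by
  apply Subtype.ext
  funext j
  by_cases h : 1 ≤ (i : ℕ)
  · rw [move_pos h, move_pos h, Equiv.swap_apply_self]
  · by_cases hj : j = 0
    · rw [hj, move_zero_self (by omega), move_zero_self (by omega), neg_neg]
    · have : (j : ℕ) ≠ 0 := fun e => hj (Fin.ext e)
      rw [move_zero_of_ne (by omega) _ this, move_zero_of_ne (by omega) _ this]

theorem move_comm {i j : Fin N} (hij : (i : ℕ) + 2 ≤ j) (x : D.carrier) :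
    move D i (move D j x) = move D j (move D i x) := by
  apply Subtype.ext
  funext l
  have hj : 1 ≤ (j : ℕ) := by omega
  have vj : ((prev j : Fin N) : ℕ) = j - 1 := rfl
  by_cases h : 1 ≤ (i : ℕ)
  · have vi : ((prev i : Fin N) : ℕ) = i - 1 := rfl
    have hd : Equiv.Perm.Disjoint (Equiv.swap (prev i) i) (Equiv.swap (prev j) j) := by
      refine Equiv.Perm.disjoint_swap_swap ?_
      simp [Fin.ext_iff, vi, vj]
      omega
    rw [move_pos h, move_pos hj, move_pos hj, move_pos h]
    exact congrArg (fun e : Equiv.Perm (Fin N) => x.1 (e l)) hd.commute.eq.symm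
  · have hi : (i : ℕ) = 0 := by omega
    by_cases hl : (l : ℕ) = 0
    · have : l = 0 := Fin.ext hl
      subst this
      rw [move_zero_self hi, move_of_ne hj _ (by omega) (by omega),
        move_of_ne hj _ (by omega) (by omega), move_zero_self hi]
    · rw [move_zero_of_ne hi _ hl, move_pos hj, move_pos hj, move_zero_of_ne hi]
      rw [Equiv.swap_apply_def]
      split_ifs <;> omega

theorem move_braid {i j : Fin N} (hi : 1 ≤ (i : ℕ)) (hij : (i : ℕ) + 1 = j) (x : D.carrier) :
    move D i (move D j (move D i x)) = move D j (move D i (move D j x)) := by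
  have hj : 1 ≤ (j : ℕ) := by omega
  have vi : ((prev i : Fin N) : ℕ) = i - 1 := rfl
  have hpj : prev j = i := Fin.ext (by simp only [prev]; omega)
  have pi : ∀ y : D.carrier, (move D i y).1 (prev i) = y.1 i := move_prev hi
  have si : ∀ y : D.carrier, (move D i y).1 i = y.1 (prev i) := move_self hi
  have fi : ∀ y : D.carrier, (move D i y).1 j = y.1 j := fun y =>
    move_of_ne hi y (by omega) (by omega)
  have pj : ∀ y : D.carrier, (move D j y).1 i = y.1 j := fun y => by rw [← hpj, move_prev hj]
  have sj : ∀ y : D.carrier, (move D j y).1 j = y.1 i := fun y => by rw [move_self hj, hpj]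
  have fj : ∀ y : D.carrier, (move D j y).1 (prev i) = y.1 (prev i) := fun y =>
    move_of_ne hj y (by omega) (by omega)
  apply Subtype.ext
  funext l
  by_cases h1 : l = prev i
  · rw [h1, pi, pj, fi, fj, pi, pj]
  · by_cases h2 : l = i
    · rw [h2, si, fj, pi, pj, fi, sj]
    · by_cases h3 : l = j
      · rw [h3, fi, sj, si, sj, si, fj]
      · have e1 : (l : ℕ) ≠ i - 1 := fun e => h1 (Fin.ext e)
        have e2 : (l : ℕ) ≠ i := fun e => h2 (Fin.ext e)
        have e3 : (l : ℕ) ≠ j := fun e => h3 (Fin.ext e)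
        rw [move_of_ne hi _ e1 e2, move_of_ne hj _ (by omega) e3, move_of_ne hi _ e1 e2,
          move_of_ne hj _ (by omega) e3, move_of_ne hi _ e1 e2, move_of_ne hj _ (by omega) e3]

theorem move_braid₀ {i j : Fin N} (hi : (i : ℕ) = 0) (hj : (j : ℕ) = 1) (x : D.carrier) :
    move D j (move D i (move D j (move D i x))) = move D i (move D j (move D i (move D j x))) := by
  have hj1 : 1 ≤ (j : ℕ) := by omega
  have hpj : prev j = 0 := Fin.ext (by simp only [prev]; rw [hj]; rfl)
  have hp : ∀ y : D.carrier, (move D j y).1 0 = y.1 j := fun y => by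
    rw [← hpj, move_prev hj1]
  have hs : ∀ y : D.carrier, (move D j y).1 j = y.1 0 := fun y => by
    rw [move_self hj1, hpj]
  have h0 : ∀ y : D.carrier, (move D i y).1 0 = -y.1 0 := fun y => move_zero_self hi y
  have h1 : ∀ y : D.carrier, (move D i y).1 j = y.1 j := fun y =>
    move_zero_of_ne hi y (by omega)
  apply Subtype.ext
  funext l
  by_cases e1 : l = 0
  · subst e1
    rw [hp, h1, hs, h0, h0, hp, h1, hs]
  · have e1' : (l : ℕ) ≠ 0 := fun e => e1 (Fin.ext e)
    by_cases e2 : l = j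
    · subst e2
      rw [hs, h0, hp, h1, h1, hs, h0, hp]
    · have e2' : (l : ℕ) ≠ j := fun e => e2 (Fin.ext e)
      rw [move_of_ne hj1 _ (by omega) e2', move_zero_of_ne hi _ e1',
        move_of_ne hj1 _ (by omega) e2', move_zero_of_ne hi _ e1',
        move_zero_of_ne hi _ e1', move_of_ne hj1 _ (by omega) e2',
        move_zero_of_ne hi _ e1', move_of_ne hj1 _ (by omega) e2']

/-- The operators `s_i` of the functional representation satisfy the relations of the Hecke algebra
of type `B`. The quadratic relation holds because the coefficients of `s_i` at a point and at its
image under the reflection add up to the loop weight; the braid relations reduce to identities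
between `q`-numbers. -/
theorem sFun_heckeRep (hq : Complex.exp P.η ≠ Complex.exp (-P.η)) (hω : qn P (P.ω + 1) ≠ 0) :
    HeckeRep P N (sFun D) := by
  have cpos : ∀ {i : Fin N}, 1 ≤ (i : ℕ) → ∀ x : D.carrier, sCoeff D i x =
      qn P (x.1 (prev i) - x.1 i + 1) / qn P (x.1 (prev i) - x.1 i) := fun h x => if_pos h
  have czero : ∀ {i : Fin N}, (i : ℕ) = 0 → ∀ x : D.carrier, sCoeff D i x =
      kfun P (x.1 0) / (qn P (2 * x.1 0) * qn P (P.ω + 1)) := fun h x => if_neg (by omega)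
  have csum : ∀ (i : Fin N) (x : D.carrier),
      sCoeff D i x + sCoeff D i (move D i x) = loopWt P i := by
    intro i x
    by_cases h : 1 ≤ (i : ℕ)
    · rw [cpos h, cpos h, move_prev h, move_self h, loopWt_pos h]
      have h1 := D.diff_ne i h x.1 x.2
      have h2 := qn_two_mul hq (x.1 (prev i) - x.1 i)
      rw [show x.1 i - x.1 (prev i) + 1 = -(x.1 (prev i) - x.1 i - 1) by ring,
        show x.1 i - x.1 (prev i) = -(x.1 (prev i) - x.1 i) by ring, qn_neg, qn_neg]
      field_simp
      linear_combination -h2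
    · have h0 : (i : ℕ) = 0 := by omega
      rw [czero h0, czero h0, move_zero_self h0, h0, loopWt_zero]
      have h1 := D.two_mul_ne x.1 x.2
      have h2 := kfun_sub hq (x.1 0)
      rw [show 2 * -x.1 0 = -(2 * x.1 0) by ring, qn_neg]
      field_simp
      linear_combination h2
  refine ⟨fun i hi => ?_, fun i j hij hj => ?_, fun i hi hN => ?_, fun hN => ?_⟩
  · rw [sFun_of_lt hi, sOp_eq]
    exact diffOp_sq (move_move _) (csum ⟨i, hi⟩)
  · have hi : i < N := by omega
    rw [sFun_of_lt hi, sFun_of_lt hj, sOp_eq, sOp_eq]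
    have hj1 : 1 ≤ ((⟨j, hj⟩ : Fin N) : ℕ) := by simp only; omega
    have vj : ((prev ⟨j, hj⟩ : Fin N) : ℕ) = j - 1 := rfl
    refine diffOp_comm (move_comm hij) (fun x => ?_) (fun x => ?_)
    · by_cases h : 1 ≤ ((⟨i, hi⟩ : Fin N) : ℕ)
      · have vi : ((prev ⟨i, hi⟩ : Fin N) : ℕ) = i - 1 := rfl
        rw [cpos h, cpos h, move_of_ne hj1 _ (by simp only [vi]; omega) (by simp only [vi]; omega),
          move_of_ne hj1 _ (by simp only; omega) (by simp only; omega)]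
      · have h0 : ((⟨i, hi⟩ : Fin N) : ℕ) = 0 := by omega
        have v0 : ((0 : Fin N) : ℕ) = 0 := rfl
        rw [czero h0, czero h0, move_of_ne hj1 _ (by simp only [v0]; omega)
          (by simp only [v0]; omega)]
    · rw [cpos hj1, cpos hj1]
      by_cases h : 1 ≤ ((⟨i, hi⟩ : Fin N) : ℕ)
      · rw [move_of_ne h _ (by simp only [vj]; omega) (by simp only [vj]; omega),
          move_of_ne h _ (by simp only; omega) (by simp only; omega)]
      · have h0 : ((⟨i, hi⟩ : Fin N) : ℕ) = 0 := by omega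
        rw [move_zero_of_ne h0 _ (by simp only [vj]; omega),
          move_zero_of_ne h0 _ (by simp only; omega)]
  · have hi' : i < N := by omega
    rw [sFun_of_lt hi', sFun_of_lt hN, sOp_eq, sOp_eq]
    set a : Fin N := ⟨i, hi'⟩ with ha
    set b : Fin N := ⟨i + 1, hN⟩ with hb
    have ha1 : 1 ≤ (a : ℕ) := hi
    have hb1 : 1 ≤ (b : ℕ) := by simp [hb]
    have hpb : prev b = a := rfl
    have va : ((prev a : Fin N) : ℕ) = i - 1 := rfl
    have m1 : ∀ x : D.carrier, sCoeff D a (move D b x) =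
        qn P (x.1 (prev a) - x.1 b + 1) / qn P (x.1 (prev a) - x.1 b) := fun x => by
      rw [cpos ha1, move_of_ne hb1 _ (by simp only [va, hb]; omega) (by simp only [va, hb]; omega)]
      have := move_prev hb1 x
      rw [hpb] at this
      rw [this]
    refine diffOp_braid (d := qn P 2) (move_move _) (move_move _)
      (move_braid ha1 rfl) (fun x => ?_) (fun x => ?_) (fun x => ?_) (fun x => ?_)
    · rw [csum, loopWt_pos ha1]
    · rw [csum, loopWt_pos hb1]
    · rw [m1, cpos hb1, hpb, move_self ha1, move_of_ne ha1 _ (by simp [ha, hb]; omega)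
        (by simp [ha, hb])]
    · have h1 := D.diff_ne a ha1 x.1 x.2
      have h2 := D.diff_ne b hb1 x.1 x.2
      have h3 := D.diff_ne a ha1 _ (move D b x).2
      rw [move_of_ne hb1 _ (by simp only [va, hb]; omega) (by simp only [va, hb]; omega), ← hpb,
        move_prev hb1, hpb] at h3
      rw [hpb] at h2
      rw [m1, cpos ha1, cpos hb1, hpb]
      have e : x.1 (prev a) - x.1 b = x.1 (prev a) - x.1 a + (x.1 a - x.1 b) := by ring
      rw [e] at h3 ⊢
      exact qn_braid_key hq h1 h2 h3
  · have h0N : 0 < N := by omega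
    rw [sFun_of_lt hN, sFun_of_lt h0N, sOp_eq, sOp_eq]
    set a : Fin N := ⟨0, h0N⟩ with ha
    set b : Fin N := ⟨1, hN⟩ with hb
    have ha0 : (a : ℕ) = 0 := rfl
    have hb1 : 1 ≤ (b : ℕ) := le_rfl
    have hpb : prev b = 0 := Fin.ext rfl
    have hp : ∀ y : D.carrier, (move D b y).1 0 = y.1 b := fun y => by
      rw [← hpb, move_prev hb1]
    have hs : ∀ y : D.carrier, (move D b y).1 b = y.1 0 := fun y => by
      rw [move_self hb1, hpb]
    have h0 : ∀ y : D.carrier, (move D a y).1 0 = -y.1 0 := fun y => move_zero_self ha0 y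
    have h1 : ∀ y : D.carrier, (move D a y).1 b = y.1 b := fun y =>
      move_zero_of_ne ha0 y (by simp [hb])
    have cb : ∀ x : D.carrier, sCoeff D b x =
        qn P (x.1 0 - x.1 b + 1) / qn P (x.1 0 - x.1 b) := fun x => by rw [cpos hb1, hpb]
    refine diffOp_braid₀ (d := qn P 2) (τ := loopWt P 0) (move_move _) (move_move _)
      (move_braid₀ ha0 rfl) (fun x => ?_) (csum a) (fun x => ?_) (fun x => ?_) (fun x => ?_)
    · rw [csum, loopWt_pos hb1]
    · rw [cb, cb, h0, h1, hp, hs, h0, h1]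
      congr 2 <;> ring
    · rw [czero ha0, czero ha0, hp, h1, hs]
    · have n1 := D.two_mul_ne x.1 x.2
      have n2 := D.two_mul_ne _ (move D b x).2
      have n3 := D.diff_ne b hb1 x.1 x.2
      have n4 := D.diff_ne b hb1 _ (move D a x).2
      rw [hp] at n2
      rw [hpb] at n3 n4
      rw [h0, h1] at n4
      rw [cb, cb, czero ha0, czero ha0, hp, h0, h1, loopWt_zero]
      exact qn_braid₀_key hq hω n1 n2 n3 n4

end Fn

/-! ### The factorised operators as products over tiles -/

section HOp

variable {P : Params} {N : ℕ} {a : ℕ → ℤ}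

/-- The integers of the tiles increase strictly in the upward directions. -/
theorem ct_lt_ct (ha : IsPath N a) {t t' : ℕ × ℕ} (ht : HasTile N a t) (ht' : HasTile N a t')
    (hlt : t.2 < t'.2) (h1 : t.1 ≤ t'.1 + 1) (h2 : t'.1 ≤ t.1 + 1) :
    ct N a t.1 t.2 < ct N a t'.1 t'.2 := by
  obtain ⟨l, c1, c2, c3⟩ := exists_ct_eq ha (i := t.1) (j := t.2) ht
  have := le_ct ha (i := t'.1) (j := t'.2) ht' (l := l) (by omega) (by omega)
  omega

theorem lt_or_far (ha : IsPath N a) {t t' : ℕ × ℕ} (ht : HasTile N a t) (ht' : HasTile N a t')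
    (hne : t ≠ t') (hct : ct N a t.1 t.2 ≤ ct N a t'.1 t'.2) :
    t.2 < t'.2 ∨ t.1 + 2 ≤ t'.1 ∨ t'.1 + 2 ≤ t.1 := by
  by_contra! hc
  obtain ⟨c1, c2, c3⟩ := hc
  rcases c1.eq_or_lt with e | e
  · have p1 := hasTile_parity ha ht
    have p2 := hasTile_parity ha ht'
    exact hne (Prod.ext (by omega) e.symm)
  · have := ct_lt_ct ha ht' ht e (by omega) (by omega)
    omega

open Classical in
/-- The tiles whose integer is `u`. -/
noncomputable def tileLayer (N : ℕ) (a : ℕ → ℤ) (u : ℕ) : List (Fin N × ℕ) :=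
  ((List.finRange N).product (List.range N)).filter fun t =>
    decide (IsTile (toHeights N a) t.1 t.2 ∧ content (toHeights N a) t.2 t.1 = u)

theorem mem_tileLayer {u : ℕ} {t : Fin N × ℕ} :
    t ∈ tileLayer N a u ↔ HasTile N a (t.1, t.2) ∧ ct N a t.1 t.2 = u := by
  obtain ⟨i, j⟩ := t
  have h1 : ct N a i j = content (toHeights N a) j i := by simp [ct]
  have h2 : HasTile N a (i, j) → j < N := fun h => by
    have := h.2.2.1
    simp only [topPath] at this
    omega
  rw [h1]
  simp only [tileLayer, List.mem_filter, List.pair_mem_product, List.mem_finRange, List.mem_range,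
    true_and, decide_eq_true_eq, isTile_toHeights, and_iff_right_iff_imp]
  exact fun h => h2 h.1

/-- The list of all tiles, ordered by their integers. -/
noncomputable def tileList (N : ℕ) (a : ℕ → ℤ) : List (ℕ × ℕ) :=
  (List.range' 1 N).flatMap fun u => (tileLayer N a u).map fun t => (t.1.val, t.2)

theorem isReading_tileList (ha : IsPath N a) : IsReading N a (tileList N a) := by
  have inj : Function.Injective fun t : Fin N × ℕ => (t.1.val, t.2) := fun t t' h => by
    simp only [Prod.mk.injEq] at h
    exact Prod.ext (Fin.ext h.1) h.2
  have hmem : ∀ u t, t ∈ (tileLayer N a u).map (fun t => (t.1.val, t.2)) →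
      HasTile N a t ∧ ct N a t.1 t.2 = u := by
    intro u t ht
    obtain ⟨t', h1, rfl⟩ := List.mem_map.1 ht
    exact mem_tileLayer.1 h1
  have hnd : ∀ u, ((tileLayer N a u).map fun t => (t.1.val, t.2)).Nodup := fun u =>
    (((List.nodup_finRange N).product List.nodup_range).filter _).map inj
  refine ⟨?_, fun t => ?_, ?_⟩
  · rw [tileList, List.nodup_flatMap]
    refine ⟨fun u _ => hnd u, ?_⟩
    refine (List.nodup_range' (step := 1)).imp ?_
    intro u u' huu t h1 h2
    exact huu ((hmem u t h1).2.symm.trans (hmem u' t h2).2)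
  · rw [tileList, List.mem_flatMap]
    constructor
    · rintro ⟨u, -, h⟩
      exact (hmem u t h).1
    · intro h
      have h1 := one_le_ct (a := a) h.1 t.2
      have h2 := h.ct_le (b := a)
      refine ⟨ct N a t.1 t.2, List.mem_range'_1.2 ⟨h1, by omega⟩, ?_⟩
      exact List.mem_map.2 ⟨(⟨t.1, h.1⟩, t.2), mem_tileLayer.2 ⟨h, rfl⟩, rfl⟩
  · rw [tileList, List.pairwise_flatMap]
    constructor
    · intro u _
      refine (List.Pairwise.and_mem.1 (hnd u)).imp ?_
      intro t t' h
      have h1 := hmem u t h.1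
      have h2 := hmem u t' h.2.1
      exact lt_or_far ha h1.1 h2.1 h.2.2 (by omega)
    · refine (List.pairwise_lt_range' (step := 1)).imp ?_
      intro u u' huu t ht t' ht'
      have h1 := hmem u t ht
      have h2 := hmem u' t' ht'
      refine lt_or_far ha h1.1 h2.1 ?_ (by omega)
      rintro rfl
      omega

variable [NeZero N] {D : Domain P N}

theorem hOp_eq (i : Fin N) (u : ℕ) : hOp D i u = baxtOp P (sFun D) i u := by
  have : sFun D i = sOp D i := sFun_of_lt i.2
  rw [baxtOp, this, hOp, baxt]
  split_ifs <;> rfl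

/-- The order of the factors by their integers is a reading of the tiles. -/
theorem HOp_toHeights (H : HeckeRep P N (sFun D)) (ha : IsPath N a) (f : Fn D) :
    HOp D (toHeights N a) f = hVec P N (sFun D) a f := by
  rw [hVec, tileVec, tileProd_eq H _ ha (isReading_tileList ha), tileList, List.map_flatMap,
    List.flatMap_def, List.prod_flatten, List.map_map, HOp]
  congr 3
  funext u
  show ((((tileLayer N a u).map Prod.fst).map fun i => hOp D i u)).prod = _
  rw [Function.comp_apply, List.map_map, List.map_map]
  refine congrArg List.prod (List.map_congr_left fun t ht => ?_)
  have := (mem_tileLayer.1 ht).2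
  simp only [Function.comp_apply]
  rw [this, hOp_eq]

theorem gamma_eq {N k m : ℕ} (h : (m : ℤ) = 2 * k - (N % 2 : ℕ) - 1) :
    gamma N k = toHeights N (gammaPath N m) := by
  funext j
  simp only [gamma, toHeights, gammaPath, h]

/-- The minima of the paths `γ(k)` are all the points at which a path can have the height `-1`. -/
theorem truncation_iff (H : HeckeRep P N (sFun D)) (f : Fn D) :
    Truncation D f ↔
      ∀ m < N, ((m : ℤ) - N) % 2 = 1 → hVec P N (sFun D) (gammaPath N m) f = 0 := by
  constructor
  · intro h m hm hpar
    have e := gamma_eq (N := N) (m := m) (k := (m + 1 + N % 2) / 2) (by omega)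
    rw [← HOp_toHeights H (gammaPath_isPath hm hpar), ← e]
    exact h _ (by omega) (by omega)
  · intro h k h1 h2
    have e := gamma_eq (N := N) (m := 2 * k - N % 2 - 1) (k := k) (by omega)
    have hm : 2 * k - N % 2 - 1 < N := by omega
    have hpar : (((2 * k - N % 2 - 1 : ℕ) : ℤ) - N) % 2 = 1 := by omega
    rw [e, HOp_toHeights H (gammaPath_isPath hm hpar)]
    exact h _ hm hpar

end HOp

/-! ### The qKZ equations as an intertwining property -/

section Ballot

variable {P : Params} {N : ℕ}

/-- A vector of heights, continued by the maximal path. -/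
def extHeights (α : Heights N) : ℕ → ℤ := fun x =>
  if h : x < N + 1 then α ⟨x, h⟩ else N - x

theorem toHeights_extHeights (α : Heights N) : toHeights N (extHeights α) = α := by
  funext i
  simp only [toHeights, extHeights]
  rw [dif_pos i.2]

theorem extHeights_toHeights {a : ℕ → ℤ} (ha : IsPath N a) : extHeights (toHeights N a) = a := by
  funext x
  simp only [extHeights, toHeights]
  split_ifs with h
  · rfl
  · exact (ha.tail x (by omega)).symm

theorem isBal_extHeights {α : Heights N} (h : IsBallot α) : IsBal N (extHeights α) := by
  obtain ⟨h1, h2, h3⟩ := h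
  have h0 : ∀ x ≤ N, 0 ≤ extHeights α x := fun x hx => by
    simp only [extHeights]
    rw [dif_pos (by omega)]
    exact h2 _
  have ht : ∀ x, N ≤ x → extHeights α x = N - x := fun x hx => by
    simp only [extHeights]
    split_ifs with h
    · have hx' : x = N := by omega
      subst hx'
      rw [sub_self]
      exact h3
    · rfl
  refine ⟨⟨fun x => ?_, ht, fun x hx => by have := h0 x hx; omega⟩, h0⟩
  by_cases hx : x < N
  · have := h1 ⟨x, hx⟩
    have e1 : extHeights α (x + 1) = α (Fin.succ ⟨x, hx⟩) := by
      simp only [extHeights]; rw [dif_pos (by omega)]; rfl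
    have e2 : extHeights α x = α (Fin.castSucc ⟨x, hx⟩) := by
      simp only [extHeights]; rw [dif_pos (by omega)]; rfl
    omega
  · rw [ht x (by omega), ht (x + 1) (by omega)]
    push_cast
    omega

theorem isBallot_toHeights {a : ℕ → ℤ} (h : IsBal N a) : IsBallot (toHeights N a) := by
  refine ⟨fun i => ?_, fun i => h.nonneg i (by omega), ?_⟩
  · have := h.step i
    simp only [toHeights, Fin.val_succ, Fin.val_castSucc]
    omega
  · have := h.tail N le_rfl
    simpa [toHeights] using this

/-- Ballot paths as vectors of heights and as functions on `ℕ`. -/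
def balEquiv (N : ℕ) : BallotPath N ≃ Bal N where
  toFun α := ⟨extHeights α.1, isBal_extHeights α.2⟩
  invFun a := ⟨toHeights N a.1, isBallot_toHeights a.2⟩
  left_inv α := Subtype.ext (toHeights_extHeights α.1)
  right_inv a := Subtype.ext (extHeights_toHeights a.2.toIsPath)

theorem extHeights_omega : extHeights (omega N).1 = topPath N := by
  funext x
  simp [extHeights, omega, topPath]

/-- The path and the coefficient of the action of `e_i` in terms of the moves. -/
theorem image_eq {a : ℕ → ℤ} (i : Fin N) {m : Move} (hm : m.Valid a i) :
    imagePath i (toHeights N a) = toHeights N (a + m.shift i) ∧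
      imageCoeff P i (toHeights N a) = m.coeff P i := by
  have eL : htL (toHeights N a) i = a (i - 1) := rfl
  have eM : htM (toHeights N a) i = a i := rfl
  have eR : htR (toHeights N a) i = a (i + 1) := rfl
  have hj : ∀ j : Fin (N + 1), j = i.castSucc ↔ (j : ℕ) = i := fun j => by
    rw [Fin.ext_iff]; rfl
  have hlt : ∀ j : Fin (N + 1), i.castSucc < j ↔ (i : ℕ) < j := fun j => Iff.rfl
  have hgt : ∀ j : Fin (N + 1), j < i.castSucc ↔ (j : ℕ) < i := fun j => Iff.rfl
  have hT : ∀ j : Fin (N + 1), toHeights N a j = a j := fun j => rfl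
  have hT' : ∀ j : Fin (N + 1), toHeights N (a + m.shift i) j = a j + m.shift i j := fun j => rfl
  refine ⟨funext fun j => ?_, ?_⟩
  · rw [hT']
    simp only [imagePath, eL, eM, eR, hj, hT, hlt, hgt]
    cases m with
    | valley =>
      have h1 := hm.1
      have h2 := hm.2
      simp only [Move.shift]
      split_ifs <;> omega
    | peak =>
      have h1 := hm.1
      have h2 := hm.2
      simp only [Move.shift]
      split_ifs <;> omega
    | up R =>
      have h1 := UpArc.pos hm
      have h2 := UpArc.left hm
      have h3 := UpArc.right hm
      have h4 := UpArc.eq hm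
      have h5 := UpArc.gt hm
      have h6 := UpArc.lt hm
      have key : ((i : ℕ) < j ∧ ∀ l : Fin (N + 1), (i : ℕ) < l → l ≤ j → a i < a l) ↔
          (i : ℕ) < j ∧ (j : ℕ) < R := by
        refine and_congr_right fun hij => ⟨fun h => ?_, fun h l h7 h8 => ?_⟩
        · by_contra! hR
          have := h ⟨R, by omega⟩ (by simp only; omega) (Fin.mk_le_of_le_val hR)
          simp only at this
          omega
        · exact h5 l h7 (lt_of_le_of_lt (Fin.le_def.1 h8) h)
      rw [if_neg (by omega), if_neg (by omega), if_neg (by omega), if_pos (by omega)]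
      simp only [key, Move.shift]
      split_ifs <;> omega
    | down K =>
      have h1 := DownArc.pos hm
      have h2 := DownArc.left hm
      have h3 := DownArc.right hm
      have h4 := DownArc.eq hm
      have h5 := DownArc.gt hm
      have h6 := DownArc.lt hm
      have key : ((j : ℕ) < i ∧ ∀ l : Fin (N + 1), j ≤ l → (l : ℕ) < i → a i < a l) ↔
          K ≤ (j : ℕ) ∧ (j : ℕ) < i := by
        rw [and_comm]
        refine and_congr_left fun hij => ⟨fun h => ?_, fun h l h7 h8 => ?_⟩
        · by_contra! hK
          have := h ⟨K - 1, by omega⟩ (Fin.le_def.2 (by simp only; omega)) (by simp only; omega)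
          simp only at this
          omega
        · exact h5 l (h.trans (Fin.le_def.1 h7)) h8
      rw [if_neg (by omega), if_neg (by omega), if_neg (by omega), if_neg (by omega)]
      simp only [key, Move.shift]
      split_ifs <;> omega
  · simp only [imageCoeff, eL, eM, eR, hT, hgt]
    cases m with
    | valley =>
      have h1 := hm.1
      have h2 := hm.2
      simp only [Move.coeff]
      split_ifs <;> first | omega | rfl
    | peak =>
      have h1 := hm.1
      have h2 := hm.2
      simp only [Move.coeff]
      split_ifs with q1 q2 q3 q4
      · omega
      · rw [q1, loopWt_zero]
      · rw [loopWt_pos (by omega)]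
      · omega
      · omega
    | up R =>
      have h1 := UpArc.pos hm
      have h2 := UpArc.left hm
      have h3 := UpArc.right hm
      simp only [Move.coeff]
      rw [if_neg (by omega), if_neg (by omega), if_neg (by omega)]
    | down K =>
      have h1 := DownArc.pos hm
      have h2 := DownArc.left hm
      have h3 := DownArc.right hm
      have h4 := DownArc.eq hm
      have h5 := DownArc.gt hm
      have h6 := DownArc.lt hm
      have key : (∀ l : Fin (N + 1), (l : ℕ) < i → a i < a l) ↔ K = 0 := by
        refine ⟨fun h => ?_, fun h l h7 => h5 l (by omega) h7⟩
        by_contra hK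
        have := h ⟨K - 1, by omega⟩ (by simp only; omega)
        simp only at this
        omega
      simp only [Move.coeff, key, loopWt_zero]
      rw [if_neg (by omega), if_neg (by omega)]
      refine if_congr ?_ rfl rfl
      constructor
      · exact fun h => ⟨h.2.2.2, h.2.2.1⟩
      · exact fun h => ⟨by omega, by omega, h.2, h.1⟩

end Ballot

section QKZ

variable {P : Params} {N : ℕ} [NeZero N] {D : Domain P N} (Ψ : BallotPath N → Fn D)

/-- The components of `e_i |Ψ⟩`. -/
noncomputable def eFam (i : Fin N) (β : BallotPath N) : Fn D := ∑ α, eMat P i β α • Ψ α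

/-- The linear map which takes the indicator function of a Ballot path `α` to `ψ_α`. -/
noncomputable def coeffMap : (Bal N → ℂ) →ₗ[ℂ] Fn D :=
  ∑ α, (LinearMap.proj (balEquiv N α)).smulRight (Ψ α)

theorem coeffMap_apply (f : Bal N → ℂ) : coeffMap Ψ f = ∑ α, f (balEquiv N α) • Ψ α := by
  simp [coeffMap]

theorem coeffMap_delta (α : BallotPath N) : coeffMap Ψ (delta N (extHeights α.1)) = Ψ α := by
  classical
  rw [coeffMap_apply, Finset.sum_eq_single α]
  · simp [delta, balEquiv]
  · intro β _ hβ
    have : (balEquiv N β).1 ≠ extHeights α.1 := fun e =>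
      hβ ((balEquiv N).injective (Subtype.ext e))
    simp [delta, this]
  · simp

theorem coeffMap_eDual (i : Fin N) (f : Bal N → ℂ) :
    coeffMap Ψ (eDual P N i f) = ∑ β, f (balEquiv N β) • eFam Ψ i β := by
  classical
  simp only [eFam, Finset.smul_sum, smul_smul]
  rw [Finset.sum_comm, coeffMap_apply]
  refine Finset.sum_congr rfl fun α _ => ?_
  have hm := valid_moveAt (balEquiv N α).2 i.2
  rw [eDual_apply i.2 f hm]
  obtain ⟨h1, h2⟩ := image_eq (P := P) i hm
  have h3 : toHeights N (balEquiv N α).1 = α.1 := toHeights_extHeights α.1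
  rw [h3] at h1 h2
  rw [Finset.sum_eq_single ((balEquiv N).symm ⟨_, hm.isBal (balEquiv N α).2 i.2⟩)]
  · rw [Equiv.apply_symm_apply]
    congr 1
    rw [mul_comm, ← h2]
    congr 1
    exact (if_pos h1.symm).symm
  · intro β _ hβ
    have : β.1 ≠ imagePath i α.1 := fun e => hβ (Subtype.ext (e.trans h1))
    simp [eMat, this]
  · simp

theorem coeffMap_eDual_delta (i : Fin N) (β : BallotPath N) :
    coeffMap Ψ (eDual P N i (delta N (extHeights β.1))) = eFam Ψ i β := by
  classical
  rw [coeffMap_eDual, Finset.sum_eq_single β]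
  · simp [delta, balEquiv]
  · intro α _ hα
    have : (balEquiv N α).1 ≠ extHeights β.1 := fun e =>
      hα ((balEquiv N).injective (Subtype.ext e))
    simp [delta, this]
  · simp

theorem eFam_apply (i : Fin N) (β : BallotPath N) (x : D.carrier) :
    eFam Ψ i β x = (eMat P i).mulVec (ket Ψ x) β := by
  simp [eFam, Matrix.mulVec, dotProduct, ket, Finset.sum_apply]

/-- The qKZ equations say that `e_i` acts on the components as `s_i - [2]`, or `s_0 - [ω]/[ω+1]`,
and that these are invariant under the reflection of the last variable. -/
theorem qkz_iff (hq : Complex.exp P.η ≠ Complex.exp (-P.η)) (hω : qn P (P.ω + 1) ≠ 0) :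
    QKZ Ψ ↔ (∀ (i : Fin N) (β : BallotPath N),
      eFam Ψ i β + loopWt P i • Ψ β = sOp D i (Ψ β)) ∧
        ∀ β x, Ψ β (moveLast D x) = Ψ β x := by
  have h1 : ∀ i : Fin N, 1 ≤ (i : ℕ) → ∀ x : D.carrier,
      ((RMat P i (x.1 (prev i) - x.1 i)).mulVec (ket Ψ x) = ket Ψ (move D i x) ↔
        ∀ β, eFam Ψ i β x + loopWt P i * Ψ β x = sOp D i (Ψ β) x) := by
    intro i hi x
    have n1 := D.diff_ne i hi x.1 x.2
    have n2 := D.one_add_diff_ne i hi x.1 x.2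
    rw [funext_iff]
    refine forall_congr' fun β => ?_
    rw [sOp_eq, diffOp_apply, sCoeff, if_pos hi, loopWt_pos hi, RMat, Matrix.smul_mulVec,
      Matrix.sub_mulVec, Matrix.smul_mulVec, Matrix.one_mulVec, Matrix.smul_mulVec]
    simp only [Pi.smul_apply, Pi.sub_apply, smul_eq_mul, ← eFam_apply]
    set d := x.1 (prev i) - x.1 i with hd
    have q := qn_two_mul hq d
    rw [show d - 1 = -(1 - d) by ring, qn_neg] at q
    rw [add_comm d 1] at q ⊢
    show _ = Ψ β (move D i x) ↔ _
    simp only [ket]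
    rw [inv_mul_eq_iff_eq_mul₀ n2]
    constructor
    · intro h
      field_simp
      linear_combination -h + q * Ψ β x
    · intro h
      field_simp at h
      linear_combination -h + q * Ψ β x
  have h2 : ∀ x : D.carrier,
      ((KMat P (-(x.1 0))).mulVec (ket Ψ x) = ket Ψ (move D 0 x) ↔
        ∀ β, eFam Ψ 0 β x + loopWt P 0 * Ψ β x = sOp D 0 (Ψ β) x) := by
    intro x
    have n1 := D.two_mul_ne x.1 x.2
    have n2 := D.kfun_ne x.1 x.2
    rw [funext_iff]
    refine forall_congr' fun β => ?_
    rw [sOp_eq, diffOp_apply, sCoeff, if_neg (by simp), loopWt_zero, KMat, Matrix.smul_mulVec,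
      Matrix.add_mulVec, Matrix.smul_mulVec, Matrix.one_mulVec, Matrix.smul_mulVec]
    simp only [Pi.smul_apply, Pi.add_apply, smul_eq_mul, ← eFam_apply, neg_neg]
    have q := kfun_sub hq (x.1 0)
    rw [show 2 * -x.1 0 = -(2 * x.1 0) by ring, qn_neg]
    show _ = Ψ β (move D 0 x) ↔ _
    simp only [ket]
    rw [inv_mul_eq_iff_eq_mul₀ n2]
    generalize qn P (2 * x.1 0) = t at *
    constructor
    · intro h
      field_simp
      linear_combination -h - q * Ψ β x
    · intro h
      field_simp at h
      linear_combination -h - q * Ψ β x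
  constructor
  · rintro ⟨k1, k2, k3⟩
    refine ⟨fun i β => funext fun x => ?_, fun β x => (congrFun (k3 x) β).symm⟩
    by_cases hi : 1 ≤ (i : ℕ)
    · exact (h1 i hi x).1 (k1 i hi x) β
    · obtain rfl : i = 0 := Fin.ext (by simpa using hi)
      have := (h2 x).1 (k2 x) β
      simpa using this
  · rintro ⟨k1, k2⟩
    refine ⟨fun i hi x => (h1 i hi x).2 fun β => congrFun (k1 i β) x,
      fun x => (h2 x).2 fun β => ?_, fun x => funext fun β => (k2 β x).symm⟩
    have := congrFun (k1 0 β) x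
    simpa using this

/-- The qKZ equations say that the coefficient map intertwines the dual representation with the
functional representation. -/
theorem qkz_iff_intertwining (hq : Complex.exp P.η ≠ Complex.exp (-P.η))
    (hω : qn P (P.ω + 1) ≠ 0) :
    QKZ Ψ ↔ (∀ i < N, ∀ f, coeffMap Ψ (sDual P N i f) = sFun D i (coeffMap Ψ f)) ∧
        ∀ β x, Ψ β (moveLast D x) = Ψ β x := by
  rw [qkz_iff Ψ hq hω]
  refine and_congr_left fun _ => ⟨fun h i hi f => ?_, fun h i β => ?_⟩
  · have e := coeffMap_eDual Ψ ⟨i, hi⟩ f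
    simp only at e
    have e2 : sDual P N i f = eDual P N i f + loopWt P i • f := by simp [sDual]
    rw [e2, map_add, map_smul, e, coeffMap_apply, map_sum, Finset.smul_sum,
      ← Finset.sum_add_distrib]
    refine Finset.sum_congr rfl fun β _ => ?_
    rw [map_smul, sFun_of_lt hi, ← h ⟨i, hi⟩ β, smul_add, smul_comm]
  · have e := h i i.2 (delta N (extHeights β.1))
    have e2 : sDual P N i (delta N (extHeights β.1)) = eDual P N i (delta N (extHeights β.1)) +
      loopWt P i • (delta N (extHeights β.1)) := by simp [sDual]
    rw [e2, map_add, map_smul, coeffMap_eDual_delta, coeffMap_delta, sFun_of_lt i.2] at e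
    exact e

end QKZ

/-! ### Naturality and closure of the vectors of the paths -/

section Natural

variable {P : Params} {N : ℕ} {M M' : Type*} [AddCommGroup M] [Module ℂ M] [AddCommGroup M']
  [Module ℂ M'] {s : ℕ → Module.End ℂ M} {s' : ℕ → Module.End ℂ M'}

/-- A homomorphism of representations maps the vectors of the paths to each other. -/
theorem map_tileVec (H : HeckeRep P N s) (H' : HeckeRep P N s') (φ : M →ₗ[ℂ] M')
    (hφ : ∀ i < N, ∀ w, φ (s i w) = s' i (φ w)) (c : ℕ → ℕ → ℕ) {a : ℕ → ℤ} (ha : IsPath N a)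
    (v : M) : φ (tileVec P N s c a v) = tileVec P N s' c a (φ v) := by
  induction h : defect N a using Nat.strong_induction_on generalizing a with
  | _ n ih =>
    by_cases htop : a = topPath N
    · rw [htop, tileVec_top H, tileVec_top H']
    · obtain ⟨e, he, hv, -⟩ := ha.exists_valley (topPath_isPath N) ha.le_top htop
      rw [tileVec_step H c ha hv, tileVec_step H' c ha hv, baxtOp_apply, baxtOp_apply, map_sub,
        map_smul, hφ e he, ih _ (h ▸ defect_raise_lt ha hv) (ha.raise hv) rfl]

theorem map_hVec (H : HeckeRep P N s) (H' : HeckeRep P N s') (φ : M →ₗ[ℂ] M')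
    (hφ : ∀ i < N, ∀ w, φ (s i w) = s' i (φ w)) {a : ℕ → ℤ} (ha : IsPath N a)
    (v : M) : φ (hVec P N s a v) = hVec P N s' a (φ v) :=
  map_tileVec H H' φ hφ _ ha v

/-- As there are no tiles above a Ballot path in the column `N - 1`, an operator need not commute
with `s_{N-1}` in order to commute with the factors of the tiles. -/
theorem map_tileVec_of_isBal (H : HeckeRep P N s) (φ : M →ₗ[ℂ] M)
    (hφ : ∀ i, i + 1 < N → ∀ w, φ (s i w) = s i (φ w)) (c : ℕ → ℕ → ℕ) {a : ℕ → ℤ}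
    (ha : IsBal N a) (v : M) : φ (tileVec P N s c a v) = tileVec P N s c a (φ v) := by
  induction h : defect N a using Nat.strong_induction_on generalizing a with
  | _ n ih =>
    have hp := ha.toIsPath
    by_cases htop : a = topPath N
    · rw [htop, tileVec_top H, tileVec_top H]
    · obtain ⟨e, he, hv, -⟩ := hp.exists_valley (topPath_isPath N) hp.le_top htop
      have he' : e + 1 < N := by
        by_contra hc
        have e1 := hp.tail (e + 1) (by omega)
        have e2 := ha.nonneg e he.le
        have e3 := hv.2
        push_cast at e1
        omega
      have hb : IsBal N (raiseAt a e) :=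
        ⟨hp.raise hv, fun x hx => (ha.nonneg x hx).trans (le_raiseAt a e x)⟩
      rw [tileVec_step H c hp hv v, tileVec_step H c hp hv (φ v), baxtOp_apply, baxtOp_apply,
        map_sub, map_smul, hφ e he', ih _ (h ▸ defect_raise_lt hp hv) hb rfl]

/-- If the truncation conditions hold, then the span of the vectors of the Ballot paths is stable
under the action of the generators. -/
theorem apply_hVec_mem_span (G : Generic P N) (H : HeckeRep P N s) {v : M}
    (hv : ∀ i, 1 ≤ i → i < N → IsSym P s i v)
    (htr : ∀ m < N, ((m : ℤ) - N) % 2 = 1 → hVec P N s (gammaPath N m) v = 0) {b : ℕ → ℤ}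
    (hb : IsBal N b) {i : ℕ} (hi : i < N) :
    s i (hVec P N s b v) ∈
      Submodule.span ℂ (Set.range fun a : Bal N => hVec P N s a.1 v) := by
  have mem : ∀ a, IsPath N a → hVec P N s a v ∈
      Submodule.span ℂ (Set.range fun a : Bal N => hVec P N s a.1 v) := by
    intro a ha
    by_cases h : ∀ m ≤ N, 0 ≤ a m
    · exact Submodule.subset_span ⟨⟨a, ha, h⟩, rfl⟩
    · push Not at h
      obtain ⟨m, hm, hm'⟩ := h
      rw [hVec_eq_zero_of_truncation H htr ha (m := m) _ hm']
      · exact Submodule.zero_mem _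
      · rcases hm.eq_or_lt with rfl | h
        · rw [ha.tail m le_rfl] at hm'
          omega
        · exact h
  by_cases hp : IsPeak b i
  · have h1 := hb.nonneg (i + 1) hi
    have h2 := hp.2
    have ha := hb.toIsPath.lower hp hi (by omega)
    have hval := hb.toIsPath.valley_lower hp
    have h3 := (weak_triangularity G H hv ha).1 i hval
    rw [raiseAt_lowerAt] at h3
    have h4 : aboveSpan P N s v (lowerAt b i) ≤
        Submodule.span ℂ (Set.range fun a : Bal N => hVec P N s a.1 v) := by
      refine Submodule.span_le.2 ?_
      rintro _ ⟨a, ha, -, -, rfl⟩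
      exact mem a ha
    have := Submodule.add_mem _ (h4 h3) (mem _ ha)
    rwa [sub_add_cancel] at this
  · have := isSym_hVec G H hv hb.toIsPath hi hp
    rw [IsSym] at this
    rw [this]
    exact Submodule.smul_mem _ _ (mem b hb.toIsPath)

theorem HeckeRep.prod (H : HeckeRep P N s) (H' : HeckeRep P N s') :
    HeckeRep P N fun i => (s i).prodMap (s' i) := by
  have hmul : ∀ (f g : Module.End ℂ M) (f' g' : Module.End ℂ M'),
      (f.prodMap f' * g.prodMap g' : Module.End ℂ (M × M')) = (f * g).prodMap (f' * g') :=
    fun _ _ _ _ => rfl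
  have hsub : ∀ (f g : Module.End ℂ M) (f' g' : Module.End ℂ M'),
      (f.prodMap f' - g.prodMap g' : Module.End ℂ (M × M')) = (f - g).prodMap (f' - g') := by
    intro f g f' g'
    ext x <;> simp
  refine ⟨fun i hi => ?_, fun i j hij hj => ?_, fun i hi hN => ?_, fun hN => ?_⟩
  · simp only [hmul, H.sq i hi, H'.sq i hi]
    ext x <;> simp
  · simp only [hmul, H.comm i j hij hj, H'.comm i j hij hj]
  · simp only [hmul, hsub, H.braid i hi hN, H'.braid i hi hN]
  · simp only [hmul, hsub, H.braid₀ hN, H'.braid₀ hN]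

end Natural

/-! ### The symmetry of the base function -/

section PairProd

variable {N : ℕ}

theorem swap_prev_lt {i : Fin N} (hi : 1 ≤ (i : ℕ)) {a b : Fin N}
    (h : a < b ∧ (a, b) ≠ (prev i, i)) :
    Equiv.swap (prev i) i a < Equiv.swap (prev i) i b ∧
      (Equiv.swap (prev i) i a, Equiv.swap (prev i) i b) ≠ (prev i, i) := by
  have hp : ((prev i : Fin N) : ℕ) = i - 1 := rfl
  simp only [Equiv.swap_apply_def, Ne, Prod.mk.injEq, Fin.ext_iff, Fin.lt_def] at *
  split_ifs <;> omega

theorem prod_Ioi_eq_prod_filter (g : Fin N × Fin N → ℂ) :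
    ∏ a, ∏ b ∈ Finset.Ioi a, g (a, b) = ∏ t with t.1 < t.2, g t := by
  rw [Finset.prod_filter, Fintype.prod_prod_type]
  refine Finset.prod_congr rfl fun a _ => ?_
  rw [← Finset.prod_filter]
  refine Finset.prod_congr ?_ fun _ _ => rfl
  ext b
  simp

/-- Under the exchange of two neighbouring variables only one factor of a product over pairs
changes. -/
theorem exists_prod_swapVars (f : ℂ → ℂ → ℂ) {i : Fin N} (hi : 1 ≤ (i : ℕ)) (x : Fin N → ℂ) :
    ∃ Q, ∏ a, ∏ b ∈ Finset.Ioi a, f (x a) (x b) = f (x (prev i)) (x i) * Q ∧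
      ∏ a, ∏ b ∈ Finset.Ioi a, f (swapVars i x a) (swapVars i x b) =
        f (x i) (x (prev i)) * Q := by
  classical
  have hm : (prev i, i) ∈ (Finset.univ.filter fun t : Fin N × Fin N => t.1 < t.2) := by
    have hp : ((prev i : Fin N) : ℕ) = i - 1 := rfl
    simp only [Finset.mem_filter, Finset.mem_univ, true_and, Fin.lt_def]
    omega
  refine ⟨∏ t ∈ (Finset.univ.filter fun t : Fin N × Fin N => t.1 < t.2).erase (prev i, i),
    f (x t.1) (x t.2), ?_, ?_⟩
  · rw [prod_Ioi_eq_prod_filter fun t => f (x t.1) (x t.2), ← Finset.mul_prod_erase _ _ hm]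
  · rw [prod_Ioi_eq_prod_filter fun t => f (swapVars i x t.1) (swapVars i x t.2),
      ← Finset.mul_prod_erase _ _ hm]
    congr 1
    · simp [swapVars]
    · refine Finset.prod_equiv
        (Equiv.prodCongr (Equiv.swap (prev i) i) (Equiv.swap (prev i) i)) ?_ fun _ _ => rfl
      rintro ⟨a, b⟩
      simp only [Finset.mem_erase, Finset.mem_filter, Finset.mem_univ, true_and,
        Equiv.prodCongr_apply, Prod.map_apply]
      constructor
      · exact fun h => (swap_prev_lt hi h.symm).symm
      · intro h
        have := swap_prev_lt hi h.symm
        simp only [Equiv.swap_apply_self] at this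
        exact this.symm

/-- The prefactor `Δ^-_1 Δ^+_{λ+1}` of the base function. -/
noncomputable def baseFactor (P : Params) (x : Fin N → ℂ) : ℂ :=
  deltaMinus P 1 x * deltaPlus P (P.lam + 1) x

theorem baseFactor_eq {P : Params} (x : Fin N → ℂ) : baseFactor P x =
    ∏ a, ∏ b ∈ Finset.Ioi a, qn P (1 + x a - x b) * qn P (P.lam + 1 + x a + x b) := by
  simp only [baseFactor, deltaMinus, deltaPlus, Finset.prod_mul_distrib]

theorem swapVars_swapVars (i : Fin N) (x : Fin N → ℂ) : swapVars i (swapVars i x) = x := by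
  funext j
  simp [swapVars]

theorem baseFactor_swapVars {P : Params} {i : Fin N} (hi : 1 ≤ (i : ℕ)) (x : Fin N → ℂ) :
    qn P (1 - (x (prev i) - x i)) * baseFactor P x =
      qn P (1 + (x (prev i) - x i)) * baseFactor P (swapVars i x) := by
  obtain ⟨Q, h1, h2⟩ := exists_prod_swapVars
    (fun u v => qn P (1 + u - v) * qn P (P.lam + 1 + u + v)) hi x
  rw [baseFactor_eq, baseFactor_eq, h1, h2]
  rw [show 1 - (x (prev i) - x i) = 1 + x i - x (prev i) by ring,
    show 1 + (x (prev i) - x i) = 1 + x (prev i) - x i by ring,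
    show P.lam + 1 + x i + x (prev i) = P.lam + 1 + x (prev i) + x i by ring]
  ring

end PairProd

section Invariance

variable {N : ℕ} {T : Type*} {F : (Fin N → ℂ) → T}

/-- The exchanges of neighbouring variables generate all permutations. -/
theorem invariant_perm (h : ∀ i : Fin N, 1 ≤ (i : ℕ) → ∀ x, F (swapVars i x) = F x)
    (σ : Equiv.Perm (Fin N)) (x : Fin N → ℂ) : F (fun j => x (σ j)) = F x := by
  cases N with
  | zero => congr 1; funext j; exact j.elim0
  | succ n =>
    let S : Submonoid (Equiv.Perm (Fin (n + 1))) :=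
      { carrier := {σ | ∀ x : Fin (n + 1) → ℂ, F (fun j => x (σ j)) = F x}
        one_mem' := fun x => rfl
        mul_mem' := fun {σ τ} hσ hτ x => (hτ fun j => x (σ j)).trans (hσ x) }
    have hS : S = ⊤ := by
      rw [eq_top_iff, ← Equiv.Perm.mclosure_swap_castSucc_succ, Submonoid.closure_le]
      rintro _ ⟨i, rfl⟩ x
      exact h i.succ (by simp) x
    exact (hS ▸ Submonoid.mem_top σ : σ ∈ S) x

/-- Every reflection of a variable is conjugate to the reflection of the last variable. -/
theorem invariant_update [NeZero N] (P : Params)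
    (h : ∀ i : Fin N, 1 ≤ (i : ℕ) → ∀ x, F (swapVars i x) = F x)
    (hl : ∀ x, F (reflLast P x) = F x) (b : Fin N) (x : Fin N → ℂ) :
    F (Function.update x b (-P.lam - x b)) = F x := by
  have h1 := invariant_perm h (Equiv.swap b (lastVar N))
  rw [← h1, ← h1 x, ← hl fun j => x (Equiv.swap b (lastVar N) j)]
  congr 1
  funext j
  simp only [reflLast, Function.update_apply, Equiv.swap_apply_right]
  by_cases hj : j = lastVar N
  · simp [hj]
  · rw [if_neg hj, if_neg]
    rw [Equiv.swap_apply_eq_iff, Equiv.swap_apply_left]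
    exact hj

end Invariance

section Base

variable {P : Params} {N : ℕ} [NeZero N] {D : Domain P N}

theorem reflLast_reflLast (x : Fin N → ℂ) : reflLast P (reflLast P x) = x := by
  simp [reflLast]

theorem swapVars_mem_iff (D : Domain P N) (i : Fin N) (hi : 1 ≤ (i : ℕ)) (x : Fin N → ℂ) :
    swapVars i x ∈ D.carrier ↔ x ∈ D.carrier :=
  ⟨fun h => swapVars_swapVars i x ▸ D.swap_mem i hi _ h, D.swap_mem i hi x⟩

theorem reflLast_mem_iff (D : Domain P N) (x : Fin N → ℂ) :
    reflLast P x ∈ D.carrier ↔ x ∈ D.carrier :=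
  ⟨fun h => reflLast_reflLast (P := P) x ▸ D.reflLast_mem _ h, D.reflLast_mem x⟩

/-- The stability of the domain carries the non-vanishing for neighbouring variables over to all
pairs. -/
theorem one_add_sub_ne (D : Domain P N) {x : Fin N → ℂ} (hx : x ∈ D.carrier) {a b : Fin N}
    (hab : a ≠ b) : qn P (1 + (x a - x b)) ≠ 0 := by
  have hN : 1 < N := by
    have : (a : ℕ) ≠ b := fun e => hab (Fin.ext e)
    omega
  have h01 : prev (⟨1, hN⟩ : Fin N) ≠ ⟨1, hN⟩ := by simp [prev]
  set o : Fin N := ⟨1, hN⟩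
  set σ : Equiv.Perm (Fin N) :=
    Equiv.swap (Equiv.swap (prev o) a o) b * Equiv.swap (prev o) a with hσ
  have h1 : σ o = b := by simp [hσ]
  have h2 : σ (prev o) = a := by
    rw [hσ, Equiv.Perm.mul_apply, Equiv.swap_apply_left, Equiv.swap_apply_of_ne_of_ne _ hab]
    intro e
    apply h01
    apply (Equiv.swap (prev o) a).injective
    rw [← e, Equiv.swap_apply_left]
  have hy : (fun j => x (σ j)) ∈ D.carrier :=
    (invariant_perm (F := fun x => x ∈ D.carrier)
      (fun i hi x => propext (swapVars_mem_iff D i hi x)) σ x).mpr hx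
  have := D.one_add_diff_ne o le_rfl _ hy
  rwa [h1, h2] at this

theorem baseFactor_ne {x : Fin N → ℂ} (hx : x ∈ D.carrier) : baseFactor P x ≠ 0 := by
  rw [baseFactor_eq]
  refine Finset.prod_ne_zero_iff.2 fun a _ => Finset.prod_ne_zero_iff.2 fun b hb => ?_
  have hab : a ≠ b := (Finset.mem_Ioi.1 hb).ne
  have hy : Function.update x b (-P.lam - x b) ∈ D.carrier :=
    (invariant_update (F := fun x => x ∈ D.carrier) P
      (fun i hi x => propext (swapVars_mem_iff D i hi x))
      (fun x => propext (reflLast_mem_iff D x)) b x).mpr hx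
  have h1 := one_add_sub_ne D hx hab
  have h2 := one_add_sub_ne D hy hab
  rw [Function.update_self, Function.update_of_ne hab] at h2
  refine mul_ne_zero ?_ ?_
  · rwa [show 1 + x a - x b = 1 + (x a - x b) by ring]
  · rwa [show P.lam + 1 + x a + x b = 1 + (x a - (-P.lam - x b)) by ring]

theorem baseFactor_reflLast (x : Fin N → ℂ) :
    baseFactor P (reflLast P x) = baseFactor P x := by
  rw [baseFactor_eq, baseFactor_eq]
  refine Finset.prod_congr rfl fun a _ => Finset.prod_congr rfl fun b hb => ?_
  have hab := Finset.mem_Ioi.1 hb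
  have ha : a ≠ lastVar N := by
    have : ((lastVar N : Fin N) : ℕ) = N - 1 := rfl
    rw [Ne, Fin.ext_iff]
    have := b.2
    have := Fin.lt_def.1 hab
    omega
  simp only [reflLast, Function.update_apply, if_neg ha]
  split_ifs with h
  · subst h
    rw [mul_comm]
    congr 2 <;> ring
  · rfl

theorem isSym_sFun_iff (hq : Complex.exp P.η ≠ Complex.exp (-P.η)) {i : Fin N}
    (hi : 1 ≤ (i : ℕ)) (ψ : Fn D) : IsSym P (sFun D) i ψ ↔ ∀ x : D.carrier,
      qn P (1 - (x.1 (prev i) - x.1 i)) * ψ x =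
        qn P (1 + (x.1 (prev i) - x.1 i)) * ψ (move D i x) := by
  rw [IsSym, sFun_of_lt i.2, funext_iff]
  refine forall_congr' fun x => ?_
  have n1 := D.diff_ne i hi x.1 x.2
  rw [sOp_eq, diffOp_apply, sCoeff, if_pos hi, loopWt_pos hi, Pi.smul_apply, smul_eq_mul]
  set d := x.1 (prev i) - x.1 i with hd
  have q := qn_two_mul hq d
  rw [show d - 1 = -(1 - d) by ring, qn_neg] at q
  rw [add_comm d 1] at q ⊢
  constructor
  · intro h
    field_simp at h
    linear_combination h + q * ψ x
  · intro h
    field_simp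
    linear_combination h - q * ψ x

/-- The ansatz for the base function says that it is symmetric for the generators `s_i`, `i ≥ 1`,
and invariant under the reflection of the last variable. -/
theorem baseAnsatz_iff (hq : Complex.exp P.η ≠ Complex.exp (-P.η)) (ψ : Fn D) :
    BaseAnsatz D ψ ↔ (∀ i : ℕ, 1 ≤ i → i < N → IsSym P (sFun D) i ψ) ∧
      ∀ x, ψ (moveLast D x) = ψ x := by
  constructor
  · rintro ⟨ξ, ⟨hs, he⟩, h⟩
    refine ⟨fun i h1 hi => (isSym_sFun_iff hq (i := ⟨i, hi⟩) h1 ψ).2 fun x => ?_, fun x => ?_⟩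
    · have e : (move D ⟨i, hi⟩ x).1 = swapVars ⟨i, hi⟩ x.1 := funext (move_pos h1 x)
      have e2 := hs (Equiv.swap (prev ⟨i, hi⟩) ⟨i, hi⟩) fun j => x.1 j + P.lam / 2
      have e3 := baseFactor_swapVars (P := P) (i := ⟨i, hi⟩) h1 x.1
      rw [h, h, e, ← baseFactor, ← baseFactor, ← mul_assoc, e3, ← e2, mul_assoc]
      rfl
    · have e3 := baseFactor_reflLast (P := P) x.1
      rw [baseFactor, baseFactor] at e3
      rw [h, h]
      change deltaMinus P 1 (reflLast P x.1) * deltaPlus P (P.lam + 1) (reflLast P x.1) *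
        ξ (fun j => reflLast P x.1 j + P.lam / 2) = _
      rw [e3, ← he (lastVar N) fun j => x.1 j + P.lam / 2]
      congr 2
      funext j
      simp only [reflLast, Function.update_apply]
      split_ifs <;> ring
  · rintro ⟨h1, h2⟩
    classical
    -- the quotient by the prefactor, extended by zero to a function on all of `ℂ^N`
    let F : (Fin N → ℂ) → ℂ := fun x => if h : x ∈ D.carrier then ψ ⟨x, h⟩ / baseFactor P x else 0
    have F1 : ∀ i : Fin N, 1 ≤ (i : ℕ) → ∀ x, F (swapVars i x) = F x := by
      intro i hi x
      by_cases hx : x ∈ D.carrier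
      · have hy := D.swap_mem i hi x hx
        have e := (isSym_sFun_iff hq hi ψ).1 (h1 i hi i.2) ⟨x, hx⟩
        have e' : move D i ⟨x, hx⟩ = ⟨swapVars i x, hy⟩ := by
          rw [move, dif_pos hi]
        have e2 := baseFactor_swapVars (P := P) hi x
        have n0 := D.one_add_diff_ne i hi x hx
        have n1 := baseFactor_ne hx
        have n2 := baseFactor_ne hy
        rw [e'] at e
        simp only [F, dif_pos hx, dif_pos hy]
        rw [div_eq_div_iff n2 n1]
        refine mul_left_cancel₀ n0 ?_
        linear_combination -baseFactor P x * e + ψ ⟨x, hx⟩ * e2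
      · have hy : swapVars i x ∉ D.carrier := fun h => hx ((swapVars_mem_iff D i hi x).1 h)
        simp only [F, dif_neg hx, dif_neg hy]
    have F2 : ∀ x, F (reflLast P x) = F x := by
      intro x
      by_cases hx : x ∈ D.carrier
      · have hy := D.reflLast_mem x hx
        have e : ψ ⟨reflLast P x, hy⟩ = ψ ⟨x, hx⟩ := h2 ⟨x, hx⟩
        simp only [F, dif_pos hx, dif_pos hy, e, baseFactor_reflLast]
      · have hy : reflLast P x ∉ D.carrier := fun h => hx ((reflLast_mem_iff D x).1 h)
        simp only [F, dif_neg hx, dif_neg hy]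
    refine ⟨fun y => F fun j => y j - P.lam / 2, ⟨fun σ y => ?_, fun i y => ?_⟩, fun x => ?_⟩
    · exact invariant_perm F1 σ fun j => y j - P.lam / 2
    · simp only
      rw [← invariant_update P F1 F2 i fun j => y j - P.lam / 2]
      congr 1
      funext j
      simp only [Function.update_apply]
      split_ifs <;> ring
    · have n1 := baseFactor_ne x.2
      simp only [add_sub_cancel_right, F, dif_pos x.2]
      change ψ x = baseFactor P x.1 * (ψ x / baseFactor P x.1)
      field_simp

end Base

/-! ### The solutions of the qKZ equations -/

section Delta

variable {N : ℕ}

theorem delta_eq_zero {a : ℕ → ℤ} (ha : ¬ IsBal N a) : delta N a = 0 := by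
  funext b
  simp only [delta, Pi.zero_apply, ite_eq_right_iff, one_ne_zero, imp_false]
  exact fun e => ha (e ▸ b.2)

theorem delta_gammaPath {m : ℕ} (hm : m < N) : delta N (gammaPath N m) = 0 := by
  refine delta_eq_zero fun h => ?_
  have h1 := h.nonneg m hm.le
  rw [gammaPath_self hm] at h1
  omega

end Delta

section Solutions

variable {P : Params} {N : ℕ} [NeZero N] {D : Domain P N}

/-- The generators `s_i`, `i ≤ N - 2`, do not involve the last variable. -/
theorem sFun_funLeft_moveLast {i : ℕ} (hi : i + 1 < N) (f : Fn D) :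
    LinearMap.funLeft ℂ ℂ (moveLast D) (sFun D i f) =
      sFun D i (LinearMap.funLeft ℂ ℂ (moveLast D) f) := by
  rw [sFun_of_lt (by omega)]
  set k : Fin N := ⟨i, by omega⟩ with hk
  have hl : ((lastVar N : Fin N) : ℕ) = N - 1 := rfl
  have hp : ((prev k : Fin N) : ℕ) = i - 1 := rfl
  have hne : ∀ j : Fin N, (j : ℕ) + 1 < N → j ≠ lastVar N := fun j hj e => by
    rw [e, hl] at hj
    omega
  have hx : ∀ (x : D.carrier) (j : Fin N), (j : ℕ) + 1 < N → (moveLast D x).1 j = x.1 j :=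
    fun x j hj => Function.update_of_ne (hne j hj) _ _
  have hx' : ∀ (x : D.carrier) (j : Fin N), (moveLast D x).1 j =
      if j = lastVar N then -P.lam - x.1 (lastVar N) else x.1 j :=
    fun x j => Function.update_apply _ _ _ _
  have h0 : ((0 : Fin N) : ℕ) = 0 := rfl
  have hc : ∀ x : D.carrier, sCoeff D k (moveLast D x) = sCoeff D k x := fun x => by
    simp only [sCoeff]
    rw [hx x (prev k) (by omega), hx x k hi, hx x 0 (by omega)]
  have hm : ∀ x : D.carrier, move D k (moveLast D x) = moveLast D (move D k x) := fun x => by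
    refine Subtype.ext (funext fun j => ?_)
    rcases Nat.eq_zero_or_pos (k : ℕ) with h | h
    · rw [hx', move_zero_of_ne h _ (j := lastVar N) (by omega), move_zero h, move_zero h,
        hx x 0 (by omega), hx']
      by_cases hj : j = 0
      · have := hne 0 (by omega)
        simp [hj, this]
      · simp [hj]
    · have hk' : (k : ℕ) = i := rfl
      rw [hx', move_of_ne h _ (j := lastVar N) (by omega) (by omega), move_pos h, move_pos h, hx']
      refine if_congr ?_ rfl rfl
      rw [Equiv.swap_apply_eq_iff, Equiv.swap_apply_of_ne_of_ne]
      · exact (hne _ (by omega)).symm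
      · exact (hne _ hi).symm
  rw [sOp_eq]
  refine funext fun x => ?_
  simp only [LinearMap.funLeft_apply, diffOp_apply, hc, hm]

/-- A solution of the qKZ equations is given by its base function, which is symmetric and satisfies
the truncation conditions. -/
theorem QKZ.isSym_hVec_truncation (G : Generic P N) {Ψ : BallotPath N → Fn D} (h : QKZ Ψ) :
    (∀ i, 1 ≤ i → i < N → IsSym P (sFun D) i (Ψ (omega N))) ∧
      (∀ α, Ψ α = HOp D α.1 (Ψ (omega N))) ∧ Truncation D (Ψ (omega N)) := by
  have H := sFun_heckeRep (D := D) G.hq G.hω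
  obtain ⟨h1, -⟩ := (qkz_iff_intertwining Ψ G.hq G.hω).1 h
  have hΩ : coeffMap Ψ (delta N (topPath N)) = Ψ (omega N) := by
    rw [← extHeights_omega, coeffMap_delta]
  have key : ∀ a, IsPath N a → hVec P N (sFun D) a (Ψ (omega N)) = coeffMap Ψ (delta N a) := by
    intro a ha
    rw [← hΩ, ← map_hVec (sDual_heckeRep) H (coeffMap Ψ) h1 ha, hVec_delta G ha]
  refine ⟨fun i hi hN => ?_, fun α => ?_, ?_⟩
  · rw [IsSym, ← hΩ, ← h1 i hN, isSym_delta_top hi hN, map_smul]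
  · have hb := isBal_extHeights α.2
    rw [← coeffMap_delta Ψ α, ← key _ hb.toIsPath, ← HOp_toHeights H hb.toIsPath,
      toHeights_extHeights]
  · refine (truncation_iff H _).2 fun m hm hpar => ?_
    rw [key _ (gammaPath_isPath hm hpar), delta_gammaPath hm, map_zero]

/-- A symmetric function which satisfies the truncation conditions gives a solution of the qKZ
equations. The span of the pairs `(ψ_α, δ_α)` in the product of the functional representation with
the dual path representation is stable and is contained in the graph of `coeffMap Ψ`. -/
theorem sOp_eq_eFam (G : Generic P N) {Ψ : BallotPath N → Fn D}
    (hs : ∀ i, 1 ≤ i → i < N → IsSym P (sFun D) i (Ψ (omega N)))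
    (hΨ : ∀ α, Ψ α = HOp D α.1 (Ψ (omega N))) (ht : Truncation D (Ψ (omega N))) (i : Fin N)
    (β : BallotPath N) : eFam Ψ i β + loopWt P i • Ψ β = sOp D i (Ψ β) := by
  have H := sFun_heckeRep (D := D) G.hq G.hω
  have H' := sDual_heckeRep (P := P) (N := N)
  have HH := H.prod H'
  set v : Fn D × (Bal N → ℂ) := (Ψ (omega N), delta N (topPath N)) with hv
  have hpair : ∀ a, IsPath N a →
      hVec P N (fun i => (sFun D i).prodMap (sDual P N i)) a v =
        (hVec P N (sFun D) a (Ψ (omega N)), delta N a) := by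
    intro a ha
    refine Prod.ext ?_ ?_
    · exact map_hVec HH H (LinearMap.fst ℂ _ _) (fun _ _ _ => rfl) ha v
    · exact (map_hVec HH H' (LinearMap.snd ℂ _ _) (fun _ _ _ => rfl) ha v).trans
        (hVec_delta G ha)
  have hbal : ∀ α : BallotPath N,
      hVec P N (fun i => (sFun D i).prodMap (sDual P N i)) (extHeights α.1) v =
        (Ψ α, delta N (extHeights α.1)) := by
    intro α
    have hb := (isBal_extHeights α.2).toIsPath
    rw [hpair _ hb, ← HOp_toHeights H hb, toHeights_extHeights, ← hΨ]
  have hsym : ∀ i, 1 ≤ i → i < N →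
      IsSym P (fun i => (sFun D i).prodMap (sDual P N i)) i v := fun i h1 hi =>
    Prod.ext (hs i h1 hi) (isSym_delta_top h1 hi)
  have htr : ∀ m < N, ((m : ℤ) - N) % 2 = 1 →
      hVec P N (fun i => (sFun D i).prodMap (sDual P N i)) (gammaPath N m) v = 0 := by
    intro m hm hpar
    rw [hpair _ (gammaPath_isPath hm hpar), delta_gammaPath hm,
      (truncation_iff H _).1 ht m hm hpar, Prod.mk_zero_zero]
  have hmem := apply_hVec_mem_span G HH hsym htr (isBal_extHeights β.2) i.2
  have hle : Submodule.span ℂ (Set.range fun a : Bal N =>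
      hVec P N (fun i => (sFun D i).prodMap (sDual P N i)) a.1 v) ≤
        LinearMap.eqLocus (LinearMap.fst ℂ _ _) (coeffMap Ψ ∘ₗ LinearMap.snd ℂ _ _) := by
    refine Submodule.span_le.2 ?_
    rintro _ ⟨a, rfl⟩
    obtain ⟨α, rfl⟩ := (balEquiv N).surjective a
    have e : (balEquiv N α).1 = extHeights α.1 := rfl
    simp only [e, hbal]
    exact (coeffMap_delta Ψ α).symm
  have e := hle hmem
  rw [hbal] at e
  have e' : sFun D i (Ψ β) = coeffMap Ψ (sDual P N i (delta N (extHeights β.1))) := e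
  have e2 : sDual P N i (delta N (extHeights β.1)) = eDual P N i (delta N (extHeights β.1)) +
    loopWt P i • (delta N (extHeights β.1)) := by simp [sDual]
  rw [e2, map_add, map_smul, coeffMap_eDual_delta, coeffMap_delta, sFun_of_lt i.2] at e'
  exact e'.symm

/-- The invariance under the reflection of the last variable carries over from the base function. -/
theorem HOp_moveLast (G : Generic P N) {ψ : Fn D} (hψ : ∀ x, ψ (moveLast D x) = ψ x)
    (α : BallotPath N) (x : D.carrier) : HOp D α.1 ψ (moveLast D x) = HOp D α.1 ψ x := by
  have H := sFun_heckeRep (D := D) G.hq G.hω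
  have hb := isBal_extHeights α.2
  have hψ' : LinearMap.funLeft ℂ ℂ (moveLast D) ψ = ψ := funext hψ
  have e := map_tileVec_of_isBal H (LinearMap.funLeft ℂ ℂ (moveLast D))
    (fun _ hi w => sFun_funLeft_moveLast hi w) (ct N (extHeights α.1)) hb ψ
  rw [hψ'] at e
  have e2 := HOp_toHeights H hb.toIsPath ψ
  rw [toHeights_extHeights] at e2
  rw [e2]
  exact congrFun e x

/-- A family of functions solves the qKZ equations exactly if it is given by a base function of the
form of the ansatz which satisfies the truncation conditions. -/
theorem qkz_iff_baseAnsatz (G : Generic P N) (Ψ : BallotPath N → Fn D) :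
    QKZ Ψ ↔ BaseAnsatz D (Ψ (omega N)) ∧ (∀ α, Ψ α = HOp D α.1 (Ψ (omega N))) ∧
      Truncation D (Ψ (omega N)) := by
  rw [baseAnsatz_iff G.hq]
  constructor
  · intro h
    obtain ⟨h1, h2, h3⟩ := h.isSym_hVec_truncation G
    exact ⟨⟨h1, ((qkz_iff Ψ G.hq G.hω).1 h).2 _⟩, h2, h3⟩
  · rintro ⟨⟨h1, h2⟩, h3, h4⟩
    refine (qkz_iff Ψ G.hq G.hω).2 ⟨sOp_eq_eFam G h1 h3 h4, fun β x => ?_⟩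
    rw [h3 β]
    exact HOp_moveLast G h2 β x

end Solutions
end TypeBqKZ

theorem mainTheorem4 (P : TypeBqKZ.Params) (N : ℕ) [NeZero N]
    (hq : Complex.exp P.η ≠ Complex.exp (-P.η))
    (hqn : ∀ k : ℕ, 2 ≤ k → k ≤ N → TypeBqKZ.qn P k ≠ 0)
    (hω : TypeBqKZ.qn P (P.ω + 1) ≠ 0)
    (D : TypeBqKZ.Domain P N)
    (Ψ : TypeBqKZ.BallotPath N → TypeBqKZ.Fn D) :
    (TypeBqKZ.QKZ Ψ → TypeBqKZ.Truncation D (Ψ (TypeBqKZ.omega N))) ∧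
    (TypeBqKZ.QKZ Ψ ↔
      (TypeBqKZ.BaseAnsatz D (Ψ (TypeBqKZ.omega N)) ∧
        (∀ α : TypeBqKZ.BallotPath N, Ψ α = TypeBqKZ.HOp D α.1 (Ψ (TypeBqKZ.omega N))) ∧
        TypeBqKZ.Truncation D (Ψ (TypeBqKZ.omega N)))) := by
  have G : TypeBqKZ.Generic P N := by
    refine ⟨hq, hω, fun k h1 hN => ?_⟩
    rcases h1.eq_or_lt with rfl | h
    · rw [Nat.cast_one, TypeBqKZ.qn_one hq]
      exact one_ne_zero
    · exact hqn k h hN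
  have h := TypeBqKZ.qkz_iff_baseAnsatz G Ψ
  exact ⟨fun hΨ => (h.1 hΨ).2.2, h⟩
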